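/- Consider the two-user symmetric Gaussian interference channel with real gains $h_d,h_c$, $$y_1=h_dx_1+h_cx_2+z_1,\qquad y_2=h_dx_2+h_cx_1+z_2,$$ where $z_1,z_2\sim\mathcal N(0,1)$ are independent of each other, i.i.d. over time and independent of the messages and of the encoders' randomness. Transmitter $i$ has a uniformly distributed message $W_i$, $W_1$ and $W_2$ are independent, and each transmitter may use private randomness. In each direction the transmitters are joined by a noiseless secure link carrying at most $NC_G$ bits per block of $N$ channel uses ($C_G\ge 0$). The encoding is causal: the link symbol sent by a transmitter at time $k$ depends only on its message, its randomness and the link symbols it received before time $k$, and its channel input at time $k$ depends only on its message, its randomness and the link symbols it received up to time $k$. The inputs satisfy the average power constraint $\frac1N\sum_{k=1}^N E[x_{i,k}^2]\le P$ ($P\ge 0$, $i=1,2$). A symmetric secrecy rate $R_s$ (bits per channel use) is achievable if for every $\varepsilon>0$ and all sufficiently large $N$ there is such a code of block length $N$ in which both message sets have at least $2^{N(R_s-\varepsilon)}$ elements, receiver $i$ decodes $W_i$ from $\mathbf y_i^N$ with error probability at most $\varepsilon$, and weak secrecy holds: $\frac1N I(W_i;\mathbf y_j^N)\le\varepsilon$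 for $i\ne j$. Let $\mathrm{SNR}=h_d^2P$ and $\mathrm{INR}=h_c^2P$. Then every achievable symmetric secrecy rate satisfies $$R_s\le\max_{0\le|\rho|\le1}\frac13\Big[2C_G+\tfrac12\log_2\big(1+\mathrm{SNR}+\mathrm{INR}+2\rho\sqrt{\mathrm{SNR}\,\mathrm{INR}}\big)+\tfrac12\log_2\det\Sigma_{\bar y|\bar s}\Big],$$ where the maximum is attained, $\Sigma_{\bar y|\bar s}=\Sigma_{\bar y}-\Sigma_{\bar y,\bar s}\Sigma_{\bar s}^{-1}\Sigma_{\bar y,\bar s}^{T}$ and $$\Sigma_{\bar y}=\begin{pmatrix}1+\mathrm{SNR}+\mathrm{INR}+2\rho\sqrt{\mathrm{SNR}\,\mathrm{INR}}&2\sqrt{\mathrm{SNR}\,\mathrm{INR}}+\rho(\mathrm{SNR}+\mathrm{INR})\\2\sqrt{\mathrm{SNR}\,\mathrm{INR}}+\rho(\mathrm{SNR}+\mathrm{INR})&1+\mathrm{SNR}+\mathrm{INR}+2\rho\sqrt{\mathrm{SNR}\,\mathrm{INR}}\end{pmatrix},$$ $$\Sigma_{\bar y,\bar s}=\begin{pmatrix}\sqrt{\mathrm{SNR}\,\mathrm{INR}}+\rho\,\mathrm{INR}&\mathrm{INR}+\rho\sqrt{\mathrm{SNR}\,\mathrm{INR}}\\\mathrm{INR}+\rho\sqrt{\mathrm{SNR}\,\mathrm{INR}}&\sqrt{\mathrm{SNR}\,\mathrm{INR}}+\rho\,\mathrm{INR}\end{pmatrix},\qquad\Sigma_{\bar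 s}=\begin{pmatrix}1+\mathrm{INR}&\rho\,\mathrm{INR}\\\rho\,\mathrm{INR}&1+\mathrm{INR}\end{pmatrix}.$$ -/

import Mathlib

open MeasureTheory ProbabilityTheory

noncomputable section

namespace GSIC

/-! ### Information -/

/-- Mutual information `I(X;Y)` under `μ`, in nats: the Kullback-Leibler divergence of the joint law
from the product of the marginal laws. -/
def mutualInfo {Ω A B : Type*} [MeasurableSpace Ω] [MeasurableSpace A] [MeasurableSpace B]
    (μ : Measure Ω) (X : Ω → A) (Y : Ω → B) : ENNReal :=
  InformationTheory.klDiv (μ.map (fun ω => (X ω, Y ω))) ((μ.map X).prod (μ.map Y))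

/-! ### Codes for the two-user interference channel with conferencing transmitters -/

/-- A block code of length `N` with message sets `Fin M₁`, `Fin M₂`. Times are `0, …, N - 1`.
Each transmitter `i` has a private random variable with law `νᵢ` (stochastic encoding; a real random
variable of arbitrary law carries as much randomness as any standard Borel source).
At time `k` transmitter 1 puts the symbol `f₁₂ k w₁ θ₁ l` on the noiseless link to transmitter 2,
where `l` is the list of the symbols it has received over the reverse link at times `< k`; the
symbol belongs to an alphabet of size `size₁₂ k`. The channel input `x₁ k w₁ θ₁ l` may use the
list `l` of the symbols received at times `≤ k`, but no future ones. Symmetrically for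
transmitter 2. Receiver `i` decodes its message from its own output block. -/
structure Code (N M₁ M₂ : ℕ) where
  ν₁ : Measure ℝ
  ν₂ : Measure ℝ
  prob₁ : IsProbabilityMeasure ν₁
  prob₂ : IsProbabilityMeasure ν₂
  size₁₂ : ℕ → ℕ
  size₂₁ : ℕ → ℕ
  f₁₂ : ℕ → Fin M₁ → ℝ → List ℕ → ℕ
  f₂₁ : ℕ → Fin M₂ → ℝ → List ℕ → ℕ
  f₁₂_lt : ∀ k w θ l, f₁₂ k w θ l < size₁₂ k
  f₂₁_lt : ∀ k w θ l, f₂₁ k w θ l < size₂₁ k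
  measurable_f₁₂ : ∀ k w l, Measurable fun θ => f₁₂ k w θ l
  measurable_f₂₁ : ∀ k w l, Measurable fun θ => f₂₁ k w θ l
  x₁ : ℕ → Fin M₁ → ℝ → List ℕ → ℝ
  x₂ : ℕ → Fin M₂ → ℝ → List ℕ → ℝ
  measurable_x₁ : ∀ k w l, Measurable fun θ => x₁ k w θ l
  measurable_x₂ : ∀ k w l, Measurable fun θ => x₂ k w θ l
  dec₁ : (Fin N → ℝ) → Fin M₁
  dec₂ : (Fin N → ℝ) → Fin M₂
  measurable_dec₁ : Measurable dec₁
  measurable_dec₂ : Measurable dec₂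

/-- Sample space: (message 1, randomness 1), (message 2, randomness 2), noise block 1,
noise block 2. -/
abbrev Sample (N M₁ M₂ : ℕ) : Type :=
  (Fin M₁ × ℝ) × (Fin M₂ × ℝ) × (Fin N → ℝ) × (Fin N → ℝ)

namespace Code

variable {N M₁ M₂ : ℕ} (c : Code N M₁ M₂)

/-- The symbols `(v₁₂, v₂₁)` exchanged over the two cooperative links at times `< k`, each list in
chronological order. -/
def transcript (a₁ : Fin M₁ × ℝ) (a₂ : Fin M₂ × ℝ) : ℕ → List ℕ × List ℕ
  | 0 => ([], [])
  | k + 1 =>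
    ((transcript a₁ a₂ k).1 ++ [c.f₁₂ k a₁.1 a₁.2 (transcript a₁ a₂ k).2],
     (transcript a₁ a₂ k).2 ++ [c.f₂₁ k a₂.1 a₂.2 (transcript a₁ a₂ k).1])

/-- The law of the sample: uniform messages, private randomness and i.i.d. standard Gaussian noise,
all independent. -/
def law : Measure (Sample N M₁ M₂) :=
  ((uniformOn (Set.univ : Set (Fin M₁))).prod c.ν₁).prod
    (((uniformOn (Set.univ : Set (Fin M₂))).prod c.ν₂).prod
      ((Measure.pi fun _ : Fin N => gaussianReal 0 1).prod
        (Measure.pi fun _ : Fin N => gaussianReal 0 1)))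

/-- Message of transmitter 1. -/
def msg₁ (ω : Sample N M₁ M₂) : Fin M₁ := ω.1.1

/-- Message of transmitter 2. -/
def msg₂ (ω : Sample N M₁ M₂) : Fin M₂ := ω.2.1.1

/-- Channel input of transmitter 1 at time `k`. -/
def input₁ (ω : Sample N M₁ M₂) (k : Fin N) : ℝ :=
  c.x₁ k ω.1.1 ω.1.2 (c.transcript ω.1 ω.2.1 (k + 1)).2

/-- Channel input of transmitter 2 at time `k`. -/
def input₂ (ω : Sample N M₁ M₂) (k : Fin N) : ℝ :=
  c.x₂ k ω.2.1.1 ω.2.1.2 (c.transcript ω.1 ω.2.1 (k + 1)).1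

/-- Output block at receiver 1: `y₁ = h_d x₁ + h_c x₂ + z₁`. -/
def output₁ (hd hc : ℝ) (ω : Sample N M₁ M₂) (k : Fin N) : ℝ :=
  hd * c.input₁ ω k + hc * c.input₂ ω k + ω.2.2.1 k

/-- Output block at receiver 2: `y₂ = h_d x₂ + h_c x₁ + z₂`. -/
def output₂ (hd hc : ℝ) (ω : Sample N M₁ M₂) (k : Fin N) : ℝ :=
  hd * c.input₂ ω k + hc * c.input₁ ω k + ω.2.2.2 k

/-- In each direction the cooperative link carries at most `N * CG` bits per block. -/
def LinkConstraint (CG : ℝ) : Prop :=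
  ∑ k ∈ Finset.range N, Real.logb 2 (c.size₁₂ k) ≤ N * CG ∧
  ∑ k ∈ Finset.range N, Real.logb 2 (c.size₂₁ k) ≤ N * CG

/-- Average power constraint: `(1/N) ∑ₖ E[xᵢ,ₖ²] ≤ P` for `i = 1, 2`. -/
def PowerConstraint (P : ℝ) : Prop :=
  ∑ k, ∫⁻ ω, ENNReal.ofReal (c.input₁ ω k ^ 2) ∂c.law ≤ ENNReal.ofReal (N * P) ∧
  ∑ k, ∫⁻ ω, ENNReal.ofReal (c.input₂ ω k ^ 2) ∂c.law ≤ ENNReal.ofReal (N * P)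

/-- Each receiver decodes its own message with error probability at most `ε`. -/
def Reliable (hd hc ε : ℝ) : Prop :=
  c.law {ω | c.dec₁ (c.output₁ hd hc ω) ≠ msg₁ ω} ≤ ENNReal.ofReal ε ∧
  c.law {ω | c.dec₂ (c.output₂ hd hc ω) ≠ msg₂ ω} ≤ ENNReal.ofReal ε

/-- Weak secrecy up to `ε`: `I(W₁; y₂ᴺ) ≤ N ε` and `I(W₂; y₁ᴺ) ≤ N ε`, in bits. -/
def WeaklySecret (hd hc ε : ℝ) : Prop :=
  mutualInfo c.law msg₁ (c.output₂ hd hc) ≤ ENNReal.ofReal (N * ε * Real.log 2) ∧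
  mutualInfo c.law msg₂ (c.output₁ hd hc) ≤ ENNReal.ofReal (N * ε * Real.log 2)

end Code

/-- The rate pair `(R₁, R₂)` (bits per channel use) is achievable under weak secrecy: for every
`ε > 0` and all large block lengths there is an admissible code with rates at least `Rᵢ - ε`, error
probabilities at most `ε`, and leakage rates at most `ε`. -/
def Achievable (hd hc P CG R₁ R₂ : ℝ) : Prop :=
  ∀ ε : ℝ, 0 < ε → ∀ᶠ N : ℕ in Filter.atTop, ∃ M₁ M₂ : ℕ, 0 < M₁ ∧ 0 < M₂ ∧
    N * (R₁ - ε) ≤ Real.logb 2 M₁ ∧ N * (R₂ - ε) ≤ Real.logb 2 M₂ ∧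
    ∃ c : Code N M₁ M₂, c.LinkConstraint CG ∧ c.PowerConstraint P ∧
      c.Reliable hd hc ε ∧ c.WeaklySecret hd hc ε

/-- `R` is an achievable symmetric secrecy rate. -/
def SymmetricAchievable (hd hc P CG R : ℝ) : Prop :=
  Achievable hd hc P CG R R

/-! ### The outer bound -/

def sigmaY (SNR INR ρ : ℝ) : Matrix (Fin 2) (Fin 2) ℝ :=
  !![1 + SNR + INR + 2 * ρ * √(SNR * INR), 2 * √(SNR * INR) + ρ * (SNR + INR);
     2 * √(SNR * INR) + ρ * (SNR + INR), 1 + SNR + INR + 2 * ρ * √(SNR * INR)]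

def sigmaYS (SNR INR ρ : ℝ) : Matrix (Fin 2) (Fin 2) ℝ :=
  !![√(SNR * INR) + ρ * INR, INR + ρ * √(SNR * INR);
     INR + ρ * √(SNR * INR), √(SNR * INR) + ρ * INR]

def sigmaS (INR ρ : ℝ) : Matrix (Fin 2) (Fin 2) ℝ :=
  !![1 + INR, ρ * INR;
     ρ * INR, 1 + INR]

/-- The conditional covariance matrix of the outputs given the interference proxies. -/
def sigmaYgivenS (SNR INR ρ : ℝ) : Matrix (Fin 2) (Fin 2) ℝ :=
  sigmaY SNR INR ρ - sigmaYS SNR INR ρ * (sigmaS INR ρ)⁻¹ * (sigmaYS SNR INR ρ).transpose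

/-- The quantity that is maximized over `ρ`; logarithms are to base 2. -/
def outerBound (CG SNR INR ρ : ℝ) : ℝ :=
  (1 / 3) * (2 * CG + (1 / 2) * Real.logb 2 (1 + SNR + INR + 2 * ρ * √(SNR * INR))
    + (1 / 2) * Real.logb 2 (sigmaYgivenS SNR INR ρ).det)

end GSIC

end

/-!
All entropic inequalities below come from Gibbs' inequality: `E log f ≤ E log g` as soon as
`E (f / g) ≤ 1`. With `f` and `g` densities of output blocks, or their products, no differential
entropy has to be defined; `h(y)` below stands for `-E log f(y)`, with `f` the density of `y`.

Let `V` be the symbols on the links and `sᵢ` the noisy interference at receiver `i`.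

* Once a receiver has decoded its message its output still hides the interference, so that
  `I(Wᵢ; yᵢ) ≤ h(yᵢ) - h(sᵢ | V)`.
* The data of the two transmitters are independent given `V`, whence
  `h(s₁, s₂) ≤ h(s₁ | V) + h(s₂ | V) + log |V|`.
* Secrecy of `W₁` at receiver 2 gives `I(W₁; y₁) ≤ I(W₁; y₂) + h(y₁ | y₂) - h(z)`.
* If a genie supplies the interference `s'` with fresh noise, then
  `h(y₁, y₂) + 2 h(z) ≤ h(s₁', s₂') + h(y₁, y₂ | s₁', s₂')`, and `s'` has the law of `s`.

In the sum, `2 I(W₁; y₁) + I(W₂; y₂)` is at most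
`I(W₁; y₂) + log |V| + h(y₁) + h(y₁, y₂ | s₁', s₂') - 3 h(z)`. The last two entropies are bounded by
testing against Gaussian densities with the average correlation `ρ` of the inputs, the conditional
one along the sum and the difference of the users, where the covariance matrices are diagonal.
-/

noncomputable section

namespace GSIC

open scoped ENNReal NNReal

/-! ### Mean log-densities -/

section MeanLog

variable {Ω Ω' : Type*} [MeasurableSpace Ω] [MeasurableSpace Ω'] {P : Measure Ω} {P' : Measure Ω'}
  {f d : Ω → ℝ≥0∞}

/-- The mean logarithm `E log f`, in nats. With `f` the density of a random variable evaluated at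
that variable, it is minus a differential entropy. -/
def meanLog (P : Measure Ω) (f : Ω → ℝ≥0∞) : ℝ :=
  ∫ ω, Real.log (f ω).toReal ∂P

/-- `f` is almost surely positive and finite, and `log f` is integrable, so that `meanLog P f` is
not a junk value. -/
structure LogIntegrable (f : Ω → ℝ≥0∞) (P : Measure Ω) : Prop where
  ne_zero : ∀ᵐ ω ∂P, f ω ≠ 0
  ne_top : ∀ᵐ ω ∂P, f ω ≠ ∞
  integrable : Integrable (fun ω => Real.log (f ω).toReal) P

theorem LogIntegrable.log_mul_ae_eq (hf : LogIntegrable f P) (hd : LogIntegrable d P) :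
    (fun ω => Real.log (f ω * d ω).toReal) =ᵐ[P]
      fun ω => Real.log (f ω).toReal + Real.log (d ω).toReal := by
  filter_upwards [hf.ne_zero, hf.ne_top, hd.ne_zero, hd.ne_top] with ω hf0 hft hd0 hdt
  rw [ENNReal.toReal_mul, Real.log_mul (ENNReal.toReal_ne_zero.2 ⟨hf0, hft⟩)
    (ENNReal.toReal_ne_zero.2 ⟨hd0, hdt⟩)]

theorem LogIntegrable.mul (hf : LogIntegrable f P) (hd : LogIntegrable d P) :
    LogIntegrable (fun ω => f ω * d ω) P where
  ne_zero := by
    filter_upwards [hf.ne_zero, hd.ne_zero] with ω h₁ h₂ using mul_ne_zero h₁ h₂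
  ne_top := by
    filter_upwards [hf.ne_top, hd.ne_top] with ω h₁ h₂ using ENNReal.mul_ne_top h₁ h₂
  integrable := (hf.integrable.add hd.integrable).congr (hf.log_mul_ae_eq hd).symm

theorem meanLog_mul (hf : LogIntegrable f P) (hd : LogIntegrable d P) :
    meanLog P (fun ω => f ω * d ω) = meanLog P f + meanLog P d :=
  (integral_congr_ae (hf.log_mul_ae_eq hd)).trans (integral_add hf.integrable hd.integrable)

theorem LogIntegrable.comp_measurePreserving {T : Ω' → Ω} (hf : LogIntegrable f P)
    (hT : MeasurePreserving T P' P) : LogIntegrable (fun ω => f (T ω)) P' where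
  ne_zero := hT.quasiMeasurePreserving.ae hf.ne_zero
  ne_top := hT.quasiMeasurePreserving.ae hf.ne_top
  integrable := hT.integrable_comp_of_integrable hf.integrable

theorem meanLog_comp_measurePreserving {T : Ω' → Ω} (hf : LogIntegrable f P)
    (hT : MeasurePreserving T P' P) : meanLog P' (fun ω => f (T ω)) = meanLog P f := by
  have hm := hf.integrable.aestronglyMeasurable
  rw [← hT.map_eq] at hm
  rw [meanLog, meanLog, ← hT.map_eq, integral_map hT.aemeasurable hm]

theorem LogIntegrable.of_map {T : Ω' → Ω} (hT : Measurable T) (hfm : Measurable f)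
    (hf : LogIntegrable (fun ω => f (T ω)) P') : LogIntegrable f (P'.map T) where
  ne_zero := (ae_map_iff hT.aemeasurable (hfm (measurableSet_singleton 0).compl)).2 hf.ne_zero
  ne_top := (ae_map_iff hT.aemeasurable (hfm (measurableSet_singleton ∞).compl)).2 hf.ne_top
  integrable :=
    (integrable_map_measure hfm.ennreal_toReal.log.aestronglyMeasurable hT.aemeasurable).2
      hf.integrable

theorem LogIntegrable.inv (hf : LogIntegrable f P) : LogIntegrable (fun ω => (f ω)⁻¹) P where
  ne_zero := hf.ne_top.mono fun _ => ENNReal.inv_ne_zero.2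
  ne_top := hf.ne_zero.mono fun _ => ENNReal.inv_ne_top.2
  integrable := by simpa only [ENNReal.toReal_inv, Real.log_inv] using! hf.integrable.neg

theorem meanLog_inv (P : Measure Ω) (f : Ω → ℝ≥0∞) :
    meanLog P (fun ω => (f ω)⁻¹) = -meanLog P f := by
  simp only [meanLog, ENNReal.toReal_inv, Real.log_inv, integral_neg]

variable [IsProbabilityMeasure P]

theorem integral_le_log_of_lintegral_exp_le {L : Ω → ℝ} (hL : Integrable L P) {K : ℝ} (hK : 0 < K)
    (h : ∫⁻ ω, ENNReal.ofReal (Real.exp (L ω)) ∂P ≤ ENNReal.ofReal K) :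
    ∫ ω, L ω ∂P ≤ Real.log K := by
  have hexp_nonneg : 0 ≤ᵐ[P] fun ω => Real.exp (L ω) := ae_of_all _ fun ω => (Real.exp_pos _).le
  have hexp : Integrable (fun ω => Real.exp (L ω)) P := by
    refine ⟨(Real.measurable_exp.comp_aemeasurable hL.aemeasurable).aestronglyMeasurable, ?_⟩
    rw [hasFiniteIntegral_iff_ofReal hexp_nonneg]
    exact h.trans_lt ENNReal.ofReal_lt_top
  have hmean : ∫ ω, Real.exp (L ω) ∂P ≤ K := by
    rw [integral_eq_lintegral_of_nonneg_ae hexp_nonneg hexp.aestronglyMeasurable]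
    exact ENNReal.toReal_le_of_le_ofReal hK.le h
  have htangent (ω : Ω) : L ω ≤ Real.exp (L ω) / K + (Real.log K - 1) := by
    have h := Real.add_one_le_exp (L ω - Real.log K)
    rw [Real.exp_sub, Real.exp_log hK] at h
    linarith
  calc ∫ ω, L ω ∂P ≤ ∫ ω, (Real.exp (L ω) / K + (Real.log K - 1)) ∂P :=
        integral_mono hL ((hexp.div_const K).add (integrable_const _)) htangent
    _ = (∫ ω, Real.exp (L ω) ∂P) / K + (Real.log K - 1) := by
        rw [integral_add (hexp.div_const K) (integrable_const _), integral_div, integral_const,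
          probReal_univ, one_smul]
    _ ≤ 1 + (Real.log K - 1) := by gcongr; exact (div_le_one hK).2 hmean
    _ = Real.log K := by ring

theorem LogIntegrable.meanLog_le_add_log (hf : LogIntegrable f P) (hd : LogIntegrable d P) {K : ℝ}
    (hK : 0 < K) (h : ∫⁻ ω, f ω / d ω ∂P ≤ ENNReal.ofReal K) :
    meanLog P f ≤ meanLog P d + Real.log K := by
  have hexp : (fun ω => ENNReal.ofReal
      (Real.exp (Real.log (f ω).toReal - Real.log (d ω).toReal))) =ᵐ[P] fun ω => f ω / d ω := by
    filter_upwards [hf.ne_zero, hf.ne_top, hd.ne_zero, hd.ne_top] with ω hf0 hft hd0 hdt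
    have hd_pos := ENNReal.toReal_pos hd0 hdt
    rw [Real.exp_sub, Real.exp_log (ENNReal.toReal_pos hf0 hft), Real.exp_log hd_pos,
      ENNReal.ofReal_div_of_pos hd_pos, ENNReal.ofReal_toReal hft, ENNReal.ofReal_toReal hdt]
  have hlog := integral_le_log_of_lintegral_exp_le (hf.integrable.sub hd.integrable) hK
    ((lintegral_congr_ae hexp).trans_le h)
  rw [integral_sub' hf.integrable hd.integrable] at hlog
  exact sub_le_iff_le_add'.1 hlog

theorem LogIntegrable.meanLog_le (hf : LogIntegrable f P) (hd : LogIntegrable d P)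
    (h : ∫⁻ ω, f ω / d ω ∂P ≤ 1) : meanLog P f ≤ meanLog P d := by
  simpa using hf.meanLog_le_add_log hd one_pos (by simpa using h)

theorem LogIntegrable.meanLog_le_of_klDiv_le {Q : Measure Ω} [IsProbabilityMeasure Q]
    (hf : LogIntegrable f P) (hfm : Measurable f) (h : ∫⁻ ω, f ω ∂Q ≤ 1) {r : ℝ} (hr : 0 ≤ r)
    (hkl : InformationTheory.klDiv P Q ≤ ENNReal.ofReal r) : meanLog P f ≤ r := by
  obtain ⟨hac, hllr⟩ := InformationTheory.klDiv_ne_top_iff.1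
    (ne_top_of_le_ne_top ENNReal.ofReal_ne_top hkl)
  have hrn : LogIntegrable (P.rnDeriv Q) P :=
    { ne_zero := (Measure.rnDeriv_pos hac).mono fun _ => ne_of_gt
      ne_top := hac.ae_le (Measure.rnDeriv_ne_top P Q)
      integrable := hllr }
  have hdiv : ∫⁻ ω, f ω / P.rnDeriv Q ω ∂P ≤ 1 :=
    calc ∫⁻ ω, f ω / P.rnDeriv Q ω ∂P
        = ∫⁻ ω, f ω / P.rnDeriv Q ω ∂(Q.withDensity (P.rnDeriv Q)) := by
          rw [Measure.withDensity_rnDeriv_eq _ _ hac]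
      _ = ∫⁻ ω, P.rnDeriv Q ω * (f ω / P.rnDeriv Q ω) ∂Q :=
          lintegral_withDensity_eq_lintegral_mul _ (Measure.measurable_rnDeriv _ _)
            (hfm.div (Measure.measurable_rnDeriv _ _))
      _ ≤ ∫⁻ ω, f ω ∂Q := lintegral_mono fun _ => ENNReal.mul_div_le
      _ ≤ 1 := h
  calc meanLog P f ≤ meanLog P (P.rnDeriv Q) := hf.meanLog_le hrn hdiv
    _ = (InformationTheory.klDiv P Q).toReal :=
        (InformationTheory.toReal_klDiv_of_measure_eq hac (by simp)).symm
    _ ≤ r := ENNReal.toReal_le_of_le_ofReal hr hkl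

end MeanLog

/-! ### Additive noise -/

instance instMeasurableAdd₂Prod {E F : Type*} [MeasurableSpace E] [MeasurableSpace F] [Add E]
    [Add F] [MeasurableAdd₂ E] [MeasurableAdd₂ F] : MeasurableAdd₂ (E × F) :=
  ⟨(measurable_fst.fst.add measurable_snd.fst).prodMk (measurable_fst.snd.add measurable_snd.snd)⟩

instance instMeasurableNegProd {E F : Type*} [MeasurableSpace E] [MeasurableSpace F] [Neg E]
    [Neg F] [MeasurableNeg E] [MeasurableNeg F] : MeasurableNeg (E × F) :=
  ⟨measurable_fst.neg.prodMk measurable_snd.neg⟩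

instance instIsAddLeftInvariantVolumeProd {E F : Type*} [MeasureSpace E] [MeasureSpace F]
    [AddGroup E] [AddGroup F] [MeasurableAdd E] [MeasurableAdd F]
    [(volume : Measure E).IsAddLeftInvariant] [(volume : Measure F).IsAddLeftInvariant]
    [SFinite (volume : Measure E)] [SFinite (volume : Measure F)] :
    (volume : Measure (E × F)).IsAddLeftInvariant :=
  inferInstanceAs ((volume : Measure E).prod (volume : Measure F)).IsAddLeftInvariant

/-- The noise law `γ` has the density `φ` with respect to the translation invariant reference
measure, `φ` is at most one and decays no faster than a Gaussian whose exponent is the quadratic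
form `sq`. These bounds make the logarithms of all mixture densities integrable. -/
structure IsNoise {G : Type*} [MeasureSpace G] [AddCommGroup G] (γ : Measure G) (φ : G → ℝ≥0∞)
    (sq : G → ℝ) : Prop where
  measurable : Measurable φ
  eq_withDensity : γ = volume.withDensity φ
  le_one : ∀ u, φ u ≤ 1
  lower : ∃ c : ℝ, 0 < c ∧
    ∀ y g, ENNReal.ofReal (c * Real.exp (-sq y) * Real.exp (-sq g)) ≤ φ (y - g)
  measurable_sq : Measurable sq
  sq_nonneg : ∀ u, 0 ≤ sq u
  sq_add : ∀ u v, sq (u + v) ≤ 2 * (sq u + sq v)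
  integrable_sq : Integrable sq γ

/-- The density of `g a + z`, with `a` drawn from `μ` and `z` from the density `φ`. -/
def mix {A G : Type*} [MeasurableSpace A] [AddCommGroup G] (φ : G → ℝ≥0∞) (μ : Measure A)
    (g : A → G) (y : G) : ℝ≥0∞ :=
  ∫⁻ a, φ (y - g a) ∂μ

/-- The density of a pair of independent noises with density `φ`. -/
def pairPDF {E : Type*} (φ : E → ℝ≥0∞) (u : E × E) : ℝ≥0∞ := φ u.1 * φ u.2

section Noise

variable {A G : Type*} [MeasurableSpace A] [MeasureSpace G] [AddCommGroup G]
  {γ : Measure G} {φ : G → ℝ≥0∞} {sq : G → ℝ}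

theorem IsNoise.ne_zero (hn : IsNoise γ φ sq) (u : G) : φ u ≠ 0 := by
  obtain ⟨c, hc, h⟩ := hn.lower
  have hlow := h u 0
  rw [sub_zero] at hlow
  exact (lt_of_lt_of_le (ENNReal.ofReal_pos.2 (by positivity)) hlow).ne'

theorem IsNoise.ne_top (hn : IsNoise γ φ sq) (u : G) : φ u ≠ ∞ :=
  ((hn.le_one u).trans_lt ENNReal.one_lt_top).ne

theorem IsNoise.mix_le (hn : IsNoise γ φ sq) (μ : Measure A) (g : A → G) (y : G) :
    mix φ μ g y ≤ μ Set.univ :=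
  calc mix φ μ g y ≤ ∫⁻ _, 1 ∂μ := lintegral_mono fun _ => hn.le_one _
    _ = μ Set.univ := lintegral_one

theorem IsNoise.mix_ne_top (hn : IsNoise γ φ sq) {μ : Measure A} [IsFiniteMeasure μ]
    (g : A → G) (y : G) : mix φ μ g y ≠ ∞ :=
  ne_top_of_le_ne_top (measure_ne_top μ _) (hn.mix_le μ g y)

theorem IsNoise.exists_le_mix (hn : IsNoise γ φ sq) {μ : Measure A} [IsFiniteMeasure μ]
    (hμ : μ ≠ 0) {g : A → G} (hg : Measurable g) :
    ∃ κ : ℝ, 0 < κ ∧ ∀ y, ENNReal.ofReal (κ * Real.exp (-sq y)) ≤ mix φ μ g y := by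
  obtain ⟨c, hc, h⟩ := hn.lower
  set K := ∫⁻ a, ENNReal.ofReal (Real.exp (-sq (g a))) ∂μ with hK
  have hm : Measurable fun a => ENNReal.ofReal (Real.exp (-sq (g a))) :=
    (Real.measurable_exp.comp (hn.measurable_sq.comp hg).neg).ennreal_ofReal
  have hK_pos : 0 < K := by
    rw [hK, lintegral_pos_iff_support hm]
    convert Measure.measure_univ_pos.2 hμ
    ext a
    simp [Real.exp_pos]
  have hK_top : K ≠ ∞ := by
    refine ne_top_of_le_ne_top (measure_ne_top μ Set.univ) ?_
    calc K ≤ ∫⁻ _, 1 ∂μ := lintegral_mono fun a => ENNReal.ofReal_le_one.2 <|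
          Real.exp_le_one_iff.2 (neg_nonpos.2 (hn.sq_nonneg _))
      _ = μ Set.univ := lintegral_one
  refine ⟨c * K.toReal, mul_pos hc (ENNReal.toReal_pos hK_pos.ne' hK_top), fun y => ?_⟩
  calc ENNReal.ofReal (c * K.toReal * Real.exp (-sq y))
      = ENNReal.ofReal (c * Real.exp (-sq y)) * K := by
        rw [mul_right_comm, ENNReal.ofReal_mul (by positivity), ENNReal.ofReal_toReal hK_top]
    _ = ∫⁻ a, ENNReal.ofReal (c * Real.exp (-sq y) * Real.exp (-sq (g a))) ∂μ := by
        rw [hK, ← lintegral_const_mul _ hm]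
        exact lintegral_congr fun a => (ENNReal.ofReal_mul (by positivity)).symm
    _ ≤ mix φ μ g y := lintegral_mono fun a => h y (g a)

theorem IsNoise.mix_ne_zero (hn : IsNoise γ φ sq) {μ : Measure A} [IsFiniteMeasure μ]
    (hμ : μ ≠ 0) {g : A → G} (hg : Measurable g) (y : G) : mix φ μ g y ≠ 0 := by
  obtain ⟨κ, hκ, h⟩ := hn.exists_le_mix hμ hg
  exact (lt_of_lt_of_le (ENNReal.ofReal_pos.2 (by positivity)) (h y)).ne'

theorem IsNoise.abs_log_mix_le (hn : IsNoise γ φ sq) (μ : Measure A) [IsFiniteMeasure μ]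
    {g : A → G} (hg : Measurable g) :
    ∃ C : ℝ, ∀ y, |Real.log (mix φ μ g y).toReal| ≤ C + sq y := by
  rcases eq_or_ne μ 0 with rfl | hμ
  · exact ⟨0, fun y => by simp [mix, hn.sq_nonneg y]⟩
  obtain ⟨κ, hκ, h⟩ := hn.exists_le_mix hμ hg
  refine ⟨|Real.log κ| + |Real.log (μ Set.univ).toReal|, fun y => ?_⟩
  have hpos : 0 < κ * Real.exp (-sq y) := by positivity
  have hlow : κ * Real.exp (-sq y) ≤ (mix φ μ g y).toReal :=
    (ENNReal.ofReal_le_iff_le_toReal (hn.mix_ne_top g y)).1 (h y)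
  have hupp : (mix φ μ g y).toReal ≤ (μ Set.univ).toReal :=
    ENNReal.toReal_mono (measure_ne_top μ _) (hn.mix_le μ g y)
  have hlog_low := Real.log_le_log hpos hlow
  have hlog_upp := Real.log_le_log (hpos.trans_le hlow) hupp
  rw [Real.log_mul hκ.ne' (Real.exp_pos _).ne', Real.log_exp] at hlog_low
  have hsq := hn.sq_nonneg y
  rw [abs_le]
  constructor
  · linarith [neg_abs_le (Real.log κ), abs_nonneg (Real.log (μ Set.univ).toReal)]
  · linarith [abs_nonneg (Real.log κ), le_abs_self (Real.log (μ Set.univ).toReal)]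

theorem IsNoise.lintegral_add [MeasurableAdd₂ G] [(volume : Measure G).IsAddLeftInvariant]
    (hn : IsNoise γ φ sq) (g : G) {F : G → ℝ≥0∞} (hF : Measurable F) :
    ∫⁻ z, F (g + z) ∂γ = ∫⁻ y, φ (y - g) * F y := by
  rw [← lintegral_add_left_eq_self (μ := (volume : Measure G)) _ g, hn.eq_withDensity,
    lintegral_withDensity_eq_lintegral_mul _ hn.measurable (g := fun z => F (g + z))
      (hF.comp (measurable_const_add g))]
  simp

theorem IsNoise.lintegral_add_div [MeasurableAdd₂ G] [(volume : Measure G).IsAddLeftInvariant]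
    (hn : IsNoise γ φ sq) (g : G) {F : G → ℝ≥0∞} (hF : Measurable F) :
    ∫⁻ z, F (g + z) / φ z ∂γ = ∫⁻ y, F y := by
  rw [← lintegral_add_left_eq_self (μ := (volume : Measure G)) F g, hn.eq_withDensity,
    lintegral_withDensity_eq_lintegral_mul _ hn.measurable (g := fun z => F (g + z) / φ z)
      ((hF.comp (measurable_const_add g)).div hn.measurable)]
  exact lintegral_congr fun z => ENNReal.mul_div_cancel (hn.ne_zero z) (hn.ne_top z)

variable [MeasurableAdd₂ G] [MeasurableNeg G]

theorem IsNoise.measurable_mix (hn : IsNoise γ φ sq) {μ : Measure A} [SFinite μ] {g : A → G}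
    (hg : Measurable g) : Measurable (mix φ μ g) :=
  Measurable.lintegral_prod_right' (f := fun p : G × A => φ (p.1 - g p.2))
    (hn.measurable.comp (measurable_fst.sub (hg.comp measurable_snd)))

variable [(volume : Measure G).IsAddLeftInvariant] [SFinite (volume : Measure G)]

theorem IsNoise.lintegral_mix_mul (hn : IsNoise γ φ sq) {μ : Measure A} [SFinite μ] {g : A → G}
    (hg : Measurable g) {F : G → ℝ≥0∞} (hF : Measurable F) :
    ∫⁻ a, ∫⁻ z, F (g a + z) ∂γ ∂μ = ∫⁻ y, mix φ μ g y * F y := by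
  have hm : Measurable fun p : A × G => φ (p.2 - g p.1) :=
    hn.measurable.comp (measurable_snd.sub (hg.comp measurable_fst))
  calc ∫⁻ a, ∫⁻ z, F (g a + z) ∂γ ∂μ
      = ∫⁻ a, ∫⁻ y, φ (y - g a) * F y ∂volume ∂μ :=
        lintegral_congr fun a => hn.lintegral_add (g a) hF
    _ = ∫⁻ y, ∫⁻ a, φ (y - g a) * F y ∂μ :=
        lintegral_lintegral_swap (hm.mul (hF.comp measurable_snd)).aemeasurable
    _ = ∫⁻ y, mix φ μ g y * F y :=
        lintegral_congr fun y => lintegral_mul_const _ (hm.comp measurable_prodMk_right)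

theorem IsNoise.lintegral_mix (hn : IsNoise γ φ sq) [IsProbabilityMeasure γ] {μ : Measure A}
    [SFinite μ] {g : A → G} (hg : Measurable g) : ∫⁻ y, mix φ μ g y = μ Set.univ := by
  simpa using (hn.lintegral_mix_mul (μ := μ) hg (F := fun _ => 1) measurable_const).symm

end Noise

theorem IsNoise.pair {E : Type*} [MeasureSpace E] [AddCommGroup E] [SFinite (volume : Measure E)]
    {γ : Measure E} [IsProbabilityMeasure γ] {φ : E → ℝ≥0∞} {sq : E → ℝ} (hn : IsNoise γ φ sq) :
    IsNoise (γ.prod γ) (pairPDF φ) (fun u => sq u.1 + sq u.2) where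
  measurable := (hn.measurable.comp measurable_fst).mul (hn.measurable.comp measurable_snd)
  eq_withDensity := by
    have : SFinite (volume.withDensity φ : Measure E) := by rw [← hn.eq_withDensity]; infer_instance
    conv_lhs => rw [hn.eq_withDensity]
    exact prod_withDensity hn.measurable hn.measurable
  le_one u := mul_le_one' (hn.le_one _) (hn.le_one _)
  lower := by
    obtain ⟨c, hc, h⟩ := hn.lower
    refine ⟨c * c, by positivity, fun y g => ?_⟩
    refine le_trans (le_of_eq ?_) (mul_le_mul' (h y.1 g.1) (h y.2 g.2))
    rw [← ENNReal.ofReal_mul (by positivity), neg_add, neg_add, Real.exp_add, Real.exp_add]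
    congr 1
    ring
  measurable_sq := (hn.measurable_sq.comp measurable_fst).add (hn.measurable_sq.comp measurable_snd)
  sq_nonneg u := add_nonneg (hn.sq_nonneg _) (hn.sq_nonneg _)
  sq_add u v := (add_le_add (hn.sq_add u.1 v.1) (hn.sq_add u.2 v.2)).trans_eq (by ring)
  integrable_sq := (hn.integrable_sq.comp_fst γ).add (hn.integrable_sq.comp_snd γ)

theorem mix_pairPDF {A₁ A₂ E : Type*} [MeasurableSpace A₁] [MeasurableSpace A₂] [MeasurableSpace E]
    [AddCommGroup E] [MeasurableAdd₂ E] [MeasurableNeg E] {φ : E → ℝ≥0∞} (hφ : Measurable φ)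
    {m₁ : Measure A₁} {m₂ : Measure A₂} [SFinite m₂]
    {g₁ : A₁ → E} {g₂ : A₂ → E} (h₁ : Measurable g₁) (h₂ : Measurable g₂) (s : E × E) :
    mix (pairPDF φ) (m₁.prod m₂) (fun a => (g₂ a.2, g₁ a.1)) s =
      mix φ m₂ g₂ s.1 * mix φ m₁ g₁ s.2 := by
  have hm₁ : Measurable fun a => φ (s.2 - g₁ a) := hφ.comp (measurable_const.sub h₁)
  have hm₂ : Measurable fun a => φ (s.1 - g₂ a) := hφ.comp (measurable_const.sub h₂)
  rw [mix, mix, mix, mul_comm, ← lintegral_prod_mul hm₁.aemeasurable hm₂.aemeasurable]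
  exact lintegral_congr fun a => mul_comm _ _

/-! ### Conditional laws given a finite-valued observation -/

/-- `ν i` is a version of the conditional law of `μ` given `I = i`. It is arbitrary where `{I = i}`
is a null set. -/
structure IsCondLaw {A ι : Type*} [MeasurableSpace A] [MeasurableSpace ι] (ν : ι → Measure A)
    (I : A → ι) (μ : Measure A) : Prop where
  measurable : Measurable I
  restrict_eq : ∀ i, μ.restrict (I ⁻¹' {i}) = μ (I ⁻¹' {i}) • ν i

theorem measurable_comp_of_countable {Ω ι E F : Type*} [MeasurableSpace Ω] [MeasurableSpace ι]
    [MeasurableSpace E] [MeasurableSpace F] [Countable ι] [MeasurableSingletonClass ι]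
    {f : ι → E → F} (hf : ∀ i, Measurable (f i)) {I : Ω → ι} (hI : Measurable I)
    {Y : Ω → E} (hY : Measurable Y) : Measurable fun ω => f (I ω) (Y ω) :=
  (measurable_from_prod_countable_right (f := fun p : ι × E => f p.1 p.2) hf).comp (hI.prodMk hY)

section CondLaw

variable {A ι : Type*} [MeasurableSpace A] [MeasurableSpace ι] {μ : Measure A} {I : A → ι}
  {ν : ι → Measure A}

theorem measure_smul_cond [IsFiniteMeasure μ] (s : Set A) :
    μ s • μ[|s] = μ.restrict s := by
  rcases eq_or_ne (μ s) 0 with h | h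
  · rw [h, zero_smul, Measure.restrict_eq_zero.2 h]
  · rw [ProbabilityTheory.cond, smul_smul, ENNReal.mul_inv_cancel h (measure_ne_top μ s), one_smul]

theorem isCondLaw_cond [IsFiniteMeasure μ] (hI : Measurable I) :
    IsCondLaw (fun i => μ[|I ⁻¹' {i}]) I μ :=
  ⟨hI, fun _ => (measure_smul_cond _).symm⟩

theorem IsCondLaw.ae_ne_zero [Countable ι] (hν : IsCondLaw ν I μ) : ∀ᵐ a ∂μ, ν (I a) ≠ 0 := by
  have hfiber : ∀ i, ∀ᵐ a ∂μ, I a = i → ν i ≠ 0 := fun i => by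
    rcases eq_or_ne (ν i) 0 with h | h
    · have hnull := hν.restrict_eq i
      rw [h, smul_zero, Measure.restrict_eq_zero] at hnull
      filter_upwards [measure_eq_zero_iff_ae_notMem.1 hnull] with a ha hI using absurd hI ha
    · exact ae_of_all _ fun _ _ => h
  filter_upwards [ae_all_iff.2 hfiber] with a ha using ha (I a) rfl

variable [MeasurableSingletonClass ι]

theorem IsCondLaw.setLIntegral_fiber (hν : IsCondLaw ν I μ) (f : ι → A → ℝ≥0∞) (i : ι) :
    ∫⁻ a in I ⁻¹' {i}, f (I a) a ∂μ = μ (I ⁻¹' {i}) * ∫⁻ a, f i a ∂ν i := by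
  rw [setLIntegral_congr_fun (hν.measurable (measurableSet_singleton i)) (g := f i)
    (fun a ha => by rw [show I a = i from ha]), hν.restrict_eq, lintegral_smul_measure, smul_eq_mul]

theorem IsCondLaw.measure_mul_mix_le {E : Type*} [AddCommGroup E] {φ : E → ℝ≥0∞} {g : ι → A → E}
    (hν : IsCondLaw ν I μ) (i : ι) (y : E) :
    μ (I ⁻¹' {i}) * mix φ (ν i) (g i) y ≤ mix φ μ (fun a => g (I a) a) y := by
  rw [mix, mix, ← hν.setLIntegral_fiber fun i a => φ (y - g i a)]
  exact setLIntegral_le_lintegral _ _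

variable [Countable ι]

theorem IsCondLaw.lintegral_eq_tsum (hν : IsCondLaw ν I μ) (f : ι → A → ℝ≥0∞) :
    ∫⁻ a, f (I a) a ∂μ = ∑' i, μ (I ⁻¹' {i}) * ∫⁻ a, f i a ∂ν i := by
  have hmeas (i : ι) : MeasurableSet (I ⁻¹' {i}) := hν.measurable (measurableSet_singleton i)
  have hcover : ⋃ i, I ⁻¹' {i} = Set.univ := by ext; simp
  have hdisj : Pairwise (Function.onFun Disjoint fun i => I ⁻¹' {i}) := fun i j hij =>
    Disjoint.preimage I (by simpa using hij)
  rw [← setLIntegral_univ, ← hcover, lintegral_iUnion hmeas hdisj]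
  exact tsum_congr fun i => hν.setLIntegral_fiber f i

theorem IsCondLaw.lintegral_comp (hν : IsCondLaw ν I μ) (f : ι → ℝ≥0∞) :
    ∫⁻ a, f (I a) ∂μ = ∑' i, μ (I ⁻¹' {i}) * f i := by
  rw [← lintegral_map (measurable_of_countable f) hν.measurable, lintegral_countable']
  refine tsum_congr fun i => ?_
  rw [Measure.map_apply hν.measurable (measurableSet_singleton i), mul_comm]

section Mix

variable {E : Type*} [MeasureSpace E] [AddCommGroup E] [MeasurableAdd₂ E] [MeasurableNeg E]
  [(volume : Measure E).IsAddLeftInvariant] [SFinite (volume : Measure E)]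
  {γ : Measure E} {φ : E → ℝ≥0∞} {sq : E → ℝ} {g : ι → A → E}

theorem IsNoise.lintegral_condMix_mul (hn : IsNoise γ φ sq) (hν : IsCondLaw ν I μ)
    [∀ i, SFinite (ν i)] (hg : ∀ i, Measurable (g i)) {F : ι → E → ℝ≥0∞}
    (hF : ∀ i, Measurable (F i)) :
    ∫⁻ a, ∫⁻ z, F (I a) (g (I a) a + z) ∂γ ∂μ =
      ∑' i, μ (I ⁻¹' {i}) * ∫⁻ y, mix φ (ν i) (g i) y * F i y := by
  rw [hν.lintegral_eq_tsum fun i a => ∫⁻ z, F i (g i a + z) ∂γ]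
  exact tsum_congr fun i => by rw [hn.lintegral_mix_mul (hg i) (hF i)]

theorem IsNoise.lintegral_div_condMix_le (hn : IsNoise γ φ sq) (hν : IsCondLaw ν I μ)
    [∀ i, SFinite (ν i)] (hg : ∀ i, Measurable (g i)) {F : ι → E → ℝ≥0∞}
    (hF : ∀ i, Measurable (F i)) :
    ∫⁻ a, ∫⁻ z, F (I a) (g (I a) a + z) / mix φ (ν (I a)) (g (I a)) (g (I a) a + z) ∂γ ∂μ ≤
      ∫⁻ a, ∫⁻ y, F (I a) y ∂volume ∂μ := by
  rw [hn.lintegral_condMix_mul hν hg (F := fun i y => F i y / mix φ (ν i) (g i) y)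
    fun i => (hF i).div (hn.measurable_mix (hg i)), hν.lintegral_comp fun i => ∫⁻ y, F i y]
  gcongr with i y
  exact ENNReal.mul_div_le

/-- Each conditional density exceeds the unconditional one by at most the factor `1 / μ (I = i)`,
and these factors average to the number of values of `I`. -/
theorem IsNoise.lintegral_condMix_div_mix_le [Fintype ι] (hn : IsNoise γ φ sq)
    [IsProbabilityMeasure γ] [SFinite μ] (hν : IsCondLaw ν I μ) [∀ i, SFinite (ν i)]
    (hmass : ∀ i, ν i Set.univ ≤ 1) (hg : ∀ i, Measurable (g i))
    (hgI : Measurable fun a => g (I a) a) :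
    ∫⁻ a, ∫⁻ z, mix φ (ν (I a)) (g (I a)) (g (I a) a + z) /
      mix φ μ (fun a => g (I a) a) (g (I a) a + z) ∂γ ∂μ ≤ Fintype.card ι := by
  set ρ := mix φ μ fun a => g (I a) a
  have hρ : Measurable ρ := hn.measurable_mix hgI
  rw [hn.lintegral_condMix_mul hν hg (F := fun i y => mix φ (ν i) (g i) y / ρ y)
    fun i => (hn.measurable_mix (hg i)).div hρ, tsum_fintype]
  calc ∑ i, μ (I ⁻¹' {i}) * ∫⁻ y, mix φ (ν i) (g i) y * (mix φ (ν i) (g i) y / ρ y)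
      ≤ ∑ i, ∫⁻ y, mix φ (ν i) (g i) y := by
        gcongr with i
        refine (lintegral_const_mul_le _ _).trans (lintegral_mono fun y => ?_)
        calc μ (I ⁻¹' {i}) * (mix φ (ν i) (g i) y * (mix φ (ν i) (g i) y / ρ y))
            = mix φ (ν i) (g i) y * (μ (I ⁻¹' {i}) * mix φ (ν i) (g i) y / ρ y) := by
              simp only [div_eq_mul_inv]; ring
          _ ≤ mix φ (ν i) (g i) y * (ρ y / ρ y) := by
              gcongr; exact hν.measure_mul_mix_le i y
          _ ≤ mix φ (ν i) (g i) y := mul_le_of_le_one_right' ENNReal.div_self_le_one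
    _ = ∑ i, ν i Set.univ := Finset.sum_congr rfl fun i _ => hn.lintegral_mix (hg i)
    _ ≤ ∑ _i : ι, 1 := Finset.sum_le_sum fun i _ => hmass i
    _ = Fintype.card ι := by simp

end Mix

end CondLaw

/-! ### Entropy inequalities -/

theorem lintegral_comp_prod {Ω A B : Type*} [MeasurableSpace Ω] [MeasurableSpace A]
    [MeasurableSpace B] {P : Measure Ω} {μ : Measure A} {γ : Measure B} [SFinite γ] {X : Ω → A}
    {Z : Ω → B} (h : MeasurePreserving (fun ω => (X ω, Z ω)) P (μ.prod γ)) {F : A × B → ℝ≥0∞}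
    (hF : Measurable F) : ∫⁻ ω, F (X ω, Z ω) ∂P = ∫⁻ a, ∫⁻ z, F (a, z) ∂γ ∂μ :=
  (h.lintegral_comp hF).trans (lintegral_prod _ hF.aemeasurable)

theorem meanLog_le_of_mutualInfo_le {Ω A B : Type*} [MeasurableSpace Ω] [MeasurableSpace A]
    [MeasurableSpace B] {P : Measure Ω} [IsProbabilityMeasure P] {U : Ω → A} {Y : Ω → B}
    (hU : Measurable U) (hY : Measurable Y) {f : A × B → ℝ≥0∞} (hfm : Measurable f)
    (hf : LogIntegrable (fun ω => f (U ω, Y ω)) P) (h : ∫⁻ ω, ∫⁻ ω', f (U ω, Y ω') ∂P ∂P ≤ 1)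
    {r : ℝ} (hr : 0 ≤ r) (hI : mutualInfo P U Y ≤ ENNReal.ofReal r) :
    meanLog P (fun ω => f (U ω, Y ω)) ≤ r := by
  have hUY : Measurable fun ω => (U ω, Y ω) := hU.prodMk hY
  have := Measure.isProbabilityMeasure_map (μ := P) hU.aemeasurable
  have := Measure.isProbabilityMeasure_map (μ := P) hY.aemeasurable
  have := Measure.isProbabilityMeasure_map (μ := P) hUY.aemeasurable
  have hf_map : LogIntegrable f (P.map fun ω => (U ω, Y ω)) := .of_map hUY hfm hf
  have hprod : ∫⁻ x, f x ∂((P.map U).prod (P.map Y)) ≤ 1 := by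
    rw [Measure.map_prod_map _ _ hU hY, lintegral_map hfm (by fun_prop),
      lintegral_prod _ (by fun_prop)]
    exact h
  rw [meanLog_comp_measurePreserving hf_map ⟨hUY, rfl⟩]
  exact hf_map.meanLog_le_of_klDiv_le hfm hprod hr hI

/-- A test of the hypothesis that an observation is independent of the label `W`: whatever the
observation, the test has mean at most one over the labels. Its mean logarithm bounds from below
the information that the observation carries about `W`. -/
structure IsTest {A ι E : Type*} [MeasurableSpace A] [MeasurableSpace E] (t : ι → E → ℝ≥0∞)
    (W : A → ι) (μ : Measure A) : Prop where
  measurable : ∀ i, Measurable (t i)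
  lintegral_le_one : ∀ y, ∫⁻ a, t (W a) y ∂μ ≤ 1

section Tests

variable {Ω A ι E : Type*} [MeasurableSpace Ω] [MeasurableSpace A] [MeasurableSpace ι]
  [MeasurableSingletonClass ι] {P : Measure Ω} {μ : Measure A} {ν : ι → Measure A} {W : A → ι}

theorem IsTest.comp_measurePreserving {B : Type*} [MeasurableSpace B] {m : Measure B}
    [MeasurableSpace E] [Countable ι] {t : ι → E → ℝ≥0∞} (ht : IsTest t W μ) (hW : Measurable W)
    {T : B → A} (hT : MeasurePreserving T m μ) : IsTest t (fun b => W (T b)) m where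
  measurable := ht.measurable
  lintegral_le_one y := by
    have hty : Measurable fun a => t (W a) y := (measurable_of_countable fun i => t i y).comp hW
    exact (hT.lintegral_comp hty).trans_le (ht.lintegral_le_one y)

theorem IsTest.lintegral_mul_le [MeasureSpace E] [SFinite (volume : Measure E)] [Countable ι]
    [SFinite μ] {t : ι → E → ℝ≥0∞} (ht : IsTest t W μ) (hW : Measurable W) {q : E → ℝ≥0∞}
    (hq : Measurable q) : ∫⁻ a, ∫⁻ y, t (W a) y * q y ∂volume ∂μ ≤ ∫⁻ y, q y := by
  have htW : Measurable fun x : A × E => t (W x.1) x.2 :=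
    measurable_comp_of_countable ht.measurable (hW.comp measurable_fst) measurable_snd
  calc ∫⁻ a, ∫⁻ y, t (W a) y * q y ∂volume ∂μ
      = ∫⁻ y, ∫⁻ a, t (W a) y * q y ∂μ :=
        lintegral_lintegral_swap (htW.mul (hq.comp measurable_snd)).aemeasurable
    _ = ∫⁻ y, (∫⁻ a, t (W a) y ∂μ) * q y :=
        lintegral_congr fun y => lintegral_mul_const _ (htW.comp measurable_prodMk_right)
    _ ≤ ∫⁻ y, q y := lintegral_mono fun y => mul_le_of_le_one_left' (ht.lintegral_le_one y)

variable [MeasureSpace E] [AddCommGroup E] [MeasurableAdd₂ E]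
  {γ : Measure E} {φ : E → ℝ≥0∞} {sq : E → ℝ}

theorem IsNoise.integrable_sq_add (hn : IsNoise γ φ sq) {X : Ω → A} {Z : Ω → E}
    (h : MeasurePreserving (fun ω => (X ω, Z ω)) P (μ.prod γ)) [IsProbabilityMeasure μ]
    [IsProbabilityMeasure γ] {b : A → E} (hb : Measurable b)
    (hsq : Integrable (fun a => sq (b a)) μ) : Integrable (fun ω => sq (b (X ω) + Z ω)) P := by
  have hX : MeasurePreserving X P μ := measurePreserving_fst.comp h
  have hZ : MeasurePreserving Z P γ := measurePreserving_snd.comp h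
  have hbound := ((hX.integrable_comp_of_integrable hsq).add
    (hZ.integrable_comp_of_integrable hn.integrable_sq)).const_mul 2
  refine hbound.mono' (hn.measurable_sq.comp
    ((hb.comp hX.measurable).add hZ.measurable)).aestronglyMeasurable (ae_of_all _ fun ω => ?_)
  rw [Real.norm_of_nonneg (hn.sq_nonneg _)]
  exact hn.sq_add _ _

variable [MeasurableNeg E]

theorem IsNoise.logIntegrable_condMix [Finite ι] [IsFiniteMeasure P] [∀ i, IsFiniteMeasure (ν i)]
    (hn : IsNoise γ φ sq) {g : ι → A → E} (hg : ∀ i, Measurable (g i)) {I : Ω → ι}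
    (hI : Measurable I) {Y : Ω → E} (hY : Measurable Y) (hsq : Integrable (fun ω => sq (Y ω)) P)
    (hne : ∀ᵐ ω ∂P, ν (I ω) ≠ 0) :
    LogIntegrable (fun ω => mix φ (ν (I ω)) (g (I ω)) (Y ω)) P where
  ne_zero := hne.mono fun ω h => hn.mix_ne_zero h (hg (I ω)) (Y ω)
  ne_top := ae_of_all _ fun ω => hn.mix_ne_top (g (I ω)) (Y ω)
  integrable := by
    choose C hC using fun i => hn.abs_log_mix_le (ν i) (hg i)
    obtain ⟨K, hK⟩ := (Set.finite_range C).bddAbove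
    have hm : Measurable fun ω => mix φ (ν (I ω)) (g (I ω)) (Y ω) :=
      measurable_comp_of_countable (fun i => hn.measurable_mix (hg i)) hI hY
    refine ((integrable_const K).add hsq).mono' hm.ennreal_toReal.log.aestronglyMeasurable
      (ae_of_all _ fun ω => (hC (I ω) (Y ω)).trans ?_)
    exact add_le_add_left (hK (Set.mem_range_self _)) _

theorem IsNoise.logIntegrable_mix [IsFiniteMeasure P] [IsProbabilityMeasure μ]
    (hn : IsNoise γ φ sq) {g : A → E} (hg : Measurable g) {Y : Ω → E} (hY : Measurable Y)
    (hsq : Integrable (fun ω => sq (Y ω)) P) : LogIntegrable (fun ω => mix φ μ g (Y ω)) P :=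
  hn.logIntegrable_condMix (ν := fun _ : Unit => μ) (I := fun _ => ()) (fun _ => hg)
    measurable_const hY hsq
    (ae_of_all _ fun _ => IsProbabilityMeasure.ne_zero μ)

theorem IsNoise.logIntegrable_noise [IsFiniteMeasure P] (hn : IsNoise γ φ sq) {Z : Ω → E}
    (hZ : MeasurePreserving Z P γ) : LogIntegrable (fun ω => φ (Z ω)) P := by
  simpa [mix] using hn.logIntegrable_mix (μ := Measure.dirac ()) (g := fun _ => 0) measurable_const
    hZ.measurable (hZ.integrable_comp_of_integrable hn.integrable_sq)

variable [(volume : Measure E).IsAddLeftInvariant] [SFinite (volume : Measure E)]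
  [IsProbabilityMeasure γ] [SFinite μ] [Countable ι]

/-- Decoding `W` from `y₁` against observing `y₂`: the information on `W` that `y₁` carries beyond
`y₂` is at most `h(y₁ | y₂) - h(z₁)`. -/
theorem IsTest.lintegral_decode_given_le (hn : IsNoise γ φ sq) {t : ι → E → ℝ≥0∞}
    (ht : IsTest t W μ) (hν : IsCondLaw ν W μ) [∀ i, SFinite (ν i)] {X : Ω → A} {Z₁ Z₂ : Ω → E}
    (h : MeasurePreserving (fun ω => (X ω, Z₂ ω, Z₁ ω)) P (μ.prod (γ.prod γ)))
    {b₁ b₂ : A → E} (hb₁ : Measurable b₁) (hb₂ : Measurable b₂) {p : E × E → ℝ≥0∞}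
    (hp : Measurable p) (hp_le : ∫⁻ y, p y ≤ 1) :
    ∫⁻ ω, t (W (X ω)) (b₁ (X ω) + Z₁ ω) * p (b₁ (X ω) + Z₁ ω, b₂ (X ω) + Z₂ ω) /
      (mix φ (ν (W (X ω))) b₂ (b₂ (X ω) + Z₂ ω) * φ (Z₁ ω)) ∂P ≤ 1 := by
  let ρ i := mix φ (ν i) b₂
  have hρ (i : ι) : Measurable (ρ i) := hn.measurable_mix hb₂
  have htp (i : ι) : Measurable fun y : E × E => t i y.1 * p y := by
    have := ht.measurable i
    fun_prop
  have hF (i : ι) : Measurable fun u : E × E × E =>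
      t i u.1 * p (u.1, u.2.1) / (ρ i u.2.1 * φ u.2.2) := by
    have := ht.measurable i
    have := hρ i
    have := hn.measurable
    exact Measurable.div (by fun_prop) (by fun_prop)
  have hW := hν.measurable
  have hm : Measurable fun x : A × E × E => t (W x.1) (b₁ x.1 + x.2.2) *
      p (b₁ x.1 + x.2.2, b₂ x.1 + x.2.1) / (ρ (W x.1) (b₂ x.1 + x.2.1) * φ x.2.2) :=
    measurable_comp_of_countable (Ω := A × E × E) hF (I := fun x => W x.1) (by fun_prop)
      (Y := fun x => (b₁ x.1 + x.2.2, b₂ x.1 + x.2.1, x.2.2)) (by fun_prop)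
  rw [lintegral_comp_prod h hm]
  calc _ = ∫⁻ a, ∫⁻ z₂, (∫⁻ y₁, t (W a) y₁ * p (y₁, b₂ a + z₂)) / ρ (W a) (b₂ a + z₂) ∂γ ∂μ := by
        refine lintegral_congr fun a => ?_
        refine (lintegral_prod _ (hm.comp measurable_prodMk_left).aemeasurable).trans ?_
        refine lintegral_congr fun z₂ => ?_
        have htp₂ : Measurable fun y₁ => t (W a) y₁ * p (y₁, b₂ a + z₂) :=
          (htp (W a)).comp measurable_prodMk_right
        simp only [div_eq_mul_inv, Function.comp_apply]
        rw [← lintegral_mul_const _ htp₂, ← hn.lintegral_add_div (b₁ a) (htp₂.mul_const _)]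
        refine lintegral_congr fun z₁ => ?_
        rw [ENNReal.mul_inv (.inr (hn.ne_top z₁)) (.inr (hn.ne_zero z₁)), ← mul_assoc,
          div_eq_mul_inv]
    _ ≤ ∫⁻ a, ∫⁻ y₂, ∫⁻ y₁, t (W a) y₁ * p (y₁, y₂) ∂volume ∂volume ∂μ :=
        hn.lintegral_div_condMix_le hν (fun _ => hb₂) (F := fun i y₂ => ∫⁻ y₁, t i y₁ * p (y₁, y₂))
          fun i => (htp i).lintegral_prod_left'
    _ = ∫⁻ y₂, ∫⁻ a, ∫⁻ y₁, t (W a) y₁ * p (y₁, y₂) ∂volume ∂μ := by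
        refine lintegral_lintegral_swap (Measurable.aemeasurable ?_)
        exact measurable_comp_of_countable (fun i => (htp i).lintegral_prod_left')
          (hW.comp measurable_fst) measurable_snd
    _ ≤ ∫⁻ y₂, ∫⁻ y₁, p (y₁, y₂) :=
        lintegral_mono fun y₂ => ht.lintegral_mul_le hW (hp.comp measurable_prodMk_right)
    _ = ∫⁻ y, p y := (lintegral_prod_symm _ hp.aemeasurable).symm
    _ ≤ 1 := hp_le

end Tests

section Genie

variable {Ω A ι E : Type*} [MeasurableSpace Ω] [MeasurableSpace A] [MeasurableSpace ι]
  [MeasurableSingletonClass ι] {P : Measure Ω} {μ : Measure A} {ν : ι → Measure A} {W : A → ι}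
  [MeasureSpace E] [AddCommGroup E] [MeasurableAdd₂ E] {γ : Measure E} {φ : E → ℝ≥0∞} {sq : E → ℝ}
  [MeasurableNeg E] [(volume : Measure E).IsAddLeftInvariant] [SFinite (volume : Measure E)]
  [IsProbabilityMeasure γ]

theorem IsNoise.lintegral_comp_add [SFinite μ] (hn : IsNoise γ φ sq) {X : Ω → A} {Z : Ω → E}
    (h : MeasurePreserving (fun ω => (X ω, Z ω)) P (μ.prod γ)) {b : A → E} (hb : Measurable b)
    {F : E → ℝ≥0∞} (hF : Measurable F) :
    ∫⁻ ω, F (b (X ω) + Z ω) ∂P = ∫⁻ y, mix φ μ b y * F y :=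
  (lintegral_comp_prod h (F := fun x => F (b x.1 + x.2)) (hF.comp (by fun_prop))).trans
    (hn.lintegral_mix_mul hb hF)

variable [IsProbabilityMeasure μ]

theorem IsNoise.meanLog_condMix_le_of_mutualInfo_le [Finite ι] [IsProbabilityMeasure P]
    (hn : IsNoise γ φ sq) (hν : IsCondLaw ν W μ) [∀ i, IsFiniteMeasure (ν i)]
    (hmass : ∀ i, ν i Set.univ ≤ 1) {X : Ω → A} {Z : Ω → E}
    (h : MeasurePreserving (fun ω => (X ω, Z ω)) P (μ.prod γ)) {b : A → E} (hb : Measurable b)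
    (hsq : Integrable (fun a => sq (b a)) μ) {r : ℝ} (hr : 0 ≤ r)
    (hI : mutualInfo P (fun ω => W (X ω)) (fun ω => b (X ω) + Z ω) ≤ ENNReal.ofReal r) :
    meanLog P (fun ω => mix φ (ν (W (X ω))) b (b (X ω) + Z ω)) ≤
      meanLog P (fun ω => mix φ μ b (b (X ω) + Z ω)) + r := by
  have hX : MeasurePreserving X P μ := measurePreserving_fst.comp h
  have hWX : Measurable fun ω => W (X ω) := hν.measurable.comp hX.measurable
  have hY : Measurable fun ω => b (X ω) + Z ω :=
    (hb.comp hX.measurable).add (measurePreserving_snd.comp h).measurable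
  have hsqY := hn.integrable_sq_add h hb hsq
  have hcond := hn.logIntegrable_condMix (fun _ => hb) hWX hY hsqY
    (hX.quasiMeasurePreserving.ae hν.ae_ne_zero)
  have hmix := hn.logIntegrable_mix hb hY hsqY (μ := μ)
  have hm (i : ι) : Measurable fun y => mix φ (ν i) b y * (mix φ μ b y)⁻¹ :=
    (hn.measurable_mix hb).mul (hn.measurable_mix hb).inv
  have hmean (i : ι) :
      ∫⁻ ω, mix φ (ν i) b (b (X ω) + Z ω) * (mix φ μ b (b (X ω) + Z ω))⁻¹ ∂P ≤ 1 :=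
    calc _ = ∫⁻ y, mix φ μ b y * (mix φ (ν i) b y / mix φ μ b y) :=
          hn.lintegral_comp_add h hb (hm i)
      _ ≤ ∫⁻ y, mix φ (ν i) b y := lintegral_mono fun _ => ENNReal.mul_div_le
      _ = ν i Set.univ := hn.lintegral_mix hb
      _ ≤ 1 := hmass i
  have hle := meanLog_le_of_mutualInfo_le hWX hY
    (f := fun u => mix φ (ν u.1) b u.2 * (mix φ μ b u.2)⁻¹)
    (measurable_comp_of_countable hm measurable_fst measurable_snd) (hcond.mul hmix.inv)
    ((lintegral_mono fun ω => hmean (W (X ω))).trans_eq (by simp)) hr hI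
  rw [meanLog_mul hcond hmix.inv, meanLog_inv] at hle
  linarith

/-- `h(y) + h(z') ≤ h(s') + h(y | s')` for `s' = g + z'` with fresh noise `z'`; here `p` and `q` are
arbitrary densities for `s'` and for `y` given `s'`. -/
theorem IsNoise.lintegral_genie_le {F : Type*} [MeasureSpace F] [AddCommGroup F]
    [MeasurableAdd₂ F] [SFinite (volume : Measure F)] [(volume : Measure F).IsAddLeftInvariant]
    {γ' : Measure F} [SFinite γ'] {φ' : F → ℝ≥0∞} {sq' : F → ℝ} (hn : IsNoise γ φ sq)
    (hn' : IsNoise γ' φ' sq') {X : Ω → A} {Z : Ω → E}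
    (h : MeasurePreserving (fun ω => (X ω, Z ω)) P (μ.prod γ)) {b : A → E} (hb : Measurable b)
    {g : A → F} (hg : Measurable g) {p : F → ℝ≥0∞} (hp : Measurable p) (hp_le : ∫⁻ s, p s ≤ 1)
    {q : F → E → ℝ≥0∞} (hq : Measurable (Function.uncurry q)) (hq_le : ∀ s, ∫⁻ y, q s y ≤ 1) :
    ∫⁻ x, p (g (X x.1) + x.2) * q (g (X x.1) + x.2) (b (X x.1) + Z x.1) /
      (mix φ μ b (b (X x.1) + Z x.1) * φ' x.2) ∂(P.prod γ') ≤ 1 := by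
  have hX : Measurable X := (measurePreserving_fst.comp h).measurable
  have hZ : Measurable Z := (measurePreserving_snd.comp h).measurable
  have hmix : Measurable (mix φ μ b) := hn.measurable_mix hb
  have hpq : Measurable fun u : E × F => p u.2 * q u.2 u.1 / mix φ μ b u.1 :=
    ((hp.comp measurable_snd).mul (hq.comp measurable_swap)).div (hmix.comp measurable_fst)
  have hm : Measurable fun x : Ω × F => p (g (X x.1) + x.2) *
      q (g (X x.1) + x.2) (b (X x.1) + Z x.1) / mix φ μ b (b (X x.1) + Z x.1) / φ' x.2 :=
    (hpq.comp (f := fun x : Ω × F => (b (X x.1) + Z x.1, g (X x.1) + x.2)) (by fun_prop)).div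
      (hn'.measurable.comp measurable_snd)
  calc _ = ∫⁻ x : Ω × F, p (g (X x.1) + x.2) * q (g (X x.1) + x.2) (b (X x.1) + Z x.1) /
        mix φ μ b (b (X x.1) + Z x.1) / φ' x.2 ∂(P.prod γ') :=
        lintegral_congr fun x => by
          simp only [div_eq_mul_inv, mul_assoc,
            ENNReal.mul_inv (.inr (hn'.ne_top x.2)) (.inr (hn'.ne_zero x.2))]
    _ = ∫⁻ ω, ∫⁻ s, p s * q s (b (X ω) + Z ω) / mix φ μ b (b (X ω) + Z ω) ∂volume ∂P := by
        rw [lintegral_prod _ hm.aemeasurable]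
        exact lintegral_congr fun ω => hn'.lintegral_add_div (g (X ω))
          (F := fun s => p s * q s (b (X ω) + Z ω) / mix φ μ b (b (X ω) + Z ω))
          (hpq.comp measurable_prodMk_left)
    _ = ∫⁻ y, mix φ μ b y * ∫⁻ s, p s * q s y / mix φ μ b y :=
        hn.lintegral_comp_add h hb hpq.lintegral_prod_right'
    _ ≤ ∫⁻ y, ∫⁻ s, p s * q s y := by
        refine lintegral_mono fun y => (lintegral_const_mul_le _ _).trans ?_
        exact lintegral_mono fun s => ENNReal.mul_div_le
    _ = ∫⁻ s, p s * ∫⁻ y, q s y := by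
        rw [lintegral_lintegral_swap
          ((hp.comp measurable_snd).mul (hq.comp measurable_swap)).aemeasurable]
        exact lintegral_congr fun s => lintegral_const_mul _ (hq.comp measurable_prodMk_left)
    _ ≤ ∫⁻ s, p s := lintegral_mono fun s => mul_le_of_le_one_right' (hq_le s)
    _ ≤ 1 := hp_le

end Genie

/-! ### Channels with conferencing transmitters -/

/-- Two transmitters with data `a₁`, `a₂` that agree on a link word `link a₁ a₂` and send signals
depending on it. The words have the rectangle property of a communication protocol: the data
leading to a word form a product `fiber₁ v ×ˢ fiber₂ v`. Transmitter `i` contributes `directᵢ` to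
the output of its own receiver and `crossᵢ` to that of the other one. -/
structure ConferencingChannel (A₁ A₂ ι E : Type*) [MeasurableSpace A₁] [MeasurableSpace A₂]
    [MeasurableSpace E] where
  link : A₁ → A₂ → ι
  fiber₁ : ι → Set A₁
  fiber₂ : ι → Set A₂
  measurableSet_fiber₁ : ∀ v, MeasurableSet (fiber₁ v)
  measurableSet_fiber₂ : ∀ v, MeasurableSet (fiber₂ v)
  link_eq_iff : ∀ {a₁ a₂ v}, link a₁ a₂ = v ↔ a₁ ∈ fiber₁ v ∧ a₂ ∈ fiber₂ v
  direct₁ : ι → A₁ → E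
  direct₂ : ι → A₂ → E
  cross₁ : ι → A₁ → E
  cross₂ : ι → A₂ → E
  measurable_direct₁ : ∀ v, Measurable (direct₁ v)
  measurable_direct₂ : ∀ v, Measurable (direct₂ v)
  measurable_cross₁ : ∀ v, Measurable (cross₁ v)
  measurable_cross₂ : ∀ v, Measurable (cross₂ v)

namespace ConferencingChannel

section Basic

variable {A₁ A₂ ι E : Type*} [MeasurableSpace A₁] [MeasurableSpace A₂] [MeasurableSpace E]
  (c : ConferencingChannel A₁ A₂ ι E)

/-- The channel with the roles of the users exchanged. -/
def swap : ConferencingChannel A₂ A₁ ι E where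
  link a₂ a₁ := c.link a₁ a₂
  fiber₁ := c.fiber₂
  fiber₂ := c.fiber₁
  measurableSet_fiber₁ := c.measurableSet_fiber₂
  measurableSet_fiber₂ := c.measurableSet_fiber₁
  link_eq_iff := c.link_eq_iff.trans and_comm
  direct₁ := c.direct₂
  direct₂ := c.direct₁
  cross₁ := c.cross₂
  cross₂ := c.cross₁
  measurable_direct₁ := c.measurable_direct₂
  measurable_direct₂ := c.measurable_direct₁
  measurable_cross₁ := c.measurable_cross₂
  measurable_cross₂ := c.measurable_cross₁

/-- The noiseless output at receiver 1. -/
def output₁ [Add E] (a : A₁ × A₂) : E :=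
  c.direct₁ (c.link a.1 a.2) a.1 + c.cross₂ (c.link a.1 a.2) a.2

/-- The noiseless output at receiver 2. -/
def output₂ [Add E] (a : A₁ × A₂) : E :=
  c.direct₂ (c.link a.1 a.2) a.2 + c.cross₁ (c.link a.1 a.2) a.1

/-- The pair of noiseless outputs. -/
def outputs [Add E] (a : A₁ × A₂) : E × E := (c.output₁ a, c.output₂ a)

/-- The signals that interfere at receivers 1 and 2. -/
def interference (a : A₁ × A₂) : E × E :=
  (c.cross₂ (c.link a.1 a.2) a.2, c.cross₁ (c.link a.1 a.2) a.1)

/-- The density, given the link word `v`, of the noisy interference at receiver 1. -/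
def interferencePDF₁ [AddCommGroup E] (φ : E → ℝ≥0∞) (m₂ : Measure A₂) (v : ι) : E → ℝ≥0∞ :=
  mix φ (m₂[|c.fiber₂ v]) (c.cross₂ v)

/-- The density, given the link word `v`, of the noisy interference at receiver 2. -/
def interferencePDF₂ [AddCommGroup E] (φ : E → ℝ≥0∞) (m₁ : Measure A₁) (v : ι) : E → ℝ≥0∞ :=
  c.swap.interferencePDF₁ φ m₁ v

end Basic

section Law

variable {A₁ A₂ ι E : Type*} [MeasurableSpace A₁] [MeasurableSpace A₂] [MeasurableSpace E]
  [MeasurableSpace ι] [Countable ι]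
  (c : ConferencingChannel A₁ A₂ ι E) {m₁ : Measure A₁} {m₂ : Measure A₂}

theorem measurable_link : Measurable fun a : A₁ × A₂ => c.link a.1 a.2 := by
  refine measurable_to_countable' fun v => ?_
  convert (c.measurableSet_fiber₁ v).prod (c.measurableSet_fiber₂ v) using 1
  ext a
  exact c.link_eq_iff

theorem isCondLaw_link_right [IsFiniteMeasure m₂] (a₁ : A₁) :
    IsCondLaw (fun v => m₂[|c.fiber₂ v]) (c.link a₁) m₂ where
  measurable := c.measurable_link.comp measurable_prodMk_left
  restrict_eq v := by
    by_cases ha₁ : a₁ ∈ c.fiber₁ v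
    · have hfiber : c.link a₁ ⁻¹' {v} = c.fiber₂ v := by ext a₂; simp [c.link_eq_iff, ha₁]
      rw [hfiber, measure_smul_cond]
    · have hempty : c.link a₁ ⁻¹' {v} = ∅ := by ext a₂; simp [c.link_eq_iff, ha₁]
      simp [hempty]

theorem isCondLaw_link [IsFiniteMeasure m₁] [IsFiniteMeasure m₂] :
    IsCondLaw (fun v => (m₁[|c.fiber₁ v]).prod (m₂[|c.fiber₂ v])) (fun a => c.link a.1 a.2)
      (m₁.prod m₂) where
  measurable := c.measurable_link
  restrict_eq v := by
    have hfiber : (fun a : A₁ × A₂ => c.link a.1 a.2) ⁻¹' {v} = c.fiber₁ v ×ˢ c.fiber₂ v := by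
      ext a
      exact c.link_eq_iff
    rw [hfiber, ← Measure.prod_restrict, ← measure_smul_cond, ← measure_smul_cond (μ := m₂),
      Measure.prod_prod, Measure.prod_smul_left, Measure.prod_smul_right, smul_smul]

variable [MeasurableSingletonClass ι]

theorem measurable_output₁ [AddCommGroup E] [MeasurableAdd₂ E] : Measurable c.output₁ :=
  (measurable_comp_of_countable c.measurable_direct₁ c.measurable_link measurable_fst).add
    (measurable_comp_of_countable c.measurable_cross₂ c.measurable_link measurable_snd)

theorem measurable_output₂ [AddCommGroup E] [MeasurableAdd₂ E] : Measurable c.output₂ :=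
  c.swap.measurable_output₁.comp measurable_swap

theorem measurable_outputs [AddCommGroup E] [MeasurableAdd₂ E] : Measurable c.outputs :=
  c.measurable_output₁.prodMk c.measurable_output₂

theorem measurable_interference : Measurable c.interference :=
  (measurable_comp_of_countable c.measurable_cross₂ c.measurable_link measurable_snd).prodMk
    (measurable_comp_of_countable c.measurable_cross₁ c.measurable_link measurable_fst)

end Law

end ConferencingChannel

namespace ConferencingChannel

/-- The noiseless outputs and the interference signals of the channel have finite power when the
data of the transmitters have laws `m₁` and `m₂`. -/
structure FinitePower {A₁ A₂ ι E : Type*} [MeasurableSpace A₁] [MeasurableSpace A₂]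
    [MeasurableSpace E] [Add E] (c : ConferencingChannel A₁ A₂ ι E) (sq : E → ℝ)
    (m₁ : Measure A₁) (m₂ : Measure A₂) : Prop where
  output₁ : Integrable (fun a => sq (c.output₁ a)) (m₁.prod m₂)
  output₂ : Integrable (fun a => sq (c.output₂ a)) (m₁.prod m₂)
  interference₁ : Integrable (fun a => sq (c.interference a).1) (m₁.prod m₂)
  interference₂ : Integrable (fun a => sq (c.interference a).2) (m₁.prod m₂)

section Noise

variable {Ω A₁ A₂ E : Type*} [MeasurableSpace Ω] [MeasurableSpace A₁] [MeasurableSpace A₂]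
  [MeasurableSpace E] {P : Measure Ω} {m₁ : Measure A₁} {m₂ : Measure A₂} {γ : Measure E}
  [SFinite m₁] [SFinite m₂] [IsProbabilityMeasure γ] {X : Ω → A₁ × A₂} {Z : Ω → E × E}

theorem measurePreserving_noise₁
    (h : MeasurePreserving (fun ω => (X ω, Z ω)) P ((m₁.prod m₂).prod (γ.prod γ))) :
    MeasurePreserving (fun ω => (X ω, (Z ω).1)) P ((m₁.prod m₂).prod γ) :=
  ((MeasurePreserving.id _).prod measurePreserving_fst).comp h

theorem measurePreserving_noise₂
    (h : MeasurePreserving (fun ω => (X ω, Z ω)) P ((m₁.prod m₂).prod (γ.prod γ))) :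
    MeasurePreserving (fun ω => ((X ω).swap, (Z ω).2)) P ((m₂.prod m₁).prod γ) :=
  (Measure.measurePreserving_swap.prod measurePreserving_snd).comp h

end Noise

variable {Ω A₁ A₂ ι E : Type*} [MeasurableSpace Ω] [MeasurableSpace A₁] [MeasurableSpace A₂]
  [MeasureSpace E] [AddCommGroup E] {c : ConferencingChannel A₁ A₂ ι E} {P : Measure Ω}
  {m₁ : Measure A₁} {m₂ : Measure A₂} [IsProbabilityMeasure m₁] [IsProbabilityMeasure m₂]
  {γ : Measure E} {φ : E → ℝ≥0∞} {sq : E → ℝ} {X : Ω → A₁ × A₂}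

theorem FinitePower.swap (hc : c.FinitePower sq m₁ m₂) : c.swap.FinitePower sq m₂ m₁ where
  output₁ := Measure.measurePreserving_swap.integrable_comp_of_integrable hc.output₂
  output₂ := Measure.measurePreserving_swap.integrable_comp_of_integrable hc.output₁
  interference₁ := Measure.measurePreserving_swap.integrable_comp_of_integrable hc.interference₂
  interference₂ := Measure.measurePreserving_swap.integrable_comp_of_integrable hc.interference₁

variable [MeasurableSpace ι] [MeasurableSingletonClass ι] [MeasurableAdd₂ E] [MeasurableNeg E]

theorem logIntegrable_interferencePDF₁ [Finite ι] [IsFiniteMeasure P]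
    [IsProbabilityMeasure γ] {Z : Ω → E} (hn : IsNoise γ φ sq) (hc : c.FinitePower sq m₁ m₂)
    (h : MeasurePreserving (fun ω => (X ω, Z ω)) P ((m₁.prod m₂).prod γ)) :
    LogIntegrable (fun ω => c.interferencePDF₁ φ m₂ (c.link (X ω).1 (X ω).2)
      ((c.interference (X ω)).1 + Z ω)) P := by
  have hX : MeasurePreserving X P (m₁.prod m₂) := measurePreserving_fst.comp h
  have hint : Measurable fun a => (c.interference a).1 := c.measurable_interference.fst
  have hne : ∀ᵐ a ∂m₁.prod m₂, m₂[|c.fiber₂ (c.link a.1 a.2)] ≠ 0 := by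
    filter_upwards [c.isCondLaw_link.ae_ne_zero] with a ha h₀
    exact ha (by rw [h₀, Measure.prod_zero])
  exact hn.logIntegrable_condMix (ν := fun v => m₂[|c.fiber₂ v]) c.measurable_cross₂
    (c.measurable_link.comp hX.measurable)
    ((hint.comp hX.measurable).add (measurePreserving_snd.comp h).measurable)
    (hn.integrable_sq_add h hint hc.interference₁) (hX.quasiMeasurePreserving.ae hne)

variable [(volume : Measure E).IsAddLeftInvariant] [SFinite (volume : Measure E)]

theorem lintegral_decode_le [Countable ι] [SFinite γ] {κ : Type*} [MeasurableSpace κ]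
    [Countable κ] [MeasurableSingletonClass κ] {Z : Ω → E} (hn : IsNoise γ φ sq)
    (h : MeasurePreserving (fun ω => (X ω, Z ω)) P ((m₁.prod m₂).prod γ))
    {W : A₁ → κ} (hW : Measurable W) {t : κ → E → ℝ≥0∞} (ht : IsTest t W m₁)
    {p : E → ℝ≥0∞} (hp : Measurable p) (hp_le : ∫⁻ y, p y ≤ 1) :
    ∫⁻ ω, t (W (X ω).1) (c.output₁ (X ω) + Z ω) * p (c.output₁ (X ω) + Z ω) /
      c.interferencePDF₁ φ m₂ (c.link (X ω).1 (X ω).2) ((c.interference (X ω)).1 + Z ω) ∂P ≤ 1 := by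
  have htW : Measurable fun x : A₁ × E => t (W x.1) x.2 :=
    measurable_comp_of_countable ht.measurable (hW.comp measurable_fst) measurable_snd
  have hout := c.measurable_output₁
  have hlink := c.measurable_link
  have hint := c.measurable_interference
  have hm : Measurable fun x : (A₁ × A₂) × E =>
      t (W x.1.1) (c.output₁ x.1 + x.2) * p (c.output₁ x.1 + x.2) /
        c.interferencePDF₁ φ m₂ (c.link x.1.1 x.1.2) ((c.interference x.1).1 + x.2) :=
    ((htW.comp (f := fun x : (A₁ × A₂) × E => (x.1.1, c.output₁ x.1 + x.2)) (by fun_prop)).mul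
      (hp.comp (by fun_prop))).div (measurable_comp_of_countable (f := c.interferencePDF₁ φ m₂)
        (fun v => hn.measurable_mix (c.measurable_cross₂ v))
        (I := fun x : (A₁ × A₂) × E => c.link x.1.1 x.1.2) (by fun_prop)
        ((hint.fst.comp measurable_fst).add measurable_snd))
  rw [lintegral_comp_prod h hm, lintegral_prod _ hm.lintegral_prod_right'.aemeasurable]
  calc _ ≤ ∫⁻ a₁, ∫⁻ y, t (W a₁) y * p y ∂volume ∂m₁ := by
        refine lintegral_mono fun a₁ => ?_
        have htp : Measurable fun y => t (W a₁) y * p y := (htW.comp measurable_prodMk_left).mul hp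
        let F v s := t (W a₁) (c.direct₁ v a₁ + s) * p (c.direct₁ v a₁ + s)
        have hle := hn.lintegral_div_condMix_le (c.isCondLaw_link_right (m₂ := m₂) a₁)
          c.measurable_cross₂ (F := F) fun v => htp.comp (measurable_const_add _)
        have hshift (v : ι) : ∫⁻ s, F v s = ∫⁻ y, t (W a₁) y * p y :=
          lintegral_add_left_eq_self (fun y => t (W a₁) y * p y) _
        simp only [hshift, lintegral_const, measure_univ, mul_one] at hle
        simpa only [F, output₁, interference, interferencePDF₁, add_assoc] using hle
    _ ≤ ∫⁻ y, p y := ht.lintegral_mul_le hW hp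
    _ ≤ 1 := hp_le

/-- Receiver 1, having decoded, is left with the interference: `I(W₁; y₁) ≤ h(y₁) - h(s₁ | V)`. -/
theorem meanLog_decode_le [Finite ι] [IsProbabilityMeasure γ] [IsProbabilityMeasure P]
    {κ : Type*} [MeasurableSpace κ] [Countable κ] [MeasurableSingletonClass κ] {Z : Ω → E}
    (hn : IsNoise γ φ sq) (hc : c.FinitePower sq m₁ m₂)
    (h : MeasurePreserving (fun ω => (X ω, Z ω)) P ((m₁.prod m₂).prod γ))
    {W : A₁ → κ} (hW : Measurable W) {t : κ → E → ℝ≥0∞} (ht : IsTest t W m₁)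
    (htlog : LogIntegrable (fun ω => t (W (X ω).1) (c.output₁ (X ω) + Z ω)) P)
    {p : E → ℝ≥0∞} (hp : Measurable p) (hp_le : ∫⁻ y, p y ≤ 1)
    (hplog : LogIntegrable (fun ω => p (c.output₁ (X ω) + Z ω)) P) :
    meanLog P (fun ω => t (W (X ω).1) (c.output₁ (X ω) + Z ω)) +
        meanLog P (fun ω => p (c.output₁ (X ω) + Z ω)) ≤
      meanLog P fun ω => c.interferencePDF₁ φ m₂ (c.link (X ω).1 (X ω).2)
        ((c.interference (X ω)).1 + Z ω) := by
  rw [← meanLog_mul htlog hplog]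
  exact (htlog.mul hplog).meanLog_le (logIntegrable_interferencePDF₁ hn hc h)
    (lintegral_decode_le hn h hW ht hp hp_le)

theorem lintegral_interferencePDF_div_le [Fintype ι] [IsProbabilityMeasure γ] {Z : Ω → E × E}
    (hn : IsNoise γ φ sq)
    (h : MeasurePreserving (fun ω => (X ω, Z ω)) P ((m₁.prod m₂).prod (γ.prod γ))) :
    ∫⁻ ω, c.interferencePDF₁ φ m₂ (c.link (X ω).1 (X ω).2) ((c.interference (X ω)).1 + (Z ω).1) *
        c.interferencePDF₂ φ m₁ (c.link (X ω).1 (X ω).2) ((c.interference (X ω)).2 + (Z ω).2) /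
      mix (pairPDF φ) (m₁.prod m₂) c.interference (c.interference (X ω) + Z ω) ∂P ≤
      Fintype.card ι := by
  have hlink := c.measurable_link
  have hint := c.measurable_interference
  have hm : Measurable fun x : (A₁ × A₂) × E × E =>
      c.interferencePDF₁ φ m₂ (c.link x.1.1 x.1.2) ((c.interference x.1).1 + x.2.1) *
        c.interferencePDF₂ φ m₁ (c.link x.1.1 x.1.2) ((c.interference x.1).2 + x.2.2) /
      mix (pairPDF φ) (m₁.prod m₂) c.interference (c.interference x.1 + x.2) := by
    refine Measurable.div (Measurable.mul ?_ ?_) ((hn.pair.measurable_mix hint).comp (by fun_prop))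
    · exact measurable_comp_of_countable (f := c.interferencePDF₁ φ m₂)
        (fun v => hn.measurable_mix (c.measurable_cross₂ v))
        (I := fun x : (A₁ × A₂) × E × E => c.link x.1.1 x.1.2) (by fun_prop)
        ((hint.fst.comp measurable_fst).add measurable_snd.fst)
    · exact measurable_comp_of_countable (f := c.interferencePDF₂ φ m₁)
        (fun v => hn.measurable_mix (c.measurable_cross₁ v))
        (I := fun x : (A₁ × A₂) × E × E => c.link x.1.1 x.1.2) (by fun_prop)
        ((hint.snd.comp measurable_fst).add measurable_snd.snd)
  have hmass (v : ι) : ((m₁[|c.fiber₁ v]).prod (m₂[|c.fiber₂ v])) Set.univ ≤ 1 := by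
    rw [← Set.univ_prod_univ, Measure.prod_prod]
    exact mul_le_one' prob_le_one prob_le_one
  have hle := hn.pair.lintegral_condMix_div_mix_le (c.isCondLaw_link (m₁ := m₁) (m₂ := m₂)) hmass
    (g := fun v (a : A₁ × A₂) => (c.cross₂ v a.2, c.cross₁ v a.1))
    (fun v => ((c.measurable_cross₂ v).comp measurable_snd).prodMk
      ((c.measurable_cross₁ v).comp measurable_fst)) hint
  simp only [mix_pairPDF hn.measurable (c.measurable_cross₁ _) (c.measurable_cross₂ _)] at hle
  exact (lintegral_comp_prod h hm).trans_le hle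

variable [Fintype ι] [IsProbabilityMeasure γ] [IsProbabilityMeasure P] {Z : Ω → E × E}

/-- `h(s₁, s₂) ≤ h(s₁ | V) + h(s₂ | V) + log |V|`, as the data are independent given `V`. -/
theorem meanLog_interferencePDF_le (hn : IsNoise γ φ sq) (hc : c.FinitePower sq m₁ m₂)
    (h : MeasurePreserving (fun ω => (X ω, Z ω)) P ((m₁.prod m₂).prod (γ.prod γ))) :
    meanLog P (fun ω => c.interferencePDF₁ φ m₂ (c.link (X ω).1 (X ω).2)
        ((c.interference (X ω)).1 + (Z ω).1)) +
      meanLog P (fun ω => c.interferencePDF₂ φ m₁ (c.link (X ω).1 (X ω).2)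
        ((c.interference (X ω)).2 + (Z ω).2)) ≤
    meanLog P (fun ω => mix (pairPDF φ) (m₁.prod m₂) c.interference (c.interference (X ω) + Z ω)) +
      Real.log (Fintype.card ι) := by
  have hX : MeasurePreserving X P (m₁.prod m₂) := measurePreserving_fst.comp h
  have hZ : MeasurePreserving Z P (γ.prod γ) := measurePreserving_snd.comp h
  have hint := c.measurable_interference
  obtain ⟨ω⟩ : Nonempty Ω := P.nonempty_of_neZero
  have : Nonempty ι := ⟨c.link (X ω).1 (X ω).2⟩
  have h₁ := logIntegrable_interferencePDF₁ hn hc (measurePreserving_noise₁ h)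
  have h₂ : LogIntegrable (fun ω => c.interferencePDF₂ φ m₁ (c.link (X ω).1 (X ω).2)
      ((c.interference (X ω)).2 + (Z ω).2)) P :=
    logIntegrable_interferencePDF₁ (c := c.swap) (X := fun ω => (X ω).swap)
      (Z := fun ω => (Z ω).2) hn hc.swap (measurePreserving_noise₂ h)
  have hmix : LogIntegrable (fun ω => mix (pairPDF φ) (m₁.prod m₂) c.interference
      (c.interference (X ω) + Z ω)) P :=
    hn.pair.logIntegrable_mix hint ((hint.comp hX.measurable).add hZ.measurable)
      (hn.pair.integrable_sq_add h hint (hc.interference₁.add hc.interference₂))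
  rw [← meanLog_mul h₁ h₂]
  refine (h₁.mul h₂).meanLog_le_add_log hmix (by simp [Fintype.card_pos]) ?_
  simpa using lintegral_interferencePDF_div_le hn h

end ConferencingChannel

section Entropy

variable {Ω A E : Type*} [MeasurableSpace Ω] [MeasurableSpace A] [MeasureSpace E] [AddCommGroup E]
  [MeasurableAdd₂ E] [MeasurableNeg E] {γ : Measure E} [IsProbabilityMeasure γ] {φ : E → ℝ≥0∞}
  {sq : E → ℝ} {P : Measure Ω} [IsProbabilityMeasure P] {μ : Measure A} [IsProbabilityMeasure μ]
  {X : Ω → A}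

theorem IsNoise.logIntegrable_mix_add (hn : IsNoise γ φ sq) {Z : Ω → E}
    (h : MeasurePreserving (fun ω => (X ω, Z ω)) P (μ.prod γ)) {b : A → E} (hb : Measurable b)
    (hsq : Integrable (fun a => sq (b a)) μ) :
    LogIntegrable (fun ω => mix φ μ b (b (X ω) + Z ω)) P :=
  hn.logIntegrable_mix hb
    ((hb.comp (measurePreserving_fst.comp h).measurable).add
      (measurePreserving_snd.comp h).measurable)
    (hn.integrable_sq_add h hb hsq)

variable [(volume : Measure E).IsAddLeftInvariant] [SFinite (volume : Measure E)]

/-- Decoding a secret message: `I(W; y₁) ≤ h(y₁ | y₂) - h(z₁) + I(W; y₂)`. -/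
theorem IsTest.meanLog_decode_secret_le {κ : Type*} [MeasurableSpace κ] [Finite κ]
    [MeasurableSingletonClass κ] (hn : IsNoise γ φ sq) {W : A → κ} (hW : Measurable W)
    {t : κ → E → ℝ≥0∞} (ht : IsTest t W μ) {Z : Ω → E × E}
    (h : MeasurePreserving (fun ω => (X ω, Z ω)) P (μ.prod (γ.prod γ))) {b₁ b₂ : A → E}
    (hb₁ : Measurable b₁) (hb₂ : Measurable b₂) (hsq₁ : Integrable (fun a => sq (b₁ a)) μ)
    (hsq₂ : Integrable (fun a => sq (b₂ a)) μ)
    (htlog : LogIntegrable (fun ω => t (W (X ω)) (b₁ (X ω) + (Z ω).1)) P) {r : ℝ} (hr : 0 ≤ r)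
    (hI : mutualInfo P (fun ω => W (X ω)) (fun ω => b₂ (X ω) + (Z ω).2) ≤ ENNReal.ofReal r) :
    meanLog P (fun ω => t (W (X ω)) (b₁ (X ω) + (Z ω).1)) +
        meanLog P (fun ω => mix (pairPDF φ) μ (fun a => (b₁ a, b₂ a))
          ((b₁ (X ω), b₂ (X ω)) + Z ω)) ≤
      meanLog P (fun ω => mix φ μ b₂ (b₂ (X ω) + (Z ω).2)) + r + meanLog γ φ := by
  have hb : Measurable fun a => (b₁ a, b₂ a) := hb₁.prodMk hb₂
  have hν := isCondLaw_cond (μ := μ) hW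
  have hX : MeasurePreserving X P μ := measurePreserving_fst.comp h
  have hZ₁ : MeasurePreserving (fun ω => (Z ω).1) P γ :=
    measurePreserving_fst.comp (measurePreserving_snd.comp h)
  have h₂ : MeasurePreserving (fun ω => (X ω, (Z ω).2)) P (μ.prod γ) :=
    ((MeasurePreserving.id _).prod measurePreserving_snd).comp h
  have hplog := hn.pair.logIntegrable_mix_add h hb (hsq₁.add hsq₂)
  have hcond : LogIntegrable (fun ω => mix φ (μ[|W ⁻¹' {W (X ω)}]) b₂ (b₂ (X ω) + (Z ω).2)) P :=
    hn.logIntegrable_condMix (ν := fun w => μ[|W ⁻¹' {w}]) (fun _ => hb₂) (hW.comp hX.measurable)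
      ((hb₂.comp hX.measurable).add (measurePreserving_snd.comp h₂).measurable)
      (hn.integrable_sq_add h₂ hb₂ hsq₂) (hX.quasiMeasurePreserving.ae hν.ae_ne_zero)
  have hφ : LogIntegrable φ γ := hn.logIntegrable_noise (.id γ)
  have hnoise := hφ.comp_measurePreserving hZ₁
  have hdecode := (htlog.mul hplog).meanLog_le (hcond.mul hnoise)
    (ht.lintegral_decode_given_le hn hν (Z₁ := fun ω => (Z ω).1) (Z₂ := fun ω => (Z ω).2)
      (((MeasurePreserving.id _).prod Measure.measurePreserving_swap).comp h) hb₁ hb₂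
      (hn.pair.measurable_mix hb) ((hn.pair.lintegral_mix hb).trans_le prob_le_one))
  have hleak := hn.meanLog_condMix_le_of_mutualInfo_le hν (fun _ => prob_le_one) h₂ hb₂ hsq₂ hr hI
  rw [meanLog_mul htlog hplog, meanLog_mul hcond hnoise,
    meanLog_comp_measurePreserving hφ hZ₁] at hdecode
  linarith

theorem IsNoise.meanLog_genie_le {F : Type*} [MeasureSpace F] [AddCommGroup F]
    [MeasurableAdd₂ F] [MeasurableNeg F] [SFinite (volume : Measure F)]
    [(volume : Measure F).IsAddLeftInvariant] {γ' : Measure F} [IsProbabilityMeasure γ']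
    {φ' : F → ℝ≥0∞} {sq' : F → ℝ} (hn : IsNoise γ φ sq) (hn' : IsNoise γ' φ' sq') {Z : Ω → E}
    {Z' : Ω → F} (h : MeasurePreserving (fun ω => (X ω, Z ω)) P (μ.prod γ))
    (h' : MeasurePreserving (fun ω => (X ω, Z' ω)) P (μ.prod γ')) {b : A → E} (hb : Measurable b)
    {g : A → F} (hg : Measurable g) (hsqb : Integrable (fun a => sq (b a)) μ)
    (hsqg : Integrable (fun a => sq' (g a)) μ) {q : F → E → ℝ≥0∞}
    (hq : Measurable (Function.uncurry q)) (hq_le : ∀ s, ∫⁻ y, q s y ≤ 1)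
    (hqlog : LogIntegrable (fun x => q (g (X x.1) + x.2) (b (X x.1) + Z x.1)) (P.prod γ')) :
    meanLog P (fun ω => mix φ' μ g (g (X ω) + Z' ω)) +
        meanLog (P.prod γ') (fun x => q (g (X x.1) + x.2) (b (X x.1) + Z x.1)) ≤
      meanLog P (fun ω => mix φ μ b (b (X ω) + Z ω)) + meanLog γ' φ' := by
  have hX : MeasurePreserving X P μ := measurePreserving_fst.comp h
  have hfresh : MeasurePreserving (fun x : Ω × F => (X x.1, x.2)) (P.prod γ') (μ.prod γ') :=
    hX.prod (.id γ')
  have hp : LogIntegrable (fun x : A × F => mix φ' μ g (g x.1 + x.2)) (μ.prod γ') :=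
    hn'.logIntegrable_mix_add (.id _) hg hsqg
  have hpfresh := hp.comp_measurePreserving hfresh
  have hmix := hn.logIntegrable_mix_add h hb hsqb
  have hnoise := hn'.logIntegrable_noise (.id γ')
  have hfst : MeasurePreserving (Prod.fst : Ω × F → Ω) (P.prod γ') P := measurePreserving_fst
  have hsnd : MeasurePreserving (Prod.snd : Ω × F → F) (P.prod γ') γ' := measurePreserving_snd
  have hle := (hpfresh.mul hqlog).meanLog_le
    ((hmix.comp_measurePreserving hfst).mul (hnoise.comp_measurePreserving hsnd))
    (hn.lintegral_genie_le hn' h hb hg (hn'.measurable_mix hg)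
      ((hn'.lintegral_mix hg).trans_le prob_le_one) hq hq_le)
  rwa [meanLog_mul hpfresh hqlog, meanLog_comp_measurePreserving hp hfresh,
    ← meanLog_comp_measurePreserving hp h', meanLog_mul (hmix.comp_measurePreserving hfst)
    (hnoise.comp_measurePreserving hsnd), meanLog_comp_measurePreserving hmix hfst,
    meanLog_comp_measurePreserving hnoise hsnd] at hle

end Entropy

namespace ConferencingChannel

variable {Ω A₁ A₂ ι E κ₁ κ₂ : Type*} [MeasurableSpace Ω] [MeasurableSpace A₁] [MeasurableSpace A₂]
  [Fintype ι] [MeasurableSpace ι] [MeasurableSingletonClass ι] [MeasureSpace E] [AddCommGroup E]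
  [MeasurableAdd₂ E] [MeasurableNeg E] [(volume : Measure E).IsAddLeftInvariant]
  [SFinite (volume : Measure E)] [MeasurableSpace κ₁] [Finite κ₁] [MeasurableSingletonClass κ₁]
  [MeasurableSpace κ₂] [Countable κ₂] [MeasurableSingletonClass κ₂]
  {c : ConferencingChannel A₁ A₂ ι E} {P : Measure Ω} [IsProbabilityMeasure P] {m₁ : Measure A₁}
  {m₂ : Measure A₂} [IsProbabilityMeasure m₁] [IsProbabilityMeasure m₂] {γ : Measure E}
  [IsProbabilityMeasure γ] {φ : E → ℝ≥0∞} {sq : E → ℝ} {X : Ω → A₁ × A₂} {Z : Ω → E × E}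

/-- In terms of entropies, and with `sᵢ'` the interference under fresh noise:
`2 I(W₁; y₁) + I(W₂; y₂) ≤ I(W₁; y₂) + log |V| + h(y₁) + h(y₁, y₂ | s₁', s₂') - 3 h(z)`. -/
theorem two_mul_meanLog_add_meanLog_le (hn : IsNoise γ φ sq) (hc : c.FinitePower sq m₁ m₂)
    (h : MeasurePreserving (fun ω => (X ω, Z ω)) P ((m₁.prod m₂).prod (γ.prod γ)))
    {W₁ : A₁ → κ₁} (hW₁ : Measurable W₁) {t₁ : κ₁ → E → ℝ≥0∞} (ht₁ : IsTest t₁ W₁ m₁)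
    (ht₁log : LogIntegrable (fun ω => t₁ (W₁ (X ω).1) (c.output₁ (X ω) + (Z ω).1)) P)
    {W₂ : A₂ → κ₂} (hW₂ : Measurable W₂) {t₂ : κ₂ → E → ℝ≥0∞} (ht₂ : IsTest t₂ W₂ m₂)
    (ht₂log : LogIntegrable (fun ω => t₂ (W₂ (X ω).2) (c.output₂ (X ω) + (Z ω).2)) P)
    {r : ℝ} (hr : 0 ≤ r)
    (hI : mutualInfo P (fun ω => W₁ (X ω).1) (fun ω => c.output₂ (X ω) + (Z ω).2) ≤
      ENNReal.ofReal r)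
    {p : E → ℝ≥0∞} (hp : Measurable p) (hp_le : ∫⁻ y, p y ≤ 1)
    (hplog : LogIntegrable (fun ω => p (c.output₁ (X ω) + (Z ω).1)) P)
    {q : E × E → E × E → ℝ≥0∞} (hq : Measurable (Function.uncurry q))
    (hq_le : ∀ s, ∫⁻ y, q s y ≤ 1)
    (hqlog : LogIntegrable (fun x : Ω × E × E => q (c.interference (X x.1) + x.2)
      (c.outputs (X x.1) + Z x.1)) (P.prod (γ.prod γ))) :
    2 * meanLog P (fun ω => t₁ (W₁ (X ω).1) (c.output₁ (X ω) + (Z ω).1)) +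
        meanLog P (fun ω => t₂ (W₂ (X ω).2) (c.output₂ (X ω) + (Z ω).2)) +
        meanLog P (fun ω => p (c.output₁ (X ω) + (Z ω).1)) +
        meanLog (P.prod (γ.prod γ)) (fun x => q (c.interference (X x.1) + x.2)
          (c.outputs (X x.1) + Z x.1)) ≤
      r + Real.log (Fintype.card ι) + meanLog γ φ + meanLog (γ.prod γ) (pairPDF φ) := by
  have hout₂ := c.measurable_output₂
  have hsecret : meanLog P (fun ω => t₁ (W₁ (X ω).1) (c.output₁ (X ω) + (Z ω).1)) +
      meanLog P (fun ω => mix (pairPDF φ) (m₁.prod m₂) c.outputs (c.outputs (X ω) + Z ω)) ≤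
      meanLog P (fun ω => mix φ (m₁.prod m₂) c.output₂ (c.output₂ (X ω) + (Z ω).2)) + r +
        meanLog γ φ :=
    (ht₁.comp_measurePreserving hW₁ measurePreserving_fst).meanLog_decode_secret_le hn
      (hW₁.comp measurable_fst) h c.measurable_output₁ hout₂ hc.output₁ hc.output₂ ht₁log hr hI
  have hdecode₁ := meanLog_decode_le hn hc (measurePreserving_noise₁ h) hW₁ ht₁ ht₁log hp hp_le
    hplog
  have hdecode₂ : meanLog P (fun ω => t₂ (W₂ (X ω).2) (c.output₂ (X ω) + (Z ω).2)) +
      meanLog P (fun ω => mix φ (m₁.prod m₂) c.output₂ (c.output₂ (X ω) + (Z ω).2)) ≤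
      meanLog P (fun ω => c.interferencePDF₂ φ m₁ (c.link (X ω).1 (X ω).2)
        ((c.interference (X ω)).2 + (Z ω).2)) :=
    meanLog_decode_le (c := c.swap) (X := fun ω => (X ω).swap) (Z := fun ω => (Z ω).2) hn hc.swap
      (measurePreserving_noise₂ h) hW₂ ht₂ ht₂log (hn.measurable_mix hout₂)
      ((hn.lintegral_mix hout₂).trans_le prob_le_one) (hn.logIntegrable_mix_add
        (((MeasurePreserving.id _).prod measurePreserving_snd).comp h) hout₂ hc.output₂)
  have hlink := meanLog_interferencePDF_le hn hc h
  have hgenie := hn.pair.meanLog_genie_le hn.pair h h c.measurable_outputs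
    c.measurable_interference (hc.output₁.add hc.output₂)
    (hc.interference₁.add hc.interference₂) hq hq_le hqlog
  linarith

end ConferencingChannel

/-! ### Gaussian densities -/

theorem lintegral_pi_prod {n : ℕ} (μ : Fin n → Measure ℝ) [∀ k, SigmaFinite (μ k)]
    {f : Fin n → ℝ → ℝ≥0∞} (hf : ∀ k, Measurable (f k)) :
    ∫⁻ x, ∏ k, f k (x k) ∂(Measure.pi μ) = ∏ k, ∫⁻ x, f k x ∂(μ k) := by
  induction n with
  | zero => simp
  | succ n ih =>
    have htail : Measurable fun x : Fin n → ℝ => ∏ k, f k.succ (x k) :=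
      Finset.measurable_fun_prod _ fun k _ => (hf _).comp (measurable_pi_apply k)
    rw [← (measurePreserving_piFinSuccAbove μ 0).symm.lintegral_comp_emb
      (MeasurableEquiv.measurableEmbedding _)]
    simp only [MeasurableEquiv.piFinSuccAbove_symm_apply, Fin.insertNthEquiv,
      Fin.prod_univ_succ, Fin.insertNth_zero, Equiv.coe_fn_mk, Fin.cons_succ,
      Fin.zero_succAbove, Fin.cons_zero, cast_eq]
    rw [lintegral_prod_mul (hf 0).aemeasurable htail.aemeasurable,
      ih (fun k => μ k.succ) fun k => hf _]

variable {n : ℕ}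

/-- Squared Euclidean norm; the norm of `Fin n → ℝ` itself is the supremum norm. -/
def sqNorm (u : Fin n → ℝ) : ℝ := u ⬝ᵥ u

theorem sqNorm_eq_sum (u : Fin n → ℝ) : sqNorm u = ∑ k, u k ^ 2 := by
  simp only [sqNorm, dotProduct, sq]

theorem sqNorm_nonneg (u : Fin n → ℝ) : 0 ≤ sqNorm u := by
  rw [sqNorm_eq_sum]
  exact Finset.sum_nonneg fun k _ => sq_nonneg (u k)

theorem sqNorm_smul_add_smul (a b : ℝ) (u v : Fin n → ℝ) :
    sqNorm (a • u + b • v) = a ^ 2 * sqNorm u + b ^ 2 * sqNorm v + 2 * a * b * (u ⬝ᵥ v) := by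
  simp only [sqNorm, add_dotProduct, dotProduct_add, smul_dotProduct, dotProduct_smul,
    smul_eq_mul, dotProduct_comm v u]
  ring

theorem sqNorm_add_le (u v : Fin n → ℝ) : sqNorm (u + v) ≤ 2 * (sqNorm u + sqNorm v) := by
  have hadd := sqNorm_smul_add_smul 1 1 u v
  have hsub := sqNorm_smul_add_smul 1 (-1) u v
  have hnonneg := sqNorm_nonneg ((1 : ℝ) • u + (-1 : ℝ) • v)
  rw [one_smul, one_smul] at hadd
  linarith

theorem sqNorm_neg (u : Fin n → ℝ) : sqNorm (-u) = sqNorm u := by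
  rw [sqNorm, sqNorm, neg_dotProduct_neg]

theorem measurable_sqNorm : Measurable (sqNorm : (Fin n → ℝ) → ℝ) := by
  simp only [funext sqNorm_eq_sum]
  fun_prop

/-- The density of independent Gaussian coordinates with means `m k` and common variance `v`. -/
def gaussPDF (m : Fin n → ℝ) (v : ℝ≥0) (u : Fin n → ℝ) : ℝ≥0∞ :=
  ∏ k, gaussianPDF (m k) v (u k)

theorem measurable_gaussPDF {α : Type*} [MeasurableSpace α] {m u : α → Fin n → ℝ}
    (hm : Measurable m) (hu : Measurable u) (v : ℝ≥0) :
    Measurable fun a => gaussPDF (m a) v (u a) :=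
  Finset.measurable_fun_prod _ fun k _ =>
    measurable_uncurry_gaussianPDF.comp (((measurable_pi_apply k).comp hm).prodMk
      (measurable_const.prodMk ((measurable_pi_apply k).comp hu)))

theorem lintegral_gaussPDF (m : Fin n → ℝ) {v : ℝ≥0} (hv : v ≠ 0) :
    ∫⁻ u, gaussPDF m v u = 1 := by
  simp only [gaussPDF]
  rw [volume_pi, lintegral_pi_prod (fun _ => volume) fun k => measurable_gaussianPDF (m k) v]
  exact Finset.prod_eq_one fun k _ => lintegral_gaussianPDF_eq_one (m k) hv

theorem gaussPDF_ne_zero (m : Fin n → ℝ) {v : ℝ≥0} (hv : v ≠ 0) (u : Fin n → ℝ) :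
    gaussPDF m v u ≠ 0 :=
  Finset.prod_ne_zero_iff.2 fun _ _ => (gaussianPDF_pos _ hv _).ne'

theorem gaussPDF_ne_top (m : Fin n → ℝ) (v : ℝ≥0) (u : Fin n → ℝ) : gaussPDF m v u ≠ ∞ :=
  ENNReal.prod_ne_top fun _ _ => gaussianPDF_ne_top

theorem toReal_gaussPDF (m : Fin n → ℝ) (v : ℝ≥0) (u : Fin n → ℝ) :
    (gaussPDF m v u).toReal
      = (√(2 * Real.pi * v))⁻¹ ^ n * Real.exp (-(sqNorm (u - m) / (2 * v))) := by
  simp only [gaussPDF, ENNReal.toReal_prod, toReal_gaussianPDF, gaussianPDFReal]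
  rw [Finset.prod_mul_distrib, ← Real.exp_sum, Finset.prod_const, Finset.card_univ,
    Fintype.card_fin]
  simp only [sqNorm_eq_sum, Pi.sub_apply, neg_div, Finset.sum_neg_distrib, Finset.sum_div]

theorem log_gaussPDF (m : Fin n → ℝ) {v : ℝ≥0} (hv : v ≠ 0) (u : Fin n → ℝ) :
    Real.log (gaussPDF m v u).toReal
      = -(n / 2 * Real.log (2 * Real.pi * v)) - sqNorm (u - m) / (2 * v) := by
  have hpos : 0 < 2 * Real.pi * (v : ℝ) := by positivity
  rw [toReal_gaussPDF, Real.log_mul (by positivity) (Real.exp_pos _).ne', Real.log_exp,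
    Real.log_pow, Real.log_inv, Real.log_sqrt hpos.le]
  ring

/-! ### The Gaussian noise blocks -/

/-- The law of a block of `n` independent standard Gaussian noise samples. -/
abbrev stdNoise (n : ℕ) : Measure (Fin n → ℝ) := Measure.pi fun _ : Fin n => gaussianReal 0 1

/-- The density of `stdNoise n`. -/
abbrev stdPDF (n : ℕ) : (Fin n → ℝ) → ℝ≥0∞ := gaussPDF 0 1

theorem measurePreserving_noise_coord (k : Fin n) :
    MeasurePreserving (fun z : Fin n → ℝ => z k) (stdNoise n) (gaussianReal 0 1) :=
  measurePreserving_eval (fun _ : Fin n => gaussianReal 0 1) k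

theorem memLp_id_stdNoise : MemLp (fun z : Fin n → ℝ => z) 2 (stdNoise n) :=
  MemLp.of_eval fun k =>
    (memLp_id_gaussianReal 2).comp_measurePreserving (measurePreserving_noise_coord k)

theorem integral_id_stdNoise : ∫ z, z ∂(stdNoise n) = 0 := by
  ext k
  rw [eval_integral fun i => (memLp_id_stdNoise.eval i).integrable one_le_two]
  simpa using (measurePreserving_noise_coord k).hasLaw.integral_comp (f := id) (by fun_prop)

theorem integral_sq_gaussianReal : ∫ x, x ^ 2 ∂(gaussianReal 0 1) = 1 := by
  have hvar := variance_of_integral_eq_zero (μ := gaussianReal 0 1) (X := id) (by fun_prop)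
    integral_id_gaussianReal
  rw [variance_id_gaussianReal] at hvar
  simpa using hvar.symm

theorem integrable_sqNorm_of_memLp {A : Type*} [MeasurableSpace A] {μ : Measure A}
    {f : A → Fin n → ℝ} (hf : MemLp f 2 μ) : Integrable (fun a => sqNorm (f a)) μ := by
  simp only [sqNorm_eq_sum]
  exact integrable_finsetSum _ fun k _ => (hf.eval k).integrable_sq

theorem integral_sqNorm_stdNoise : ∫ z, sqNorm z ∂(stdNoise n) = n := by
  have hcoord (k : Fin n) : ∫ z : Fin n → ℝ, z k ^ 2 ∂(stdNoise n) = 1 :=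
    ((measurePreserving_noise_coord k).hasLaw.integral_comp (f := fun x => x ^ 2)
      (by fun_prop)).trans integral_sq_gaussianReal
  simp only [sqNorm_eq_sum]
  rw [integral_finsetSum _ fun k _ => (memLp_id_stdNoise.eval k).integrable_sq]
  simp [hcoord]

theorem stdNoise_eq_withDensity : stdNoise n = volume.withDensity (stdPDF n) := by
  refine Measure.pi_eq fun s hs => ?_
  rw [withDensity_apply _ (MeasurableSet.univ_pi hs), volume_pi, Measure.restrict_pi_pi]
  simp only [stdPDF, gaussPDF]
  rw [lintegral_pi_prod _ fun k => measurable_gaussianPDF _ _]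
  refine Finset.prod_congr rfl fun k _ => ?_
  rw [gaussianReal_of_var_ne_zero _ one_ne_zero, withDensity_apply _ (hs k)]
  rfl

theorem stdPDF_eq (u : Fin n → ℝ) :
    stdPDF n u = ENNReal.ofReal ((√(2 * Real.pi))⁻¹ ^ n * Real.exp (-(sqNorm u / 2))) := by
  refine (ENNReal.ofReal_toReal (gaussPDF_ne_top 0 1 u)).symm.trans ?_
  simp [toReal_gaussPDF]

theorem stdPDF_le_one (u : Fin n → ℝ) : stdPDF n u ≤ 1 := by
  have hsqrt : 1 ≤ √(2 * Real.pi) := Real.one_le_sqrt.2 (by linarith [Real.pi_gt_three])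
  rw [stdPDF_eq, ENNReal.ofReal_le_one]
  refine mul_le_one₀ (pow_le_one₀ (by positivity) (inv_le_one_of_one_le₀ hsqrt))
    (Real.exp_pos _).le (Real.exp_le_one_iff.2 ?_)
  linarith [sqNorm_nonneg u]

theorem isNoise_stdNoise : IsNoise (stdNoise n) (stdPDF n) sqNorm where
  measurable := measurable_gaussPDF measurable_const measurable_id 1
  eq_withDensity := stdNoise_eq_withDensity
  le_one := stdPDF_le_one
  lower := by
    refine ⟨(√(2 * Real.pi))⁻¹ ^ n, by positivity, fun y g => ?_⟩
    rw [stdPDF_eq, mul_assoc, ← Real.exp_add]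
    have hsub := sqNorm_add_le y (-g)
    rw [sqNorm_neg, ← sub_eq_add_neg] at hsub
    gcongr
    linarith
  measurable_sq := measurable_sqNorm
  sq_nonneg := sqNorm_nonneg
  sq_add := sqNorm_add_le
  integrable_sq := integrable_sqNorm_of_memLp memLp_id_stdNoise

/-! ### Second moments and Gaussian log-densities -/

section SecondMoments

variable {Ω A B : Type*} [MeasurableSpace Ω] [MeasurableSpace A] [MeasurableSpace B]
  {P : Measure Ω} {μ : Measure A} {ν : Measure B}

theorem integral_sqNorm_smul_add_smul {f g : A → Fin n → ℝ} (hf : MemLp f 2 μ) (hg : MemLp g 2 μ)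
    (a b : ℝ) :
    ∫ x, sqNorm (a • f x + b • g x) ∂μ
      = a ^ 2 * ∫ x, sqNorm (f x) ∂μ + b ^ 2 * ∫ x, sqNorm (g x) ∂μ
        + 2 * a * b * ∫ x, f x ⬝ᵥ g x ∂μ := by
  have hfg : Integrable (fun x => f x ⬝ᵥ g x) μ :=
    integrable_finsetSum _ fun k _ => (hf.eval k).integrable_mul (hg.eval k)
  have hf' := (integrable_sqNorm_of_memLp hf).const_mul (a ^ 2)
  have hg' := (integrable_sqNorm_of_memLp hg).const_mul (b ^ 2)
  simp only [sqNorm_smul_add_smul]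
  rw [integral_add (by exact hf'.add hg') (hfg.const_mul _), integral_add hf' hg',
    integral_const_mul, integral_const_mul, integral_const_mul]

variable [IsProbabilityMeasure μ] [IsProbabilityMeasure ν]

theorem integral_sqNorm_add_of_measurePreserving {X : Ω → A} {Z : Ω → B}
    (h : MeasurePreserving (fun ω => (X ω, Z ω)) P (μ.prod ν)) {f : A → Fin n → ℝ}
    {g : B → Fin n → ℝ} (hf : MemLp f 2 μ) (hg : MemLp g 2 ν) (hg₀ : ∫ b, g b ∂ν = 0) :
    ∫ ω, sqNorm (f (X ω) + g (Z ω)) ∂P = ∫ a, sqNorm (f a) ∂μ + ∫ b, sqNorm (g b) ∂ν := by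
  have hf' : MemLp (fun p : A × B => f p.1) 2 (μ.prod ν) :=
    hf.comp_measurePreserving measurePreserving_fst
  have hg' : MemLp (fun p : A × B => g p.2) 2 (μ.prod ν) :=
    hg.comp_measurePreserving measurePreserving_snd
  have hcross : ∫ p, f p.1 ⬝ᵥ g p.2 ∂(μ.prod ν) = 0 := by
    have hcoord (k : Fin n) : ∫ b, g b k ∂ν = 0 := by
      rw [← eval_integral fun i => (hg.eval i).integrable one_le_two, hg₀, Pi.zero_apply]
    simp only [dotProduct]
    rw [integral_finsetSum _ fun k _ => by exact (hf'.eval k).integrable_mul (hg'.eval k)]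
    refine Finset.sum_eq_zero fun k _ => ?_
    rw [integral_prod_mul (fun a => f a k) fun b => g b k, hcoord, mul_zero]
  have hsum := integral_sqNorm_smul_add_smul hf' hg' 1 1
  simp only [one_smul, hcross, integral_fun_fst (fun a => sqNorm (f a)),
    integral_fun_snd (fun b => sqNorm (g b)), probReal_univ] at hsum
  have hm : AEStronglyMeasurable (fun p : A × B => sqNorm (f p.1 + g p.2)) (μ.prod ν) :=
    (integrable_sqNorm_of_memLp (hf'.add hg')).aestronglyMeasurable
  rw [← h.map_eq] at hm hsum
  rw [integral_map h.aemeasurable hm] at hsum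
  linarith

end SecondMoments

section GaussianLog

variable {Ω A : Type*} [MeasurableSpace Ω] [MeasurableSpace A] {P : Measure Ω}
  [IsProbabilityMeasure P] {n : ℕ}

theorem logIntegrable_gaussPDF {m y : Ω → Fin n → ℝ} {v : ℝ≥0} (hv : v ≠ 0)
    (h : MemLp (fun ω => y ω - m ω) 2 P) :
    LogIntegrable (fun ω => gaussPDF (m ω) v (y ω)) P where
  ne_zero := Filter.Eventually.of_forall fun _ => gaussPDF_ne_zero _ hv _
  ne_top := Filter.Eventually.of_forall fun _ => gaussPDF_ne_top _ _ _
  integrable := by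
    simp only [log_gaussPDF _ hv]
    exact (integrable_const _).sub ((integrable_sqNorm_of_memLp h).div_const _)

theorem meanLog_gaussPDF {m y : Ω → Fin n → ℝ} {v : ℝ≥0} (hv : v ≠ 0)
    (h : MemLp (fun ω => y ω - m ω) 2 P) :
    meanLog P (fun ω => gaussPDF (m ω) v (y ω))
      = -(n / 2 * Real.log (2 * Real.pi * v)) - (∫ ω, sqNorm (y ω - m ω) ∂P) / (2 * v) := by
  simp only [meanLog, log_gaussPDF _ hv]
  rw [integral_sub (integrable_const _) ((integrable_sqNorm_of_memLp h).div_const _),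
    integral_div, integral_const, probReal_univ, one_smul]

theorem meanLog_stdNoise :
    meanLog (stdNoise n) (stdPDF n) = -(n / 2 * Real.log (2 * Real.pi)) - n / 2 := by
  have h := meanLog_gaussPDF (P := stdNoise n) (m := 0) (y := fun z => z) one_ne_zero
    (by simpa using memLp_id_stdNoise)
  simpa [integral_sqNorm_stdNoise] using h

/-- The density of a pair of blocks with means `m` in which the pairs of coordinates are
independent, and the sum and the difference of such a pair are uncorrelated with variances `2 * l₁`
and `2 * l₂`. It is written as the density of the first block times the conditional density of the
second one. -/
def pairGaussPDF (l₁ l₂ : ℝ≥0) (m y : (Fin n → ℝ) × (Fin n → ℝ)) : ℝ≥0∞ :=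
  gaussPDF m.1 ((l₁ + l₂) / 2) y.1 *
    gaussPDF (m.2 + (((l₁ : ℝ) - l₂) / (l₁ + l₂)) • (y.1 - m.1)) (2 * l₁ * l₂ / (l₁ + l₂)) y.2

theorem measurable_pairGaussPDF {m y : A → (Fin n → ℝ) × (Fin n → ℝ)} (hm : Measurable m)
    (hy : Measurable y) (l₁ l₂ : ℝ≥0) : Measurable fun a => pairGaussPDF l₁ l₂ (m a) (y a) :=
  (measurable_gaussPDF hm.fst hy.fst _).mul (measurable_gaussPDF (by fun_prop) hy.snd _)

theorem lintegral_pairGaussPDF {l₁ l₂ : ℝ≥0} (h₁ : l₁ ≠ 0) (h₂ : l₂ ≠ 0)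
    (m : (Fin n → ℝ) × (Fin n → ℝ)) : ∫⁻ y, pairGaussPDF l₁ l₂ m y = 1 := by
  have hm : Measurable fun y => pairGaussPDF l₁ l₂ m y :=
    measurable_pairGaussPDF measurable_const measurable_id l₁ l₂
  have hinner (x : Fin n → ℝ) :
      ∫⁻ y, pairGaussPDF l₁ l₂ m (x, y) = gaussPDF m.1 ((l₁ + l₂) / 2) x := by
    simp only [pairGaussPDF]
    rw [lintegral_const_mul _ (measurable_gaussPDF measurable_const measurable_id' _),
      lintegral_gaussPDF _ (by positivity), mul_one]
  rw [Measure.volume_eq_prod, lintegral_prod _ hm.aemeasurable]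
  simp only [hinner]
  exact lintegral_gaussPDF _ (by positivity)

/-- Completing the square: the exponent of `pairGaussPDF` is diagonal in the sum and the difference
of the two blocks. -/
theorem sqNorm_div_add_sqNorm_div {l₁ l₂ : ℝ} (h₁ : 0 < l₁) (h₂ : 0 < l₂) (u v : Fin n → ℝ) :
    sqNorm u / (2 * ((l₁ + l₂) / 2))
        + sqNorm (v - ((l₁ - l₂) / (l₁ + l₂)) • u) / (2 * (2 * l₁ * l₂ / (l₁ + l₂)))
      = sqNorm (u + v) / (4 * l₁) + sqNorm (u - v) / (4 * l₂) := by
  have hres : v - ((l₁ - l₂) / (l₁ + l₂)) • u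
      = (1 : ℝ) • v + (-((l₁ - l₂) / (l₁ + l₂))) • u := by module
  have hadd : u + v = (1 : ℝ) • u + (1 : ℝ) • v := by module
  have hsub : u - v = (1 : ℝ) • u + (-1 : ℝ) • v := by module
  rw [hres, hadd, hsub, sqNorm_smul_add_smul, sqNorm_smul_add_smul, sqNorm_smul_add_smul,
    dotProduct_comm v u]
  field_simp
  ring

theorem log_pairGaussPDF {l₁ l₂ : ℝ≥0} (h₁ : l₁ ≠ 0) (h₂ : l₂ ≠ 0)
    (m y : (Fin n → ℝ) × (Fin n → ℝ)) :
    Real.log (pairGaussPDF l₁ l₂ m y).toReal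
      = -(n * Real.log (2 * Real.pi) + n / 2 * Real.log (l₁ * l₂))
        - sqNorm ((y - m).1 + (y - m).2) / (4 * l₁)
        - sqNorm ((y - m).1 - (y - m).2) / (4 * l₂) := by
  have p₁ : (0 : ℝ) < l₁ := by positivity
  have p₂ : (0 : ℝ) < l₂ := by positivity
  have hvar : Real.log (2 * Real.pi * ((l₁ + l₂) / 2))
      + Real.log (2 * Real.pi * (2 * l₁ * l₂ / (l₁ + l₂)))
        = 2 * Real.log (2 * Real.pi) + Real.log (l₁ * l₂) := by
    rw [← Real.log_mul (by positivity) (by positivity), two_mul (Real.log _),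
      ← Real.log_mul (by positivity) (by positivity),
      ← Real.log_mul (by positivity) (by positivity)]
    congr 1
    field_simp
  have hexp := sqNorm_div_add_sqNorm_div p₁ p₂ (y - m).1 (y - m).2
  rw [pairGaussPDF, ENNReal.toReal_mul,
    Real.log_mul
      (ENNReal.toReal_pos (gaussPDF_ne_zero _ (by positivity) _) (gaussPDF_ne_top _ _ _)).ne'
      (ENNReal.toReal_pos (gaussPDF_ne_zero _ (by positivity) _) (gaussPDF_ne_top _ _ _)).ne',
    log_gaussPDF _ (by positivity), log_gaussPDF _ (by positivity), ← sub_sub y.2]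
  simp only [Prod.fst_sub, Prod.snd_sub] at hexp ⊢
  push_cast
  linear_combination (-(n : ℝ) / 2) * hvar - hexp

theorem logIntegrable_pairGaussPDF {m y : Ω → (Fin n → ℝ) × (Fin n → ℝ)} {l₁ l₂ : ℝ≥0}
    (h₁ : l₁ ≠ 0) (h₂ : l₂ ≠ 0) (hadd : MemLp (fun ω => (y ω - m ω).1 + (y ω - m ω).2) 2 P)
    (hsub : MemLp (fun ω => (y ω - m ω).1 - (y ω - m ω).2) 2 P) :
    LogIntegrable (fun ω => pairGaussPDF l₁ l₂ (m ω) (y ω)) P where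
  ne_zero := Filter.Eventually.of_forall fun _ =>
    mul_ne_zero (gaussPDF_ne_zero _ (by positivity) _) (gaussPDF_ne_zero _ (by positivity) _)
  ne_top := Filter.Eventually.of_forall fun _ =>
    ENNReal.mul_ne_top (gaussPDF_ne_top _ _ _) (gaussPDF_ne_top _ _ _)
  integrable := by
    simp only [log_pairGaussPDF h₁ h₂]
    exact ((integrable_const _).sub ((integrable_sqNorm_of_memLp hadd).div_const _)).sub
      ((integrable_sqNorm_of_memLp hsub).div_const _)

theorem meanLog_pairGaussPDF {m y : Ω → (Fin n → ℝ) × (Fin n → ℝ)} {l₁ l₂ : ℝ≥0}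
    (h₁ : l₁ ≠ 0) (h₂ : l₂ ≠ 0) (hadd : MemLp (fun ω => (y ω - m ω).1 + (y ω - m ω).2) 2 P)
    (hsub : MemLp (fun ω => (y ω - m ω).1 - (y ω - m ω).2) 2 P) :
    meanLog P (fun ω => pairGaussPDF l₁ l₂ (m ω) (y ω))
      = -(n * Real.log (2 * Real.pi) + n / 2 * Real.log (l₁ * l₂))
        - (∫ ω, sqNorm ((y ω - m ω).1 + (y ω - m ω).2) ∂P) / (4 * l₁)
        - (∫ ω, sqNorm ((y ω - m ω).1 - (y ω - m ω).2) ∂P) / (4 * l₂) := by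
  have hadd' := (integrable_sqNorm_of_memLp hadd).div_const (4 * l₁)
  have hsub' := (integrable_sqNorm_of_memLp hsub).div_const (4 * l₂)
  simp only [meanLog, log_pairGaussPDF h₁ h₂]
  rw [integral_sub (by exact (integrable_const _).sub hadd') hsub',
    integral_sub (integrable_const _) hadd',
    integral_div, integral_div, integral_const, probReal_univ, one_smul]

end GaussianLog

/-! ### Gaussian log-likelihoods at the channel outputs -/

section GaussianOutputs

variable {Ω A : Type*} [MeasurableSpace Ω] [MeasurableSpace A] {n : ℕ}

theorem integral_sqNorm_smul {μ : Measure A} {f : A → Fin n → ℝ} (hf : MemLp f 2 μ) (u : ℝ) :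
    ∫ a, sqNorm (u • f a) ∂μ = u ^ 2 * ∫ a, sqNorm (f a) ∂μ := by
  simpa using integral_sqNorm_smul_add_smul hf hf u 0

theorem memLp_smul_add_smul_stdNoise (u v : ℝ) :
    MemLp (fun z : (Fin n → ℝ) × (Fin n → ℝ) => u • z.1 + v • z.2) 2
      ((stdNoise n).prod (stdNoise n)) :=
  ((memLp_id_stdNoise.comp_measurePreserving measurePreserving_fst).const_smul u).add
    ((memLp_id_stdNoise.comp_measurePreserving measurePreserving_snd).const_smul v)

theorem integral_smul_add_smul_stdNoise (u v : ℝ) :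
    ∫ z : (Fin n → ℝ) × (Fin n → ℝ), (u • z.1 + v • z.2) ∂((stdNoise n).prod (stdNoise n)) = 0 := by
  have hint (w : ℝ) : Integrable (fun z : Fin n → ℝ => w • z) (stdNoise n) :=
    (memLp_id_stdNoise.integrable one_le_two).smul w
  rw [integral_add ((hint u).comp_fst _) ((hint v).comp_snd _),
    integral_fun_fst (fun z : Fin n → ℝ => u • z), integral_fun_snd (fun z : Fin n → ℝ => v • z),
    integral_smul, integral_smul, integral_id_stdNoise]
  simp

theorem integral_sqNorm_smul_add_smul_stdNoise (u v : ℝ) :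
    ∫ z : (Fin n → ℝ) × (Fin n → ℝ), sqNorm (u • z.1 + v • z.2) ∂((stdNoise n).prod (stdNoise n))
      = (u ^ 2 + v ^ 2) * n := by
  rw [integral_sqNorm_add_of_measurePreserving (X := Prod.fst) (Z := Prod.snd)
      (f := fun z => u • z) (g := fun z => v • z) (MeasurePreserving.id _)
      (memLp_id_stdNoise.const_smul u) (memLp_id_stdNoise.const_smul v)
      (by rw [integral_smul, integral_id_stdNoise, smul_zero]),
    integral_sqNorm_smul memLp_id_stdNoise, integral_sqNorm_smul memLp_id_stdNoise,
    integral_sqNorm_stdNoise, add_mul]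

theorem meanLog_pairPDF_stdPDF : meanLog ((stdNoise n).prod (stdNoise n)) (pairPDF (stdPDF n))
    = -(n * Real.log (2 * Real.pi)) - n := by
  have hfst : MeasurePreserving Prod.fst ((stdNoise n).prod (stdNoise n)) (stdNoise n) :=
    measurePreserving_fst
  have hsnd : MeasurePreserving Prod.snd ((stdNoise n).prod (stdNoise n)) (stdNoise n) :=
    measurePreserving_snd
  have hlog : LogIntegrable (stdPDF n) (stdNoise n) :=
    isNoise_stdNoise.logIntegrable_noise (MeasurePreserving.id _)
  have hmul := meanLog_mul (hlog.comp_measurePreserving hfst) (hlog.comp_measurePreserving hsnd)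
  rw [meanLog_comp_measurePreserving hlog hfst, meanLog_comp_measurePreserving hlog hsnd,
    meanLog_stdNoise] at hmul
  exact hmul.trans (by ring)

variable {P : Measure Ω} {μ : Measure A} [IsProbabilityMeasure μ]
  {X : Ω → A} {Z : Ω → (Fin n → ℝ) × (Fin n → ℝ)}

theorem memLp_add_noise (h : MeasurePreserving (fun ω => (X ω, Z ω)) P
      (μ.prod ((stdNoise n).prod (stdNoise n)))) {f : A → Fin n → ℝ} (hf : MemLp f 2 μ)
    (u v : ℝ) : MemLp (fun ω => f (X ω) + (u • (Z ω).1 + v • (Z ω).2)) 2 P :=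
  (hf.comp_measurePreserving (measurePreserving_fst.comp h)).add
    ((memLp_smul_add_smul_stdNoise u v).comp_measurePreserving (measurePreserving_snd.comp h))

theorem memLp_output (h : MeasurePreserving (fun ω => (X ω, Z ω)) P
      (μ.prod ((stdNoise n).prod (stdNoise n)))) {f : A → Fin n → ℝ} (hf : MemLp f 2 μ) :
    MemLp (fun ω => f (X ω) + (Z ω).1) 2 P := by
  simpa using memLp_add_noise h hf 1 0

variable [IsProbabilityMeasure P]

theorem memLp_add_noise_add_noise (h : MeasurePreserving (fun ω => (X ω, Z ω)) P
      (μ.prod ((stdNoise n).prod (stdNoise n)))) {f : A → Fin n → ℝ} (hf : MemLp f 2 μ)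
    (u v u' v' : ℝ) :
    MemLp (fun x : Ω × (Fin n → ℝ) × (Fin n → ℝ) =>
        f (X x.1) + (u • (Z x.1).1 + v • (Z x.1).2) + (u' • x.2.1 + v' • x.2.2)) 2
      (P.prod ((stdNoise n).prod (stdNoise n))) :=
  memLp_add_noise (X := Prod.fst) (Z := Prod.snd) (MeasurePreserving.id _)
    (memLp_add_noise h hf u v) u' v'

theorem integral_sqNorm_add_noise_add_noise (h : MeasurePreserving (fun ω => (X ω, Z ω)) P
      (μ.prod ((stdNoise n).prod (stdNoise n)))) {f : A → Fin n → ℝ} (hf : MemLp f 2 μ)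
    (u v u' v' : ℝ) :
    ∫ x : Ω × (Fin n → ℝ) × (Fin n → ℝ),
        sqNorm (f (X x.1) + (u • (Z x.1).1 + v • (Z x.1).2) + (u' • x.2.1 + v' • x.2.2))
        ∂(P.prod ((stdNoise n).prod (stdNoise n)))
      = ∫ a, sqNorm (f a) ∂μ + (u ^ 2 + v ^ 2 + (u' ^ 2 + v' ^ 2)) * n := by
  rw [integral_sqNorm_add_of_measurePreserving (A := Ω) (B := (Fin n → ℝ) × (Fin n → ℝ))
      (X := Prod.fst) (Z := Prod.snd) (f := fun ω => f (X ω) + (u • (Z ω).1 + v • (Z ω).2))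
      (g := fun z => u' • z.1 + v' • z.2)
      (MeasurePreserving.id _) (memLp_add_noise h hf u v) (memLp_smul_add_smul_stdNoise u' v')
      (integral_smul_add_smul_stdNoise u' v'),
    integral_sqNorm_add_of_measurePreserving (g := fun z => u • z.1 + v • z.2) h hf
      (memLp_smul_add_smul_stdNoise u v) (integral_smul_add_smul_stdNoise u v),
    integral_sqNorm_smul_add_smul_stdNoise, integral_sqNorm_smul_add_smul_stdNoise]
  ring

theorem le_meanLog_gaussPDF_output (h : MeasurePreserving (fun ω => (X ω, Z ω)) P
      (μ.prod ((stdNoise n).prod (stdNoise n)))) {f : A → Fin n → ℝ} (hf : MemLp f 2 μ)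
    {v : ℝ≥0} (hv : v ≠ 0) (hpow : ∫ a, sqNorm (f a) ∂μ ≤ n * (v - 1)) :
    -(n / 2 * Real.log (2 * Real.pi * v)) - n / 2
      ≤ meanLog P (fun ω => gaussPDF 0 v (f (X ω) + (Z ω).1)) := by
  have hfst : MeasurePreserving (fun ω => (X ω, (Z ω).1)) P (μ.prod (stdNoise n)) :=
    ((MeasurePreserving.id μ).prod measurePreserving_fst).comp h
  have hout := meanLog_gaussPDF (m := fun _ => 0) (y := fun ω => f (X ω) + (Z ω).1) hv
    (by simpa using memLp_output h hf)
  simp only [sub_zero] at hout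
  rw [hout, integral_sqNorm_add_of_measurePreserving (g := fun z => z) hfst hf memLp_id_stdNoise
    integral_id_stdNoise, integral_sqNorm_stdNoise]
  have hdiv : (∫ a, sqNorm (f a) ∂μ + n) / (2 * v) ≤ n / 2 := by
    rw [div_le_div_iff₀ (by positivity) two_pos]
    linarith
  linarith

end GaussianOutputs

/-! ### Linear estimation of the outputs from the noisy interference -/

/-- The error variance of the optimal linear estimate of `h x + z` from `b x + z'`, where
`h ^ 2 = H` and `b ^ 2 = B`, the variance of `x` is `Q`, and `z`, `z'` are independent of unit
variance. -/
def condVar (H B Q : ℝ) : ℝ := 1 + H * Q / (1 + B * Q)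

theorem condVar_eq {H B Q : ℝ} (h : 1 + B * Q ≠ 0) :
    condVar H B Q = 1 + H * Q - H * B * Q ^ 2 / (1 + B * Q) := by
  rw [condVar, add_sub_assoc, add_right_inj, eq_sub_iff_add_eq, ← add_div, div_eq_iff h]
  ring

theorem one_le_condVar {H B Q : ℝ} (hH : 0 ≤ H) (hB : 0 ≤ B) (hQ : 0 ≤ Q) : 1 ≤ condVar H B Q :=
  le_add_of_nonneg_right (by positivity)

/-- The coefficient of the optimal linear estimate of `h x + z` from `b x + z'`, where the variance
of `x` is `Q`, and `z`, `z'` are independent of unit variance. -/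
def optGain (h b Q : ℝ) : ℝ := h * b * Q / (1 + b ^ 2 * Q)

theorem optGain_error_eq {h b Q : ℝ} (hQ : 0 ≤ Q) :
    (h - optGain h b Q * b) ^ 2 * Q + (1 + optGain h b Q ^ 2) = condVar (h ^ 2) (b ^ 2) Q := by
  have hpos : 1 + b ^ 2 * Q ≠ 0 := by positivity
  unfold condVar optGain
  field_simp [hpos]
  ring

theorem optGain_error_le {h b Q S n : ℝ} (hQ : 0 ≤ Q) (hS : S ≤ 2 * n * Q) :
    (h - optGain h b Q * b) ^ 2 * S + (2 + 2 * optGain h b Q ^ 2) * n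
      ≤ 2 * n * condVar (h ^ 2) (b ^ 2) Q := by
  have hmul := mul_le_mul_of_nonneg_left hS (sq_nonneg (h - optGain h b Q * b))
  linear_combination hmul + 2 * n * optGain_error_eq hQ (h := h) (b := b)

section Estimate

variable {Ω A : Type*} [MeasurableSpace Ω] [MeasurableSpace A] {n : ℕ}

/-- The linear estimate of a pair of outputs from a pair of interference blocks that has gain `b₁`
on the sum of the two blocks and gain `-b₂` on their difference; the sign appears because the
interference at one receiver comes from the input meant for the other one. -/
def estimate (b₁ b₂ : ℝ) (s : (Fin n → ℝ) × (Fin n → ℝ)) : (Fin n → ℝ) × (Fin n → ℝ) :=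
  (((b₁ - b₂) / 2) • s.1 + ((b₁ + b₂) / 2) • s.2, ((b₁ + b₂) / 2) • s.1 + ((b₁ - b₂) / 2) • s.2)

theorem measurable_estimate (b₁ b₂ : ℝ) :
    Measurable (estimate b₁ b₂ : (Fin n → ℝ) × (Fin n → ℝ) → _) := by
  unfold estimate
  fun_prop

/-- The output means `(h_d x₁ + h_c x₂, h_d x₂ + h_c x₁)` of the input blocks `x₁`, `x₂`. -/
def outputMean (hd hc : ℝ) (x₁ x₂ : Fin n → ℝ) : (Fin n → ℝ) × (Fin n → ℝ) :=
  (hd • x₁ + hc • x₂, hd • x₂ + hc • x₁)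

theorem estimate_error_add (hd hc b₁ b₂ : ℝ) (x₁ x₂ : Fin n → ℝ)
    (z z' : (Fin n → ℝ) × (Fin n → ℝ)) :
    (outputMean hd hc x₁ x₂ + z - estimate b₁ b₂ (hc • (x₂, x₁) + z')).1
        + (outputMean hd hc x₁ x₂ + z - estimate b₁ b₂ (hc • (x₂, x₁) + z')).2
      = (hd + hc - b₁ * hc) • (x₁ + x₂) + ((1 : ℝ) • z.1 + (1 : ℝ) • z.2)
        + ((-b₁) • z'.1 + (-b₁) • z'.2) := by
  simp only [outputMean, estimate, Prod.fst_sub, Prod.fst_add, Prod.snd_sub, Prod.snd_add,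
    Prod.smul_fst, Prod.smul_snd]
  module

theorem estimate_error_sub (hd hc b₁ b₂ : ℝ) (x₁ x₂ : Fin n → ℝ)
    (z z' : (Fin n → ℝ) × (Fin n → ℝ)) :
    (outputMean hd hc x₁ x₂ + z - estimate b₁ b₂ (hc • (x₂, x₁) + z')).1
        - (outputMean hd hc x₁ x₂ + z - estimate b₁ b₂ (hc • (x₂, x₁) + z')).2
      = (hd - hc - b₂ * hc) • (x₁ - x₂) + ((1 : ℝ) • z.1 + (-1 : ℝ) • z.2)
        + (b₂ • z'.1 + (-b₂) • z'.2) := by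
  simp only [outputMean, estimate, Prod.fst_sub, Prod.fst_add, Prod.snd_sub, Prod.snd_add,
    Prod.smul_fst, Prod.smul_snd]
  module

variable {P : Measure Ω} {μ : Measure A} [IsProbabilityMeasure P] [IsProbabilityMeasure μ]
  {X : Ω → A} {Z : Ω → (Fin n → ℝ) × (Fin n → ℝ)} {x₁ x₂ : A → Fin n → ℝ} {l₁ l₂ : ℝ≥0}

theorem logIntegrable_pairGaussPDF_estimate (h : MeasurePreserving (fun ω => (X ω, Z ω)) P
      (μ.prod ((stdNoise n).prod (stdNoise n)))) (hx₁ : MemLp x₁ 2 μ) (hx₂ : MemLp x₂ 2 μ)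
    (h₁ : l₁ ≠ 0) (h₂ : l₂ ≠ 0) (hd hc b₁ b₂ : ℝ) :
    LogIntegrable (fun ω : Ω × (Fin n → ℝ) × (Fin n → ℝ) =>
        pairGaussPDF l₁ l₂ (estimate b₁ b₂ (hc • (x₂ (X ω.1), x₁ (X ω.1)) + ω.2))
          (outputMean hd hc (x₁ (X ω.1)) (x₂ (X ω.1)) + Z ω.1))
      (P.prod ((stdNoise n).prod (stdNoise n))) := by
  refine logIntegrable_pairGaussPDF h₁ h₂ ?_ ?_
  · simp only [estimate_error_add]
    exact memLp_add_noise_add_noise h ((hx₁.add hx₂).const_smul (hd + hc - b₁ * hc)) _ _ _ _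
  · simp only [estimate_error_sub]
    exact memLp_add_noise_add_noise h ((hx₁.sub hx₂).const_smul (hd - hc - b₂ * hc)) _ _ _ _

theorem le_meanLog_pairGaussPDF_estimate (h : MeasurePreserving (fun ω => (X ω, Z ω)) P
      (μ.prod ((stdNoise n).prod (stdNoise n)))) (hx₁ : MemLp x₁ 2 μ) (hx₂ : MemLp x₂ 2 μ)
    {hd hc Q₁ Q₂ : ℝ} (hQ₁ : 0 ≤ Q₁) (hQ₂ : 0 ≤ Q₂)
    (hadd : ∫ a, sqNorm (x₁ a + x₂ a) ∂μ ≤ 2 * n * Q₁)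
    (hsub : ∫ a, sqNorm (x₁ a - x₂ a) ∂μ ≤ 2 * n * Q₂)
    (hl₁ : l₁ = condVar ((hd + hc) ^ 2) (hc ^ 2) Q₁)
    (hl₂ : l₂ = condVar ((hd - hc) ^ 2) (hc ^ 2) Q₂) :
    -(n * Real.log (2 * Real.pi) + n / 2 * Real.log (l₁ * l₂)) - n
      ≤ meanLog (P.prod ((stdNoise n).prod (stdNoise n)))
        (fun ω : Ω × (Fin n → ℝ) × (Fin n → ℝ) =>
          pairGaussPDF l₁ l₂ (estimate (optGain (hd + hc) hc Q₁) (optGain (hd - hc) hc Q₂)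
              (hc • (x₂ (X ω.1), x₁ (X ω.1)) + ω.2))
            (outputMean hd hc (x₁ (X ω.1)) (x₂ (X ω.1)) + Z ω.1)) := by
  have p₁ : (0 : ℝ) < l₁ :=
    zero_lt_one.trans_le (hl₁ ▸ one_le_condVar (sq_nonneg _) (sq_nonneg _) hQ₁)
  have p₂ : (0 : ℝ) < l₂ :=
    zero_lt_one.trans_le (hl₂ ▸ one_le_condVar (sq_nonneg _) (sq_nonneg _) hQ₂)
  set b₁ := optGain (hd + hc) hc Q₁
  set b₂ := optGain (hd - hc) hc Q₂
  have madd : MemLp (fun a => (hd + hc - b₁ * hc) • (x₁ a + x₂ a)) 2 μ :=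
    (hx₁.add hx₂).const_smul (hd + hc - b₁ * hc)
  have msub : MemLp (fun a => (hd - hc - b₂ * hc) • (x₁ a - x₂ a)) 2 μ :=
    (hx₁.sub hx₂).const_smul (hd - hc - b₂ * hc)
  rw [meanLog_pairGaussPDF (by exact_mod_cast p₁.ne') (by exact_mod_cast p₂.ne')
    (by simp only [estimate_error_add]; exact memLp_add_noise_add_noise h madd _ _ _ _)
    (by simp only [estimate_error_sub]; exact memLp_add_noise_add_noise h msub _ _ _ _)]
  simp only [estimate_error_add, estimate_error_sub]
  rw [integral_sqNorm_add_noise_add_noise h madd, integral_sqNorm_add_noise_add_noise h msub,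
    integral_sqNorm_smul (f := fun a => x₁ a + x₂ a) (hx₁.add hx₂),
    integral_sqNorm_smul (f := fun a => x₁ a - x₂ a) (hx₁.sub hx₂)]
  have hdiv {S T l : ℝ} (hl : 0 < l) (h : S + T ≤ 2 * n * l) : (S + T) / (4 * l) ≤ n / 2 := by
    rw [div_le_div_iff₀ (by positivity) two_pos]
    linarith
  have e₁ := hdiv p₁ (hl₁ ▸ optGain_error_le (b := hc) (h := hd + hc) hQ₁ hadd)
  have e₂ := hdiv p₂ (hl₂ ▸ optGain_error_le (b := hc) (h := hd - hc) hQ₂ hsub)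
  ring_nf at e₁ e₂ ⊢
  linarith

end Estimate

/-! ### Decoders as tests -/

section DecodeTest

variable {κ E : Type*} [Fintype κ] [DecidableEq κ]

/-- The test that bets half of its mass on the decision of the decoder `dec`, and spreads the rest
evenly over all messages so that its logarithm is never `-∞`. -/
def decodeTest (dec : E → κ) (w : κ) (y : E) : ℝ≥0∞ :=
  ((if dec y = w then (Fintype.card κ : ℝ≥0∞) else 0) + 1) / 2

theorem sum_decodeTest (dec : E → κ) (y : E) : ∑ w, decodeTest dec w y = Fintype.card κ := by
  simp only [decodeTest, div_eq_mul_inv, ← Finset.sum_mul, Finset.sum_add_distrib,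
    Finset.sum_ite_eq, Finset.mem_univ, if_true, Finset.sum_const, Finset.card_univ, nsmul_eq_mul,
    mul_one]
  rw [← two_mul, mul_right_comm, ENNReal.mul_inv_cancel two_ne_zero ENNReal.ofNat_ne_top, one_mul]

theorem log_decodeTest (dec : E → κ) (w : κ) (y : E) : Real.log (decodeTest dec w y).toReal =
    if dec y = w then Real.log ((Fintype.card κ + 1) / 2) else Real.log (1 / 2) := by
  unfold decodeTest
  split_ifs with h
  · rw [ENNReal.toReal_div, ENNReal.toReal_add (ENNReal.natCast_ne_top _) ENNReal.one_ne_top]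
    simp
  · simp

theorem le_log_decodeTest (dec : E → κ) (w : κ) (y : E) :
    Real.log (Fintype.card κ) - Real.log 2 - (if dec y ≠ w then Real.log (Fintype.card κ) else 0)
      ≤ Real.log (decodeTest dec w y).toReal := by
  have hcard : (0 : ℝ) < Fintype.card κ := by exact_mod_cast Fintype.card_pos_iff.2 ⟨w⟩
  rw [log_decodeTest, ite_not]
  split_ifs with h
  · rw [sub_zero, ← Real.log_div hcard.ne' two_ne_zero]
    exact Real.log_le_log (by positivity) (by linarith)
  · rw [one_div, Real.log_inv]
    linarith

variable [MeasurableSpace κ] [MeasurableSingletonClass κ] [MeasurableSpace E] {dec : E → κ}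

theorem measurable_decodeTest (hdec : Measurable dec) (w : κ) : Measurable (decodeTest dec w) :=
  ((Measurable.ite (hdec (measurableSet_singleton w)) measurable_const measurable_const).add
    measurable_const).div measurable_const

theorem isTest_decodeTest {A : Type*} [MeasurableSpace A] {W : A → κ} {μ : Measure A}
    (hdec : Measurable dec) (hW : MeasurePreserving W μ (uniformOn Set.univ)) :
    IsTest (decodeTest dec) W μ where
  measurable := measurable_decodeTest hdec
  lintegral_le_one y := by
    rw [hW.lintegral_comp (f := fun w => decodeTest dec w y) (measurable_of_countable _)]
    simp only [lintegral_fintype, uniformOn_univ, Measure.count_singleton, one_div]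
    rw [← Finset.sum_mul, sum_decodeTest]
    exact ENNReal.mul_inv_le_one _

variable {Ω : Type*} [MeasurableSpace Ω] {P : Measure Ω} [IsProbabilityMeasure P] {W : Ω → κ}
  {Y : Ω → E}

theorem logIntegrable_decodeTest (hdec : Measurable dec) (hW : Measurable W) (hY : Measurable Y) :
    LogIntegrable (fun ω => decodeTest dec (W ω) (Y ω)) P where
  ne_zero := Filter.Eventually.of_forall fun ω =>
    (ENNReal.div_pos (by simp) ENNReal.ofNat_ne_top).ne'
  ne_top := Filter.Eventually.of_forall fun ω =>
    ENNReal.div_ne_top (by split_ifs <;> simp) two_ne_zero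
  integrable := by
    simp only [log_decodeTest]
    exact Integrable.piecewise (s := {ω | dec (Y ω) = W ω})
      (measurableSet_eq_fun (hdec.comp hY) hW)
      (integrable_const _).integrableOn (integrable_const _).integrableOn

theorem le_meanLog_decodeTest (hdec : Measurable dec) (hW : Measurable W) (hY : Measurable Y)
    {ε : ℝ} (hε : 0 ≤ ε) (herr : P {ω | dec (Y ω) ≠ W ω} ≤ ENNReal.ofReal ε) :
    (1 - ε) * Real.log (Fintype.card κ) - Real.log 2
      ≤ meanLog P (fun ω => decodeTest dec (W ω) (Y ω)) := by
  set S : Set Ω := {ω | dec (Y ω) ≠ W ω}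
  have hS : MeasurableSet S := (measurableSet_eq_fun (hdec.comp hY) hW).compl
  have hint : Integrable (S.indicator fun _ => Real.log (Fintype.card κ)) P :=
    (integrable_const _).indicator hS
  have hmono : ∫ ω, (Real.log (Fintype.card κ) - Real.log 2
      - S.indicator (fun _ => Real.log (Fintype.card κ)) ω) ∂P
      ≤ meanLog P (fun ω => decodeTest dec (W ω) (Y ω)) :=
    integral_mono ((integrable_const _).sub hint) (logIntegrable_decodeTest hdec hW hY).integrable
      fun ω => by
        simp only [Set.indicator_apply]
        exact le_log_decodeTest dec (W ω) (Y ω)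
  rw [integral_sub (integrable_const _) hint, integral_indicator_const _ hS, integral_const,
    probReal_univ, one_smul, smul_eq_mul] at hmono
  have hmul := mul_le_mul_of_nonneg_right (ENNReal.toReal_le_of_le_ofReal hε herr)
    (Real.log_natCast_nonneg (Fintype.card κ))
  rw [← measureReal_def] at hmul
  linarith

end DecodeTest

/-! ### Gaussian channels with conferencing transmitters -/

section Correlation

variable {A : Type*} [MeasurableSpace A] {n : ℕ} {μ : Measure A} {x₁ x₂ : A → Fin n → ℝ}

theorem exists_correlation (hx₁ : MemLp x₁ 2 μ) (hx₂ : MemLp x₂ 2 μ) {T : ℝ}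
    (h₁ : ∫ a, sqNorm (x₁ a) ∂μ ≤ T) (h₂ : ∫ a, sqNorm (x₂ a) ∂μ ≤ T) :
    ∃ ρ ∈ Set.Icc (-1 : ℝ) 1, ∫ a, x₁ a ⬝ᵥ x₂ a ∂μ = ρ * T := by
  have hT : 0 ≤ T := (integral_nonneg fun a => sqNorm_nonneg (x₁ a)).trans h₁
  have hquad (s : ℝ) :
      0 ≤ ∫ a, sqNorm (x₁ a) ∂μ + s ^ 2 * ∫ a, sqNorm (x₂ a) ∂μ + 2 * s * ∫ a, x₁ a ⬝ᵥ x₂ a ∂μ := by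
    have hnonneg : 0 ≤ ∫ a, sqNorm ((1 : ℝ) • x₁ a + s • x₂ a) ∂μ :=
      integral_nonneg fun a => sqNorm_nonneg _
    rw [integral_sqNorm_smul_add_smul hx₁ hx₂] at hnonneg
    linarith
  have hadd := hquad 1
  have hsub := hquad (-1)
  rcases hT.eq_or_lt with hT | hT
  · exact ⟨0, by simp, by linarith⟩
  · refine ⟨(∫ a, x₁ a ⬝ᵥ x₂ a ∂μ) / T, ⟨?_, ?_⟩, (div_mul_cancel₀ _ hT.ne').symm⟩
    · rw [le_div_iff₀ hT]
      linarith
    · rw [div_le_iff₀ hT]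
      linarith

theorem integral_sqNorm_smul_add_smul_le (hx₁ : MemLp x₁ 2 μ) (hx₂ : MemLp x₂ 2 μ) {T ρ : ℝ}
    (h₁ : ∫ a, sqNorm (x₁ a) ∂μ ≤ T) (h₂ : ∫ a, sqNorm (x₂ a) ∂μ ≤ T)
    (hρ : ∫ a, x₁ a ⬝ᵥ x₂ a ∂μ = ρ * T) (u v : ℝ) :
    ∫ a, sqNorm (u • x₁ a + v • x₂ a) ∂μ ≤ (u ^ 2 + v ^ 2 + 2 * ρ * (u * v)) * T := by
  rw [integral_sqNorm_smul_add_smul hx₁ hx₂, hρ]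
  linarith [mul_le_mul_of_nonneg_left h₁ (sq_nonneg u), mul_le_mul_of_nonneg_left h₂ (sq_nonneg v)]

end Correlation

theorem sq_add_sq_add_mul_nonneg {ρ : ℝ} (hρ : ρ ∈ Set.Icc (-1) 1) (u v : ℝ) :
    0 ≤ u ^ 2 + v ^ 2 + 2 * ρ * (u * v) := by
  nlinarith [mul_nonneg (neg_le_iff_add_nonneg.1 hρ.1) (sq_nonneg (u + v)),
    mul_nonneg (sub_nonneg.2 hρ.2) (sq_nonneg (u - v))]

theorem exists_nnreal_eq_of_one_le {x : ℝ} (hx : 1 ≤ x) : ∃ v : ℝ≥0, v ≠ 0 ∧ (v : ℝ) = x :=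
  ⟨⟨x, zero_le_one.trans hx⟩, fun h => (zero_lt_one.trans_le hx).ne' (congrArg NNReal.toReal h),
    rfl⟩

namespace ConferencingChannel

/-- The transmitters send the input blocks `x₁`, `x₂`, which are received with the direct gain `hd`
and the cross gain `hc`. -/
structure HasInputs {A₁ A₂ ι : Type*} [MeasurableSpace A₁] [MeasurableSpace A₂] {n : ℕ}
    (c : ConferencingChannel A₁ A₂ ι (Fin n → ℝ)) (hd hc : ℝ) (x₁ x₂ : A₁ × A₂ → Fin n → ℝ) :
    Prop where
  output₁_eq : ∀ a, c.output₁ a = hd • x₁ a + hc • x₂ a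
  output₂_eq : ∀ a, c.output₂ a = hd • x₂ a + hc • x₁ a
  interference_eq : ∀ a, c.interference a = hc • (x₂ a, x₁ a)

variable {Ω A₁ A₂ ι : Type*} [MeasurableSpace Ω] [MeasurableSpace A₁] [MeasurableSpace A₂] {n : ℕ}
  {c : ConferencingChannel A₁ A₂ ι (Fin n → ℝ)} {hd hc : ℝ} {x₁ x₂ : A₁ × A₂ → Fin n → ℝ}
  {m₁ : Measure A₁} {m₂ : Measure A₂}

theorem HasInputs.outputs_eq (hx : c.HasInputs hd hc x₁ x₂) (a : A₁ × A₂) :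
    c.outputs a = outputMean hd hc (x₁ a) (x₂ a) :=
  Prod.ext (hx.output₁_eq a) (hx.output₂_eq a)

theorem HasInputs.finitePower (hx : c.HasInputs hd hc x₁ x₂) (hx₁ : MemLp x₁ 2 (m₁.prod m₂))
    (hx₂ : MemLp x₂ 2 (m₁.prod m₂)) : c.FinitePower sqNorm m₁ m₂ where
  output₁ := by
    simp only [hx.output₁_eq]
    exact integrable_sqNorm_of_memLp ((hx₁.const_smul hd).add (hx₂.const_smul hc))
  output₂ := by
    simp only [hx.output₂_eq]
    exact integrable_sqNorm_of_memLp ((hx₂.const_smul hd).add (hx₁.const_smul hc))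
  interference₁ := by
    simp only [hx.interference_eq]
    exact integrable_sqNorm_of_memLp (hx₂.const_smul hc)
  interference₂ := by
    simp only [hx.interference_eq]
    exact integrable_sqNorm_of_memLp (hx₁.const_smul hc)

variable {κ₁ κ₂ : Type*} [Fintype ι] [MeasurableSpace ι] [MeasurableSingletonClass ι]
  [MeasurableSpace κ₁] [Finite κ₁] [MeasurableSingletonClass κ₁] [MeasurableSpace κ₂]
  [Countable κ₂] [MeasurableSingletonClass κ₂] {P : Measure Ω} [IsProbabilityMeasure P]
  [IsProbabilityMeasure m₁] [IsProbabilityMeasure m₂] {X : Ω → A₁ × A₂}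
  {Z : Ω → (Fin n → ℝ) × (Fin n → ℝ)}

theorem HasInputs.two_mul_meanLog_add_meanLog_le (hx : c.HasInputs hd hc x₁ x₂)
    (hx₁ : MemLp x₁ 2 (m₁.prod m₂)) (hx₂ : MemLp x₂ 2 (m₁.prod m₂))
    (h : MeasurePreserving (fun ω => (X ω, Z ω)) P
      ((m₁.prod m₂).prod ((stdNoise n).prod (stdNoise n))))
    {W₁ : A₁ → κ₁} (hW₁ : Measurable W₁) {t₁ : κ₁ → (Fin n → ℝ) → ℝ≥0∞} (ht₁ : IsTest t₁ W₁ m₁)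
    (ht₁log : LogIntegrable (fun ω => t₁ (W₁ (X ω).1) (c.output₁ (X ω) + (Z ω).1)) P)
    {W₂ : A₂ → κ₂} (hW₂ : Measurable W₂) {t₂ : κ₂ → (Fin n → ℝ) → ℝ≥0∞} (ht₂ : IsTest t₂ W₂ m₂)
    (ht₂log : LogIntegrable (fun ω => t₂ (W₂ (X ω).2) (c.output₂ (X ω) + (Z ω).2)) P)
    {r : ℝ} (hr : 0 ≤ r)
    (hI : mutualInfo P (fun ω => W₁ (X ω).1) (fun ω => c.output₂ (X ω) + (Z ω).2) ≤
      ENNReal.ofReal r)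
    {Q ρ : ℝ} (hQ : 0 ≤ Q) (hρ : ρ ∈ Set.Icc (-1) 1)
    (h₁ : ∫ a, sqNorm (x₁ a) ∂(m₁.prod m₂) ≤ n * Q) (h₂ : ∫ a, sqNorm (x₂ a) ∂(m₁.prod m₂) ≤ n * Q)
    (hcorr : ∫ a, x₁ a ⬝ᵥ x₂ a ∂(m₁.prod m₂) = ρ * (n * Q)) :
    2 * meanLog P (fun ω => t₁ (W₁ (X ω).1) (c.output₁ (X ω) + (Z ω).1)) +
        meanLog P (fun ω => t₂ (W₂ (X ω).2) (c.output₂ (X ω) + (Z ω).2)) ≤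
      r + Real.log (Fintype.card ι)
        + n / 2 * Real.log (1 + (hd ^ 2 + hc ^ 2 + 2 * ρ * (hd * hc)) * Q)
        + n / 2 * Real.log (condVar ((hd + hc) ^ 2) (hc ^ 2) (Q * (1 + ρ)) *
            condVar ((hd - hc) ^ 2) (hc ^ 2) (Q * (1 - ρ))) := by
  have hquad := integral_sqNorm_smul_add_smul_le hx₁ hx₂ h₁ h₂ hcorr
  have hQ₁ : 0 ≤ Q * (1 + ρ) := mul_nonneg hQ (neg_le_iff_add_nonneg'.1 hρ.1)
  have hQ₂ : 0 ≤ Q * (1 - ρ) := mul_nonneg hQ (sub_nonneg.2 hρ.2)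
  obtain ⟨v, hv₀, hv⟩ := exists_nnreal_eq_of_one_le
    (le_add_of_nonneg_right (a := 1) (mul_nonneg (sq_add_sq_add_mul_nonneg hρ hd hc) hQ))
  obtain ⟨l₁, hl₁₀, hl₁⟩ := exists_nnreal_eq_of_one_le
    (one_le_condVar (sq_nonneg (hd + hc)) (sq_nonneg hc) hQ₁)
  obtain ⟨l₂, hl₂₀, hl₂⟩ := exists_nnreal_eq_of_one_le
    (one_le_condVar (sq_nonneg (hd - hc)) (sq_nonneg hc) hQ₂)
  rw [← hv, ← hl₁, ← hl₂]
  have hmean : MemLp (fun a => hd • x₁ a + hc • x₂ a) 2 (m₁.prod m₂) :=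
    (hx₁.const_smul hd).add (hx₂.const_smul hc)
  have hout := le_meanLog_gaussPDF_output h hmean hv₀
    ((hquad hd hc).trans_eq (by rw [hv]; ring))
  have houts := le_meanLog_pairGaussPDF_estimate h hx₁ hx₂ hQ₁ hQ₂
    (by simpa using (hquad 1 1).trans_eq (by ring))
    (by simpa [← sub_eq_add_neg] using (hquad 1 (-1)).trans_eq (by ring)) hl₁ hl₂
  set b₁ := optGain (hd + hc) hc (Q * (1 + ρ))
  set b₂ := optGain (hd - hc) hc (Q * (1 - ρ))
  have hplog := logIntegrable_gaussPDF (m := fun _ => 0) hv₀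
    (by simpa only [sub_zero] using memLp_output h hmean)
  have hqlog := logIntegrable_pairGaussPDF_estimate h hx₁ hx₂ hl₁₀ hl₂₀ hd hc b₁ b₂
  have hq : Measurable fun y : ((Fin n → ℝ) × (Fin n → ℝ)) × (Fin n → ℝ) × (Fin n → ℝ) =>
      pairGaussPDF l₁ l₂ (estimate b₁ b₂ y.1) y.2 :=
    measurable_pairGaussPDF ((measurable_estimate b₁ b₂).comp measurable_fst) measurable_snd l₁ l₂
  simp only [← hx.outputs_eq, ← hx.interference_eq, ← hx.output₁_eq] at hout houts hplog hqlog
  have hmain := c.two_mul_meanLog_add_meanLog_le isNoise_stdNoise (hx.finitePower hx₁ hx₂) h hW₁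
    ht₁ ht₁log hW₂ ht₂ ht₂log hr hI (p := gaussPDF 0 v)
    (measurable_gaussPDF measurable_const measurable_id v) (lintegral_gaussPDF 0 hv₀).le hplog
    (q := fun s => pairGaussPDF l₁ l₂ (estimate b₁ b₂ s)) hq
    (fun s => (lintegral_pairGaussPDF hl₁₀ hl₂₀ _).le) hqlog
  rw [meanLog_stdNoise, meanLog_pairPDF_stdPDF] at hmain
  rw [Real.log_mul (by positivity) (by exact_mod_cast hv₀)] at hout
  linarith

end ConferencingChannel

/-! ### Codes as channels with conferencing transmitters -/

section Symbols

variable {N : ℕ} {size : ℕ → ℕ}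

/-- The link symbols sent before time `k`, in the format of `Code.transcript`. -/
def sentBefore (v : ∀ k : Fin N, Fin (size k)) (k : ℕ) : List ℕ :=
  (List.ofFn fun i => (v i : ℕ)).take k

theorem sentBefore_zero (v : ∀ k : Fin N, Fin (size k)) : sentBefore v 0 = [] := List.take_zero

theorem sentBefore_succ (v : ∀ k : Fin N, Fin (size k)) {k : ℕ} (hk : k < N) :
    sentBefore v (k + 1) = sentBefore v k ++ [(v ⟨k, hk⟩ : ℕ)] := by
  rw [sentBefore, List.take_succ_eq_append_getElem (by simpa using hk), List.getElem_ofFn]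
  rfl

end Symbols

namespace Code

variable {N M₁ M₂ : ℕ} (c : Code N M₁ M₂)

/-- The symbols exchanged over the two links during a block. -/
abbrev Links : Type := (∀ k : Fin N, Fin (c.size₁₂ k)) × (∀ k : Fin N, Fin (c.size₂₁ k))

/-- The link symbols that the two transmitters exchange when their data are `a₁` and `a₂`. -/
def links (a₁ : Fin M₁ × ℝ) (a₂ : Fin M₂ × ℝ) : c.Links :=
  (fun k => ⟨c.f₁₂ k a₁.1 a₁.2 (c.transcript a₁ a₂ k).2, c.f₁₂_lt _ _ _ _⟩,
   fun k => ⟨c.f₂₁ k a₂.1 a₂.2 (c.transcript a₁ a₂ k).1, c.f₂₁_lt _ _ _ _⟩)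

/-- The data with which transmitter 1 sends its part of the link symbols `v` when it receives the
other part. -/
def compatible₁ (v : c.Links) : Set (Fin M₁ × ℝ) :=
  {a | ∀ k : Fin N, c.f₁₂ k a.1 a.2 (sentBefore v.2 k) = v.1 k}

/-- The data with which transmitter 2 sends its part of the link symbols `v` when it receives the
other part. -/
def compatible₂ (v : c.Links) : Set (Fin M₂ × ℝ) :=
  {a | ∀ k : Fin N, c.f₂₁ k a.1 a.2 (sentBefore v.1 k) = v.2 k}

theorem transcript_eq_of_compatible {v : c.Links} {a₁ : Fin M₁ × ℝ} {a₂ : Fin M₂ × ℝ}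
    (h₁ : a₁ ∈ c.compatible₁ v) (h₂ : a₂ ∈ c.compatible₂ v) {k : ℕ} (hk : k ≤ N) :
    c.transcript a₁ a₂ k = (sentBefore v.1 k, sentBefore v.2 k) := by
  induction k with
  | zero => simp only [transcript, sentBefore_zero]
  | succ k ih =>
    simp only [transcript, ih (Nat.le_of_succ_le hk), sentBefore_succ _ hk, ← h₁ ⟨k, hk⟩,
      ← h₂ ⟨k, hk⟩]

theorem transcript_eq (a₁ : Fin M₁ × ℝ) (a₂ : Fin M₂ × ℝ) {k : ℕ} (hk : k ≤ N) :
    c.transcript a₁ a₂ k =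
      (sentBefore (c.links a₁ a₂).1 k, sentBefore (c.links a₁ a₂).2 k) := by
  induction k with
  | zero => simp only [transcript, sentBefore_zero]
  | succ k ih =>
    rw [sentBefore_succ _ hk, sentBefore_succ _ hk, transcript, ih (Nat.le_of_succ_le hk)]
    simp only [links, ih (Nat.le_of_succ_le hk)]

theorem links_eq_iff {a₁ : Fin M₁ × ℝ} {a₂ : Fin M₂ × ℝ} {v : c.Links} :
    c.links a₁ a₂ = v ↔ a₁ ∈ c.compatible₁ v ∧ a₂ ∈ c.compatible₂ v := by
  constructor
  · rintro rfl
    exact ⟨fun k => by simp only [links, c.transcript_eq a₁ a₂ k.2.le],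
      fun k => by simp only [links, c.transcript_eq a₁ a₂ k.2.le]⟩
  · rintro ⟨h₁, h₂⟩
    refine Prod.ext (funext fun k => Fin.ext ?_) (funext fun k => Fin.ext ?_)
    · simpa only [links, c.transcript_eq_of_compatible h₁ h₂ k.2.le] using h₁ k
    · simpa only [links, c.transcript_eq_of_compatible h₁ h₂ k.2.le] using h₂ k

theorem measurableSet_compatible₁ (v : c.Links) : MeasurableSet (c.compatible₁ v) := by
  rw [compatible₁, Set.ofPred_forall]
  exact MeasurableSet.iInter fun k =>
    measurable_from_prod_countable_right (fun w => c.measurable_f₁₂ k w (sentBefore v.2 k))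
      (measurableSet_singleton (v.1 k : ℕ))

theorem measurableSet_compatible₂ (v : c.Links) : MeasurableSet (c.compatible₂ v) := by
  rw [compatible₂, Set.ofPred_forall]
  exact MeasurableSet.iInter fun k =>
    measurable_from_prod_countable_right (fun w => c.measurable_f₂₁ k w (sentBefore v.1 k))
      (measurableSet_singleton (v.2 k : ℕ))

/-- The input block of transmitter 1 as a function of the link symbols and its own data. -/
def block₁ (v : c.Links) (a : Fin M₁ × ℝ) (k : Fin N) : ℝ :=
  c.x₁ k a.1 a.2 (sentBefore v.2 (k + 1))

/-- The input block of transmitter 2 as a function of the link symbols and its own data. -/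
def block₂ (v : c.Links) (a : Fin M₂ × ℝ) (k : Fin N) : ℝ :=
  c.x₂ k a.1 a.2 (sentBefore v.1 (k + 1))

theorem measurable_block₁ (v : c.Links) : Measurable (c.block₁ v) :=
  measurable_pi_lambda _ fun k =>
    measurable_from_prod_countable_right fun w => c.measurable_x₁ k w _

theorem measurable_block₂ (v : c.Links) : Measurable (c.block₂ v) :=
  measurable_pi_lambda _ fun k =>
    measurable_from_prod_countable_right fun w => c.measurable_x₂ k w _

/-- The interference channel, seen from the data (message and private randomness) of the
transmitters. -/
def channel (hd hc : ℝ) : ConferencingChannel (Fin M₁ × ℝ) (Fin M₂ × ℝ) c.Links (Fin N → ℝ) where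
  link := c.links
  fiber₁ := c.compatible₁
  fiber₂ := c.compatible₂
  measurableSet_fiber₁ := c.measurableSet_compatible₁
  measurableSet_fiber₂ := c.measurableSet_compatible₂
  link_eq_iff := c.links_eq_iff
  direct₁ v a := hd • c.block₁ v a
  direct₂ v a := hd • c.block₂ v a
  cross₁ v a := hc • c.block₁ v a
  cross₂ v a := hc • c.block₂ v a
  measurable_direct₁ v := (c.measurable_block₁ v).const_smul hd
  measurable_direct₂ v := (c.measurable_block₂ v).const_smul hd
  measurable_cross₁ v := (c.measurable_block₁ v).const_smul hc
  measurable_cross₂ v := (c.measurable_block₂ v).const_smul hc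

/-- The input block of transmitter 1 as a function of the data of the two transmitters. -/
def sent₁ (a : (Fin M₁ × ℝ) × (Fin M₂ × ℝ)) : Fin N → ℝ := c.block₁ (c.links a.1 a.2) a.1

/-- The input block of transmitter 2 as a function of the data of the two transmitters. -/
def sent₂ (a : (Fin M₁ × ℝ) × (Fin M₂ × ℝ)) : Fin N → ℝ := c.block₂ (c.links a.1 a.2) a.2

theorem measurable_sent₁ : Measurable c.sent₁ :=
  measurable_comp_of_countable c.measurable_block₁ (c.channel 0 0).measurable_link measurable_fst

theorem measurable_sent₂ : Measurable c.sent₂ :=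
  measurable_comp_of_countable c.measurable_block₂ (c.channel 0 0).measurable_link measurable_snd

theorem hasInputs_channel (hd hc : ℝ) : (c.channel hd hc).HasInputs hd hc c.sent₁ c.sent₂ where
  output₁_eq _ := rfl
  output₂_eq _ := rfl
  interference_eq _ := rfl

theorem input₁_eq (ω : Sample N M₁ M₂) : c.input₁ ω = c.sent₁ (ω.1, ω.2.1) :=
  funext fun k => by rw [input₁, c.transcript_eq ω.1 ω.2.1 k.2, sent₁, block₁]

theorem input₂_eq (ω : Sample N M₁ M₂) : c.input₂ ω = c.sent₂ (ω.1, ω.2.1) :=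
  funext fun k => by rw [input₂, c.transcript_eq ω.1 ω.2.1 k.2, sent₂, block₂]

theorem output₁_eq (hd hc : ℝ) (ω : Sample N M₁ M₂) :
    c.output₁ hd hc ω = (c.channel hd hc).output₁ (ω.1, ω.2.1) + ω.2.2.1 :=
  funext fun k => by rw [output₁, c.input₁_eq, c.input₂_eq]; rfl

theorem output₂_eq (hd hc : ℝ) (ω : Sample N M₁ M₂) :
    c.output₂ hd hc ω = (c.channel hd hc).output₂ (ω.1, ω.2.1) + ω.2.2.2 :=
  funext fun k => by rw [output₂, c.input₁_eq, c.input₂_eq]; rfl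

/-- The law of the message and the private randomness of transmitter 1. -/
def source₁ : Measure (Fin M₁ × ℝ) := (uniformOn (Set.univ : Set (Fin M₁))).prod c.ν₁

/-- The law of the message and the private randomness of transmitter 2. -/
def source₂ : Measure (Fin M₂ × ℝ) := (uniformOn (Set.univ : Set (Fin M₂))).prod c.ν₂

theorem measurePreserving_msg₁ :
    MeasurePreserving Prod.fst c.source₁ (uniformOn (Set.univ : Set (Fin M₁))) :=
  have := c.prob₁
  measurePreserving_fst

theorem measurePreserving_msg₂ :
    MeasurePreserving Prod.fst c.source₂ (uniformOn (Set.univ : Set (Fin M₂))) :=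
  have := c.prob₂
  measurePreserving_fst

instance [NeZero M₁] : IsProbabilityMeasure c.source₁ :=
  have := c.prob₁
  have := isProbabilityMeasure_uniformOn (s := (Set.univ : Set (Fin M₁))) Set.finite_univ
    Set.univ_nonempty
  inferInstanceAs (IsProbabilityMeasure ((uniformOn _).prod _))

instance [NeZero M₂] : IsProbabilityMeasure c.source₂ :=
  have := c.prob₂
  have := isProbabilityMeasure_uniformOn (s := (Set.univ : Set (Fin M₂))) Set.finite_univ
    Set.univ_nonempty
  inferInstanceAs (IsProbabilityMeasure ((uniformOn _).prod _))

theorem measurePreserving_sample [NeZero M₂] :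
    MeasurePreserving (fun ω : Sample N M₁ M₂ => ((ω.1, ω.2.1), ω.2.2)) c.law
      ((c.source₁.prod c.source₂).prod ((stdNoise N).prod (stdNoise N))) :=
  (measurePreserving_prodAssoc c.source₁ c.source₂ ((stdNoise N).prod (stdNoise N))).symm

end Code

section Power

variable {A : Type*} [MeasurableSpace A] {μ : Measure A} {n : ℕ} {x : A → Fin n → ℝ} {r : ℝ}

theorem memLp_two_of_sum_lintegral_sq_le (hx : Measurable x)
    (h : ∑ k, ∫⁻ a, ENNReal.ofReal (x a k ^ 2) ∂μ ≤ ENNReal.ofReal r) : MemLp x 2 μ := by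
  refine MemLp.of_eval fun k => ?_
  have hk : Measurable fun a => x a k := (measurable_pi_apply k).comp hx
  refine (memLp_two_iff_integrable_sq hk.aestronglyMeasurable).2
    ⟨(hk.pow_const 2).aestronglyMeasurable, ?_⟩
  rw [hasFiniteIntegral_iff_ofReal (ae_of_all μ fun a => sq_nonneg _)]
  exact ((Finset.single_le_sum_of_canonicallyOrdered (Finset.mem_univ k)).trans h).trans_lt
    ENNReal.ofReal_lt_top

theorem integral_sqNorm_le_of_sum_lintegral_sq_le (hx : Measurable x) (hr : 0 ≤ r)
    (h : ∑ k, ∫⁻ a, ENNReal.ofReal (x a k ^ 2) ∂μ ≤ ENNReal.ofReal r) :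
    ∫ a, sqNorm (x a) ∂μ ≤ r := by
  have hk : ∀ k, Measurable fun a => x a k := fun k => (measurable_pi_apply k).comp hx
  rw [integral_eq_lintegral_of_nonneg_ae (ae_of_all μ fun a => sqNorm_nonneg _)
    (integrable_sqNorm_of_memLp (memLp_two_of_sum_lintegral_sq_le hx h)).aestronglyMeasurable]
  refine ENNReal.toReal_le_of_le_ofReal hr (le_of_eq_of_le ?_ h)
  simp only [sqNorm_eq_sum, ENNReal.ofReal_sum_of_nonneg fun _ _ => sq_nonneg _]
  exact lintegral_finsetSum _ fun k _ => ((hk k).pow_const 2).ennreal_ofReal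

end Power

namespace Code

variable {N M₁ M₂ : ℕ} (c : Code N M₁ M₂)

theorem size₁₂_pos [NeZero M₁] (k : ℕ) : 0 < c.size₁₂ k :=
  (Nat.zero_le _).trans_lt (c.f₁₂_lt k 0 0 [])

theorem size₂₁_pos [NeZero M₂] (k : ℕ) : 0 < c.size₂₁ k :=
  (Nat.zero_le _).trans_lt (c.f₂₁_lt k 0 0 [])

variable {c}

theorem LinkConstraint.log_card_links_le [NeZero M₁] [NeZero M₂] {CG : ℝ}
    (h : c.LinkConstraint CG) :
    Real.log (Fintype.card c.Links) ≤ 2 * N * CG * Real.log 2 := by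
  have h₁₂ : ∀ k : Fin N, (c.size₁₂ k : ℝ) ≠ 0 := fun k => by exact_mod_cast (c.size₁₂_pos k).ne'
  have h₂₁ : ∀ k : Fin N, (c.size₂₁ k : ℝ) ≠ 0 := fun k => by exact_mod_cast (c.size₂₁_pos k).ne'
  have hcard : (Fintype.card c.Links : ℝ) =
      (∏ k : Fin N, (c.size₁₂ k : ℝ)) * ∏ k : Fin N, (c.size₂₁ k : ℝ) := by
    simp only [Fintype.card_prod, Fintype.card_pi, Fintype.card_fin, Nat.cast_mul, Nat.cast_prod]
  obtain ⟨hsum₁₂, hsum₂₁⟩ := h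
  simp only [Real.logb, ← Finset.sum_div, Finset.sum_range, div_le_iff₀ (Real.log_pos one_lt_two)]
    at hsum₁₂ hsum₂₁
  rw [hcard, Real.log_mul (Finset.prod_ne_zero_iff.2 fun k _ => h₁₂ k)
    (Finset.prod_ne_zero_iff.2 fun k _ => h₂₁ k), Real.log_prod fun k _ => h₁₂ k,
    Real.log_prod fun k _ => h₂₁ k]
  linarith

variable (c)

theorem measurePreserving_sources [NeZero M₂] :
    MeasurePreserving (fun ω : Sample N M₁ M₂ => (ω.1, ω.2.1)) c.law (c.source₁.prod c.source₂) :=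
  measurePreserving_fst.comp c.measurePreserving_sample

instance [NeZero M₁] [NeZero M₂] : IsProbabilityMeasure c.law :=
  inferInstanceAs (IsProbabilityMeasure (c.source₁.prod (c.source₂.prod ((stdNoise N).prod
    (stdNoise N)))))

theorem measurable_output₁ (hd hc : ℝ) : Measurable (c.output₁ hd hc) := by
  rw [funext (c.output₁_eq hd hc)]
  exact ((c.channel hd hc).measurable_output₁.comp
    (measurable_fst.prodMk measurable_snd.fst)).add measurable_snd.snd.fst

theorem measurable_output₂ (hd hc : ℝ) : Measurable (c.output₂ hd hc) := by
  rw [funext (c.output₂_eq hd hc)]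
  exact ((c.channel hd hc).measurable_output₂.comp
    (measurable_fst.prodMk measurable_snd.fst)).add measurable_snd.snd.snd

variable {c} {P : ℝ}

theorem PowerConstraint.sum_lintegral_sent₁_le [NeZero M₂] (h : c.PowerConstraint P) :
    ∑ k, ∫⁻ a, ENNReal.ofReal (c.sent₁ a k ^ 2) ∂(c.source₁.prod c.source₂) ≤
      ENNReal.ofReal (N * P) := by
  refine le_of_eq_of_le (Finset.sum_congr rfl fun k _ => ?_) h.1
  simp only [c.input₁_eq]
  exact (c.measurePreserving_sources.lintegral_comp
    ((measurable_pi_apply k).comp c.measurable_sent₁ |>.pow_const 2).ennreal_ofReal).symm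

theorem PowerConstraint.sum_lintegral_sent₂_le [NeZero M₂] (h : c.PowerConstraint P) :
    ∑ k, ∫⁻ a, ENNReal.ofReal (c.sent₂ a k ^ 2) ∂(c.source₁.prod c.source₂) ≤
      ENNReal.ofReal (N * P) := by
  refine le_of_eq_of_le (Finset.sum_congr rfl fun k _ => ?_) h.2
  simp only [c.input₂_eq]
  exact (c.measurePreserving_sources.lintegral_comp
    ((measurable_pi_apply k).comp c.measurable_sent₂ |>.pow_const 2).ennreal_ofReal).symm

theorem exists_correlation_log_card_le [NeZero M₁] [NeZero M₂] {hd hc CG ε : ℝ} (hP : 0 ≤ P)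
    (hε : 0 ≤ ε) (hL : c.LinkConstraint CG) (hpow : c.PowerConstraint P)
    (hrel : c.Reliable hd hc ε) (hsec : c.WeaklySecret hd hc ε) :
    ∃ ρ ∈ Set.Icc (-1 : ℝ) 1,
      (1 - ε) * (2 * Real.log M₁ + Real.log M₂) - 3 * Real.log 2 ≤
        N * ε * Real.log 2 + 2 * N * CG * Real.log 2
          + N / 2 * Real.log (1 + (hd ^ 2 + hc ^ 2 + 2 * ρ * (hd * hc)) * P)
          + N / 2 * Real.log (condVar ((hd + hc) ^ 2) (hc ^ 2) (P * (1 + ρ)) *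
              condVar ((hd - hc) ^ 2) (hc ^ 2) (P * (1 - ρ))) := by
  have hNP : (0 : ℝ) ≤ N * P := by positivity
  have hr : (0 : ℝ) ≤ N * ε * Real.log 2 := by positivity
  have hx₁ := memLp_two_of_sum_lintegral_sq_le c.measurable_sent₁ hpow.sum_lintegral_sent₁_le
  have hx₂ := memLp_two_of_sum_lintegral_sq_le c.measurable_sent₂ hpow.sum_lintegral_sent₂_le
  have h₁ := integral_sqNorm_le_of_sum_lintegral_sq_le c.measurable_sent₁ hNP
    hpow.sum_lintegral_sent₁_le
  have h₂ := integral_sqNorm_le_of_sum_lintegral_sq_le c.measurable_sent₂ hNP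
    hpow.sum_lintegral_sent₂_le
  obtain ⟨ρ, hρ, hcorr⟩ := exists_correlation hx₁ hx₂ h₁ h₂
  refine ⟨ρ, hρ, ?_⟩
  have hmsg₁ : Measurable (msg₁ : Sample N M₁ M₂ → Fin M₁) := measurable_fst.fst
  have hmsg₂ : Measurable (msg₂ : Sample N M₁ M₂ → Fin M₂) := measurable_snd.fst.fst
  have hY₁ := c.measurable_output₁ hd hc
  have hY₂ := c.measurable_output₂ hd hc
  have hlog₁ := logIntegrable_decodeTest (P := c.law) c.measurable_dec₁ hmsg₁ hY₁
  have hlog₂ := logIntegrable_decodeTest (P := c.law) c.measurable_dec₂ hmsg₂ hY₂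
  have hfano₁ := le_meanLog_decodeTest c.measurable_dec₁ hmsg₁ hY₁ hε hrel.1
  have hfano₂ := le_meanLog_decodeTest c.measurable_dec₂ hmsg₂ hY₂ hε hrel.2
  have hI := hsec.1
  rw [funext (c.output₁_eq hd hc)] at hlog₁ hfano₁
  rw [funext (c.output₂_eq hd hc)] at hlog₂ hfano₂ hI
  have hmain := (c.hasInputs_channel hd hc).two_mul_meanLog_add_meanLog_le hx₁ hx₂
    c.measurePreserving_sample measurable_fst
    (isTest_decodeTest c.measurable_dec₁ c.measurePreserving_msg₁) hlog₁ measurable_fst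
    (isTest_decodeTest c.measurable_dec₂ c.measurePreserving_msg₂) hlog₂ hr hI hP hρ h₁ h₂ hcorr
  have hcard := hL.log_card_links_le
  simp only [Fintype.card_fin] at hfano₁ hfano₂
  simp only [msg₁, msg₂] at hfano₁ hfano₂
  linarith

end Code

/-! ### The outer bound -/

/-- The outer bound on the symmetric rate in terms of the gains and the correlation `ρ` of the
inputs. It factors the determinant in `outerBound` along the sum and the difference of the two
users, and keeps track of the signs of the gains. -/
def gainBound (CG hd hc P ρ : ℝ) : ℝ :=
  (1 / 3) * (2 * CG + (1 / 2) * Real.logb 2 (1 + (hd ^ 2 + hc ^ 2 + 2 * ρ * (hd * hc)) * P)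
    + (1 / 2) * Real.logb 2 (condVar ((hd + hc) ^ 2) (hc ^ 2) (P * (1 + ρ)) *
        condVar ((hd - hc) ^ 2) (hc ^ 2) (P * (1 - ρ))))

theorem three_mul_gainBound_mul_log_two (CG hd hc P ρ : ℝ) :
    3 * gainBound CG hd hc P ρ * Real.log 2 =
      2 * CG * Real.log 2 + 1 / 2 * Real.log (1 + (hd ^ 2 + hc ^ 2 + 2 * ρ * (hd * hc)) * P)
        + 1 / 2 * Real.log (condVar ((hd + hc) ^ 2) (hc ^ 2) (P * (1 + ρ)) *
            condVar ((hd - hc) ^ 2) (hc ^ 2) (P * (1 - ρ))) := by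
  have := (Real.log_pos one_lt_two).ne'
  rw [gainBound, Real.logb, Real.logb]
  field_simp

theorem gainBound_neg_left (CG hd hc P ρ : ℝ) :
    gainBound CG (-hd) hc P ρ = gainBound CG hd hc P (-ρ) := by
  rw [gainBound, gainBound, neg_add_eq_sub, ← neg_add', neg_sq, neg_sq, ← neg_sub, neg_sq,
    sub_neg_eq_add, ← sub_eq_add_neg, mul_comm (condVar ((hd - hc) ^ 2) _ _), neg_mul, mul_neg,
    mul_neg, neg_mul]

theorem gainBound_neg_right (CG hd hc P ρ : ℝ) :
    gainBound CG hd (-hc) P ρ = gainBound CG hd hc P (-ρ) := by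
  rw [gainBound, gainBound, ← sub_eq_add_neg, sub_neg_eq_add, neg_sq, sub_neg_eq_add,
    ← sub_eq_add_neg, mul_comm (condVar ((hd - hc) ^ 2) _ _), mul_neg, mul_neg, mul_neg, neg_mul]

theorem exists_gainBound_abs_eq (CG hd hc P : ℝ) {ρ : ℝ} (hρ : ρ ∈ Set.Icc (-1 : ℝ) 1) :
    ∃ ρ' ∈ Set.Icc (-1 : ℝ) 1, gainBound CG |hd| |hc| P ρ' = gainBound CG hd hc P ρ := by
  have hneg : -ρ ∈ Set.Icc (-1 : ℝ) 1 := ⟨neg_le_neg hρ.2, neg_le.1 hρ.1⟩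
  rcases abs_choice hd with hd' | hd' <;> rcases abs_choice hc with hc' | hc' <;> rw [hd', hc']
  · exact ⟨ρ, hρ, rfl⟩
  · exact ⟨-ρ, hneg, by rw [gainBound_neg_right, neg_neg]⟩
  · exact ⟨-ρ, hneg, by rw [gainBound_neg_left, neg_neg]⟩
  · exact ⟨ρ, hρ, by rw [gainBound_neg_left, gainBound_neg_right, neg_neg]⟩

theorem continuousOn_condVar {H B : ℝ} (hB : 0 ≤ B) :
    ContinuousOn (condVar H B) (Set.Ici 0) := by
  unfold condVar
  refine continuousOn_const.add (ContinuousOn.div (by fun_prop) (by fun_prop) fun Q hQ => ?_)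
  have : 0 ≤ B * Q := mul_nonneg hB hQ
  positivity

theorem continuousOn_gainBound (CG hd hc : ℝ) {P : ℝ} (hP : 0 ≤ P) :
    ContinuousOn (gainBound CG hd hc P) (Set.Icc (-1) 1) := by
  have hQ₁ : Set.MapsTo (fun ρ => P * (1 + ρ)) (Set.Icc (-1) 1) (Set.Ici 0) := fun ρ hρ =>
    mul_nonneg hP (neg_le_iff_add_nonneg'.1 hρ.1)
  have hQ₂ : Set.MapsTo (fun ρ => P * (1 - ρ)) (Set.Icc (-1) 1) (Set.Ici 0) := fun ρ hρ =>
    mul_nonneg hP (sub_nonneg.2 hρ.2)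
  have hvar₁ : ContinuousOn (fun ρ => condVar ((hd + hc) ^ 2) (hc ^ 2) (P * (1 + ρ)))
      (Set.Icc (-1) 1) := (continuousOn_condVar (sq_nonneg hc)).comp (by fun_prop) hQ₁
  have hvar₂ : ContinuousOn (fun ρ => condVar ((hd - hc) ^ 2) (hc ^ 2) (P * (1 - ρ)))
      (Set.Icc (-1) 1) := (continuousOn_condVar (sq_nonneg hc)).comp (by fun_prop) hQ₂
  have hlog₁ : ContinuousOn (fun ρ => Real.logb 2 (1 + (hd ^ 2 + hc ^ 2 + 2 * ρ * (hd * hc)) * P))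
      (Set.Icc (-1) 1) := by
    refine (ContinuousOn.log (by fun_prop) fun ρ hρ => ?_).div_const _
    have := sq_add_sq_add_mul_nonneg hρ hd hc
    positivity
  have hlog₂ : ContinuousOn (fun ρ => Real.logb 2 (condVar ((hd + hc) ^ 2) (hc ^ 2) (P * (1 + ρ)) *
      condVar ((hd - hc) ^ 2) (hc ^ 2) (P * (1 - ρ)))) (Set.Icc (-1) 1) := by
    refine ((hvar₁.mul hvar₂).log fun ρ hρ => (mul_pos ?_ ?_).ne').div_const _
    · exact zero_lt_one.trans_le (one_le_condVar (sq_nonneg _) (sq_nonneg _) (hQ₁ hρ))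
    · exact zero_lt_one.trans_le (one_le_condVar (sq_nonneg _) (sq_nonneg _) (hQ₂ hρ))
  unfold gainBound
  fun_prop

-- The matrices involved are all diagonal in the basis `(1, 1)`, `(1, -1)`.
theorem det_sub_mul_inv_mul_transpose {a b s t y z : ℝ} (hadd : a + b ≠ 0) (hsub : a - b ≠ 0) :
    (!![y, z; z, y] - !![s, t; t, s] * (!![a, b; b, a])⁻¹ * (!![s, t; t, s]).transpose).det =
      (y + z - (s + t) ^ 2 / (a + b)) * (y - z - (s - t) ^ 2 / (a - b)) := by
  have hdet : a * a - b * b = (a + b) * (a - b) := by ring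
  have htr : (!![s, t; t, s]).transpose = !![s, t; t, s] := by
    ext i j
    fin_cases i <;> fin_cases j <;> rfl
  rw [htr, Matrix.inv_def, Matrix.det_fin_two_of, Ring.inverse_eq_inv', Matrix.adjugate_fin_two_of,
    hdet, mul_smul_comm, smul_mul_assoc, Matrix.mul_fin_two, Matrix.mul_fin_two,
    Matrix.det_fin_two]
  simp only [Matrix.sub_apply, Matrix.smul_apply, Matrix.of_apply, Matrix.cons_val_zero,
    Matrix.cons_val_one, Matrix.cons_val', Matrix.cons_val_fin_one, smul_eq_mul]
  field_simp
  ring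

theorem outerBound_eq_gainBound (CG : ℝ) {hd hc P ρ : ℝ} (hP : 0 ≤ P)
    (hρ : ρ ∈ Set.Icc (-1 : ℝ) 1) :
    outerBound CG (hd ^ 2 * P) (hc ^ 2 * P) ρ = gainBound CG |hd| |hc| P ρ := by
  rw [← sq_abs hd, ← sq_abs hc]
  generalize hu : |hd| = u
  generalize hw : |hc| = w
  have hsqrt : √(u ^ 2 * P * (w ^ 2 * P)) = u * w * P := by
    rw [show u ^ 2 * P * (w ^ 2 * P) = (u * w * P) ^ 2 by ring, Real.sqrt_sq]
    rw [← hu, ← hw]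
    positivity
  have hpos₁ : 0 < 1 + w ^ 2 * (P * (1 + ρ)) := by
    have := mul_nonneg hP (neg_le_iff_add_nonneg'.1 hρ.1)
    positivity
  have hpos₂ : 0 < 1 + w ^ 2 * (P * (1 - ρ)) := by
    have := mul_nonneg hP (sub_nonneg.2 hρ.2)
    positivity
  have hadd : 1 + w ^ 2 * P + ρ * (w ^ 2 * P) = 1 + w ^ 2 * (P * (1 + ρ)) := by ring
  have hsub : 1 + w ^ 2 * P - ρ * (w ^ 2 * P) = 1 + w ^ 2 * (P * (1 - ρ)) := by ring
  rw [outerBound, sigmaYgivenS, sigmaY, sigmaYS, sigmaS, det_sub_mul_inv_mul_transpose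
    (hadd ▸ hpos₁.ne') (hsub ▸ hpos₂.ne'), hsqrt, hadd, hsub, gainBound, condVar_eq hpos₁.ne',
    condVar_eq hpos₂.ne']
  ring_nf

theorem continuousOn_outerBound (CG hd hc : ℝ) {P : ℝ} (hP : 0 ≤ P) :
    ContinuousOn (outerBound CG (hd ^ 2 * P) (hc ^ 2 * P)) (Set.Icc (-1) 1) :=
  (continuousOn_gainBound CG |hd| |hc| hP).congr fun _ hρ => outerBound_eq_gainBound CG hP hρ

/-! ### Achievable rates -/

theorem Code.exists_rate_le_outerBound {N M₁ M₂ : ℕ} [NeZero N] [NeZero M₁] [NeZero M₂]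
    {c : Code N M₁ M₂} {hd hc P CG ε R₁ R₂ : ℝ} (hP : 0 ≤ P) (hε : 0 ≤ ε) (hε₁ : ε ≤ 1)
    (hL : c.LinkConstraint CG) (hpow : c.PowerConstraint P) (hrel : c.Reliable hd hc ε)
    (hsec : c.WeaklySecret hd hc ε) (hR₁ : N * R₁ ≤ Real.logb 2 M₁)
    (hR₂ : N * R₂ ≤ Real.logb 2 M₂) :
    ∃ ρ ∈ Set.Icc (-1 : ℝ) 1, (1 - ε) * (2 * R₁ + R₂) - 3 / N - ε ≤
      3 * outerBound CG (hd ^ 2 * P) (hc ^ 2 * P) ρ := by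
  obtain ⟨ρ, hρ, hnats⟩ := exists_correlation_log_card_le hP hε hL hpow hrel hsec
  obtain ⟨ρ', hρ', hgain⟩ := exists_gainBound_abs_eq CG hd hc P hρ
  refine ⟨ρ', hρ', ?_⟩
  have hlog2 : 0 < Real.log 2 := Real.log_pos one_lt_two
  have hN : (0 : ℝ) < N := by exact_mod_cast NeZero.pos N
  rw [Real.logb, le_div_iff₀ hlog2] at hR₁ hR₂
  have hrates : (1 - ε) * (2 * (N * R₁ * Real.log 2) + N * R₂ * Real.log 2) ≤
      (1 - ε) * (2 * Real.log M₁ + Real.log M₂) :=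
    mul_le_mul_of_nonneg_left (by linarith) (sub_nonneg.2 hε₁)
  rw [outerBound_eq_gainBound CG hP hρ', hgain]
  refine le_of_mul_le_mul_left ?_ (mul_pos hN hlog2)
  calc N * Real.log 2 * ((1 - ε) * (2 * R₁ + R₂) - 3 / N - ε)
      = (1 - ε) * (2 * (N * R₁ * Real.log 2) + N * R₂ * Real.log 2) - 3 * Real.log 2
          - N * ε * Real.log 2 := by field_simp
    _ ≤ N * (3 * gainBound CG hd hc P ρ * Real.log 2) := by
      rw [three_mul_gainBound_mul_log_two]
      linarith
    _ = N * Real.log 2 * (3 * gainBound CG hd hc P ρ) := by ring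

theorem Achievable.two_mul_add_le {hd hc P CG R₁ R₂ B : ℝ} (h : Achievable hd hc P CG R₁ R₂)
    (hP : 0 ≤ P)
    (hB : ∀ ρ ∈ Set.Icc (-1 : ℝ) 1, outerBound CG (hd ^ 2 * P) (hc ^ 2 * P) ρ ≤ B) :
    2 * R₁ + R₂ ≤ 3 * B := by
  have hlim : Filter.Tendsto (fun ε : ℝ => (1 - ε) * (2 * (R₁ - ε) + (R₂ - ε)) - ε - ε)
      (nhdsWithin 0 (Set.Ioi 0)) (nhds (2 * R₁ + R₂)) := by
    refine Filter.Tendsto.mono_left (Continuous.tendsto' (by fun_prop) _ _ ?_) nhdsWithin_le_nhds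
    ring
  refine le_of_tendsto hlim ?_
  filter_upwards [Ioc_mem_nhdsGT (zero_lt_one (α := ℝ))] with ε ⟨hε, hε₁⟩
  obtain ⟨N, ⟨⟨M₁, M₂, hM₁, hM₂, hR₁, hR₂, c, hL, hpow, hrel, hsec⟩, hN⟩, hNε⟩ :=
    (((h ε hε).and (Filter.eventually_gt_atTop 0)).and
      ((tendsto_const_div_atTop_nhds_zero_nat (3 : ℝ)).eventually_lt_const hε)).exists
  have : NeZero N := ⟨hN.ne'⟩
  have : NeZero M₁ := ⟨hM₁.ne'⟩
  have : NeZero M₂ := ⟨hM₂.ne'⟩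
  obtain ⟨ρ, hρ, hrate⟩ :=
    Code.exists_rate_le_outerBound hP hε.le hε₁ hL hpow hrel hsec hR₁ hR₂
  linarith [hB ρ hρ]

end GSIC

end

theorem theorem7_general (hd hc CG : ℝ) {P : ℝ} (hP : 0 ≤ P) :
    ∃ B : ℝ,
      IsGreatest
        ((fun ρ : ℝ => GSIC.outerBound CG (hd ^ 2 * P) (hc ^ 2 * P) ρ) '' Set.Icc (-1) 1) B ∧
      ∀ R₁ R₂ : ℝ, GSIC.Achievable hd hc P CG R₁ R₂ → 2 * R₁ + R₂ ≤ 3 * B := by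
  obtain ⟨ρ, hρ, hmax⟩ := isCompact_Icc.exists_isMaxOn (Set.nonempty_Icc.2 (by norm_num))
    (GSIC.continuousOn_outerBound CG hd hc hP)
  exact ⟨_, ⟨Set.mem_image_of_mem _ hρ, Set.forall_mem_image.2 fun _ h => hmax h⟩,
    fun R₁ R₂ hR => hR.two_mul_add_le hP fun _ h => hmax h⟩

theorem theorem7 (hd hc P CG : ℝ) (hP : 0 ≤ P) (hCG : 0 ≤ CG) :
    ∃ B : ℝ,
      IsGreatest
        ((fun ρ : ℝ => GSIC.outerBound CG (hd ^ 2 * P) (hc ^ 2 * P) ρ) '' Set.Icc (-1) 1) B ∧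
      ∀ R : ℝ, GSIC.SymmetricAchievable hd hc P CG R → R ≤ B := by
  obtain ⟨B, hB, hR⟩ := theorem7_general hd hc CG hP
  exact ⟨B, hB, fun R h => by linarith [hR R R h]⟩
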